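/- Let $n\ge 3$. Let $Cl_n$ be the Clifford algebra generated by $\mathbb R^n$ with $x^2=-\|x\|^2$, with basis $e_A=e_{\alpha_1}\cdots e_{\alpha_h}$ ($A=\{\alpha_1<\dots<\alpha_h\}\subseteq\{1,\dots,n\}$) and norm $\|\sum_A a_Ae_A\|=(\sum_A a_A^2)^{1/2}$, and let $Cl_{n-1}\subset Cl_n$ be generated by $\mathbb R^{n-1}=\mathrm{span}(e_1,\dots,e_{n-1})$. Write $\tilde A$ for the reversion, $\widetilde{AB}=\tilde B\tilde A$, $\tilde e_j=e_j$. Every $A\in Cl_n$ is uniquely $A=B+Ce_n$ with $B,C\in Cl_{n-1}$; put $\hat A=B-Ce_n$, $Q(A)=C$, $Q'(A)=-e_nQ(A)e_n$. Let $\mathbb R^{n,+}=\{x\in\mathbb R^n:x_n>0\}$. For an open set $U\subseteq\mathbb R^{n,+}$, a differentiable function $f:U\to Cl_n$ is called left hypermonogenic if $$Mf=\sum_{j=1}^n e_j\frac{\partial f}{\partial x_j}+\frac{n-2}{x_n}Q'(f)=0\quad\text{on }U.$$ Let $\psi(u)=(au+b)(cu+d)^{-1}$ be a Möbius transformation that leaves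 $\mathbb R^{n,+}$ invariant, where $a,b,c,d$ are products of vectors of $\mathbb R^{n-1}$ (possibly empty or zero), $\tilde ac,\ \tilde cd,\ \tilde db,\ \tilde ba\in\mathbb R^{n-1}$ and $\tilde ad-\tilde cb=\pm1$. Put $J(\psi,u)=\dfrac{\widetilde{cu+d}}{\|cu+d\|^2}$. Let $f$ be left hypermonogenic on the open set $U\subseteq\mathbb R^{n,+}$, and let $K\subset U$ be compact with $C^1$ boundary (near each of its boundary points $K$ is $\{\rho\le0\}$ for a $C^1$ function $\rho$ with non-vanishing gradient). Let $\psi^{-1}(K)=\{u\in\mathbb R^{n,+}:\psi(u)\in K\}$, let $n(u)$ be its outer unit normal, $\sigma$ the surface measure, and $\omega_n$ the surface area of the unit sphere of $\mathbb R^n$. Then for every $v$ in the interior of $\psi^{-1}(K)$ the following integrand is integrable and $$J(\psi,v)f(\psi(v))=\frac{2^{n-2}v_n^{n-2}}{\omega_n}\int_{\partial\psi^{-1}(K)}\Big(E(u,v)\,n(u)\,J(\psi,u)f(\psi(u))-F(u,v)\,\hat n(u)\,\hat J(\psi,u)\hat f(\psi(u))\Big)\,d\sigma(u),$$ where $\hat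 J(\psi,u)$ and $\hat f(\psi(u))$ are the images of $J(\psi,u)$ and $f(\psi(u))$ under $A\mapsto\hat A$, and $$E(u,v)=\frac{(u-v)^{-1}}{\|u-v\|^{n-2}\|u-\hat v\|^{n-2}},\qquad F(u,v)=\frac{(\hat u-v)^{-1}}{\|u-v\|^{n-2}\|\hat u-v\|^{n-2}}.$$ -/

import Mathlib

open MeasureTheory Set

noncomputable section

/-! ### Euclidean space and the Clifford algebra -/

/-- Euclidean space `R^n`. -/
abbrev Rn (n : ℕ) : Type := EuclideanSpace ℝ (Fin n)

/-- The negative definite quadratic form `x ↦ -‖x‖^2` on `R^n`. -/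
def negForm (n : ℕ) : QuadraticForm ℝ (Rn n) :=
  -(LinearMap.BilinMap.toQuadraticMap (innerₗ (Rn n)))

theorem negForm_apply {n : ℕ} (x : Rn n) : negForm n x = -‖x‖ ^ 2 := by
  simp [negForm]

/-- The Clifford algebra `Cl_n`, generated by `R^n` with `x * x = -‖x‖^2`. -/
abbrev Cl (n : ℕ) : Type := CliffordAlgebra (negForm n)

/-- The inclusion of vectors `R^n ⊆ Cl_n`. -/
abbrev vec {n : ℕ} : Rn n →ₗ[ℝ] Cl n := CliffordAlgebra.ι (negForm n)

/-- The standard basis vector `e_j` of `R^n`. -/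
abbrev stdVec {n : ℕ} (j : Fin n) : Rn n := EuclideanSpace.single j 1

/-- The generator `e_j` of `Cl_n`. -/
abbrev gen {n : ℕ} (j : Fin n) : Cl n := vec (stdVec j)

/-- The basis of `Cl_n` indexed by the subsets of `{1, …, n}`; see `cliffordBasis_apply`. -/
def cliffordBasis (n : ℕ) : Module.Basis (Finset (Fin n)) ℝ (Cl n) :=
  (Module.Basis.ExteriorAlgebra (EuclideanSpace.basisFun (Fin n) ℝ).toBasis).map
    (CliffordAlgebra.equivExterior (negForm n)).symm

theorem associated_stdVec {n : ℕ} {i j : Fin n} (h : i ≠ j) :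
    QuadraticMap.associated (R := ℝ) (-negForm n) (stdVec i) (stdVec j) = 0 := by
  have h0 : inner ℝ (stdVec i) (stdVec j) = 0 := by
    simp [stdVec, EuclideanSpace.inner_single_left, h]
  have h1 := norm_add_sq_real (stdVec i) (stdVec j)
  rw [h0] at h1
  rw [QuadraticMap.associated_apply]
  simp only [neg_apply, negForm_apply, neg_neg]
  rw [h1]
  simp

theorem contractLeft_prod_eq_zero {n : ℕ} (d : Module.Dual ℝ (Rn n)) (l : List (Fin n))
    (hl : ∀ j ∈ l, d (stdVec j) = 0) :
    CliffordAlgebra.contractLeft d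
      (l.map (fun j => CliffordAlgebra.ι (0 : QuadraticForm ℝ (Rn n)) (stdVec j))).prod = 0 := by
  induction l with
  | nil => simp [CliffordAlgebra.contractLeft_one]
  | cons i l ih =>
    rw [List.map_cons, List.prod_cons, CliffordAlgebra.contractLeft_ι_mul,
      ih fun j hj => hl j (List.mem_cons_of_mem _ hj), hl i List.mem_cons_self]
    simp

theorem equivExterior_prod {n : ℕ} (l : List (Fin n)) (hl : l.Nodup) :
    CliffordAlgebra.equivExterior (negForm n) (l.map gen).prod =
      (l.map (fun j => ExteriorAlgebra.ι ℝ (stdVec j))).prod := by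
  induction l with
  | nil => simp
  | cons i l ih =>
    rw [List.nodup_cons] at hl
    have ih' := ih hl.2
    simp only [CliffordAlgebra.equivExterior, CliffordAlgebra.changeFormEquiv_apply] at ih' ⊢
    rw [List.map_cons, List.prod_cons, CliffordAlgebra.changeForm_ι_mul, ih', List.map_cons,
      List.prod_cons]
    refine (sub_eq_self).2 (contractLeft_prod_eq_zero _ l fun j hj => ?_)
    exact associated_stdVec fun h => hl.1 (h ▸ hj)

/-- The basis element of `Cl_n` attached to `A = {α_1 < … < α_h}` is `e_{α_1} ⋯ e_{α_h}`. -/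
theorem cliffordBasis_apply {n : ℕ} (A : Finset (Fin n)) :
    cliffordBasis n A = ((A.sort (· ≤ ·)).map gen).prod := by
  rw [cliffordBasis, Module.Basis.map_apply, LinearEquiv.symm_apply_eq,
    equivExterior_prod _ (Finset.sort_nodup _ _), ExteriorAlgebra.basis_apply]
  refine (ExteriorAlgebra.ιMulti_apply (R := ℝ) _).trans ?_
  congr 1
  refine List.ext_getElem (by simp) fun k h1 h2 => ?_
  simp [Set.powersetCard.ofFinEmbEquiv_symm_apply, Finset.orderEmbOfFin]
  rfl

/-- The coordinates of an element of `Cl_n` with respect to the basis `e_A`. -/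
def cliffordCoords (n : ℕ) : Cl n ≃ₗ[ℝ] EuclideanSpace ℝ (Finset (Fin n)) :=
  (cliffordBasis n).equivFun.trans (WithLp.linearEquiv 2 ℝ (Finset (Fin n) → ℝ)).symm

/-- The norm `‖A‖ = (∑ a_A ^ 2)^{1/2}` on `Cl_n`. -/
instance instNormedAddCommGroupCl (n : ℕ) : NormedAddCommGroup (Cl n) :=
  NormedAddCommGroup.induced (Cl n) (EuclideanSpace ℝ (Finset (Fin n)))
    (cliffordCoords n).toLinearMap (cliffordCoords n).injective

instance instNormedSpaceCl (n : ℕ) : NormedSpace ℝ (Cl n) :=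
  NormedSpace.induced ℝ (Cl n) (EuclideanSpace ℝ (Finset (Fin n))) (cliffordCoords n).toLinearMap

theorem cl_norm_eq {n : ℕ} (A : Cl n) :
    ‖A‖ = Real.sqrt (∑ s, ((cliffordBasis n).repr A s) ^ 2) := by
  change ‖cliffordCoords n A‖ = _
  simp [EuclideanSpace.norm_eq, cliffordCoords]

/-! ### Upper half space in `R^{m+1}`, the hat automorphism and the Dirac-Hodge operator -/

/-- Upper half space: the last coordinate is positive. -/
def upperHalf (m : ℕ) : Set (Rn (m + 1)) := {x | 0 < x (Fin.last m)}

/-- The generator belonging to the last coordinate. -/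
abbrev genLast (m : ℕ) : Cl (m + 1) := gen (Fin.last m)

/-- The reflection `x ↦ x̂` changing the sign of the last coordinate, as an isometry of the
quadratic form. -/
def hatVec (m : ℕ) : negForm (m + 1) →qᵢ negForm (m + 1) where
  toFun x := x - (2 * x (Fin.last m)) • stdVec (Fin.last m)
  map_add' x y := by
    simp only [PiLp.add_apply, mul_add, add_smul]; abel
  map_smul' r x := by
    simp only [PiLp.smul_apply, smul_eq_mul, RingHom.id_apply, smul_sub, smul_smul]
    congr 2; ring
  map_app' x := by
    simp only [negForm_apply, neg_inj, EuclideanSpace.norm_sq_eq, Real.norm_eq_abs, sq_abs]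
    refine Finset.sum_congr rfl fun i _ => ?_
    by_cases h : i = Fin.last m
    · subst h; simp; ring
    · simp [h]

/-- The automorphism `A = B + C e_n ↦ Â = B - C e_n` of `Cl_n` (with `B, C ∈ Cl_{n-1}`), that is
the automorphism extending the reflection `x ↦ x̂`. -/
def hatCl {m : ℕ} : Cl (m + 1) →ₐ[ℝ] Cl (m + 1) := CliffordAlgebra.map (hatVec m)

/-- The vectors of `R^{n-1} = span(e_1, …, e_{n-1})` inside `Cl_n`, where `n = m + 1`. -/
def boundaryVectors (m : ℕ) : Set (Cl (m + 1)) := vec '' {w | w (Fin.last m) = 0}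

/-- The subalgebra `Cl_{n-1}` of `Cl_n`, where `n = m + 1`. -/
def subCl (m : ℕ) : Subalgebra ℝ (Cl (m + 1)) := Algebra.adjoin ℝ (boundaryVectors m)

/-- The projection `P : Cl_n → Cl_{n-1}`, `P(B + C e_n) = B`. -/
def projP {m : ℕ} (A : Cl (m + 1)) : Cl (m + 1) := (1 / 2 : ℝ) • (A + hatCl A)

/-- The projection `Q : Cl_n → Cl_{n-1}`, `Q(B + C e_n) = C`. -/
def projQ {m : ℕ} (A : Cl (m + 1)) : Cl (m + 1) := -((1 / 2 : ℝ) • ((A - hatCl A) * genLast m))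

/-- `Q'(A) = -e_n Q(A) e_n`. -/
def projQ' {m : ℕ} (A : Cl (m + 1)) : Cl (m + 1) := -(genLast m * projQ A * genLast m)

theorem genLast_mul_self (m : ℕ) : genLast m * genLast m = -1 := by
  rw [CliffordAlgebra.ι_sq_scalar, negForm_apply]
  simp [stdVec]

theorem hatCl_genLast (m : ℕ) : hatCl (genLast m) = -genLast m := by
  have h : hatVec m (stdVec (Fin.last m)) = -stdVec (Fin.last m) := by
    change stdVec (Fin.last m) - (2 * stdVec (Fin.last m) (Fin.last m)) • stdVec (Fin.last m) = _
    simp [stdVec, two_smul]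
  rw [hatCl, CliffordAlgebra.map_apply_ι, h, map_neg]

theorem hatCl_of_mem_subCl {m : ℕ} {B : Cl (m + 1)} (hB : B ∈ subCl m) : hatCl B = B := by
  have h : subCl m ≤ AlgHom.equalizer hatCl (AlgHom.id ℝ (Cl (m + 1))) := by
    refine Algebra.adjoin_le ?_
    rintro _ ⟨w, hw, rfl⟩
    have hw' : hatVec m w = w := by
      change w - (2 * w (Fin.last m)) • stdVec (Fin.last m) = w
      rw [show w (Fin.last m) = 0 from hw]; simp
    change hatCl (vec w) = vec w
    rw [hatCl, CliffordAlgebra.map_apply_ι, hw']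
  exact h hB

/-- `P` and `Q` are the coefficients of the decomposition `Cl_n = Cl_{n-1} + Cl_{n-1} e_n`. -/
theorem projP_add_projQ {m : ℕ} (A : Cl (m + 1)) : projP A + projQ A * genLast m = A := by
  simp only [projP, projQ, neg_mul, smul_mul_assoc, mul_assoc, genLast_mul_self, mul_neg, mul_one,
    smul_neg, neg_neg]
  rw [← smul_add, show A + hatCl A + (A - hatCl A) = (2 : ℝ) • A by rw [two_smul]; abel, smul_smul]
  norm_num

theorem projP_projQ_unique {m : ℕ} {B C : Cl (m + 1)} (hB : B ∈ subCl m) (hC : C ∈ subCl m) :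
    projP (B + C * genLast m) = B ∧ projQ (B + C * genLast m) = C := by
  have h : hatCl (B + C * genLast m) = B - C * genLast m := by
    rw [map_add, map_mul, hatCl_of_mem_subCl hB, hatCl_of_mem_subCl hC, hatCl_genLast, mul_neg,
      sub_eq_add_neg]
  constructor
  · rw [projP, h, show B + C * genLast m + (B - C * genLast m) = (2 : ℝ) • B by
      rw [two_smul]; abel, smul_smul]
    norm_num
  · rw [projQ, h, show B + C * genLast m - (B - C * genLast m) = (2 : ℝ) • (C * genLast m) by
      rw [two_smul]; abel, smul_mul_assoc, mul_assoc, genLast_mul_self, smul_smul]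
    norm_num

theorem genLast_mul_of_mem_subCl {m : ℕ} {B : Cl (m + 1)} (hB : B ∈ subCl m) :
    ∃ B' ∈ subCl m, genLast m * B = B' * genLast m := by
  refine Algebra.adjoin_induction (p := fun B _ => ∃ B' ∈ subCl m, genLast m * B = B' * genLast m)
    ?_ ?_ ?_ ?_ hB
  · rintro _ ⟨w, hw, rfl⟩
    refine ⟨-vec w, neg_mem (Algebra.subset_adjoin ⟨w, hw, rfl⟩), ?_⟩
    have h : (negForm (m + 1)).IsOrtho (stdVec (Fin.last m)) w := by
      rw [QuadraticMap.isOrtho_def]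
      simp only [negForm_apply]
      have h0 : inner ℝ (stdVec (Fin.last m)) w = 0 := by
        simpa [stdVec, EuclideanSpace.inner_single_left] using hw
      rw [norm_add_sq_real, h0]
      ring
    rw [CliffordAlgebra.ι_mul_ι_comm_of_isOrtho h, neg_mul]
  · intro r
    exact ⟨algebraMap ℝ _ r, Subalgebra.algebraMap_mem _ r, (Algebra.commutes r _).symm⟩
  · rintro x y - - ⟨x', hx, ex⟩ ⟨y', hy, ey⟩
    exact ⟨x' + y', add_mem hx hy, by rw [mul_add, ex, ey, add_mul]⟩
  · rintro x y - - ⟨x', hx, ex⟩ ⟨y', hy, ey⟩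
    exact ⟨x' * y', mul_mem hx hy, by rw [← mul_assoc, ex, mul_assoc, ey, mul_assoc]⟩

theorem exists_decomposition {m : ℕ} (A : Cl (m + 1)) :
    ∃ B ∈ subCl m, ∃ C ∈ subCl m, A = B + C * genLast m := by
  induction A using CliffordAlgebra.induction with
  | algebraMap r => exact ⟨_, Subalgebra.algebraMap_mem _ r, 0, zero_mem _, by simp⟩
  | ι x =>
    refine ⟨vec (x - x (Fin.last m) • stdVec (Fin.last m)), Algebra.subset_adjoin ⟨_, ?_, rfl⟩,
      algebraMap ℝ _ (x (Fin.last m)), Subalgebra.algebraMap_mem _ _, ?_⟩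
    · simp [stdVec]
    · rw [map_sub, map_smul, Algebra.smul_def]; abel
  | add x y hx hy =>
    obtain ⟨B, hB, C, hC, rfl⟩ := hx
    obtain ⟨B', hB', C', hC', rfl⟩ := hy
    exact ⟨B + B', add_mem hB hB', C + C', add_mem hC hC', by rw [add_mul]; abel⟩
  | mul x y hx hy =>
    obtain ⟨B, hB, C, hC, rfl⟩ := hx
    obtain ⟨B', hB', C', hC', rfl⟩ := hy
    obtain ⟨X, hX, eX⟩ := genLast_mul_of_mem_subCl hB'
    obtain ⟨Y, hY, eY⟩ := genLast_mul_of_mem_subCl hC'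
    refine ⟨B * B' - C * Y, sub_mem (mul_mem hB hB') (mul_mem hC hY), B * C' + C * X,
      add_mem (mul_mem hB hC') (mul_mem hC hX), ?_⟩
    have e1 : C * genLast m * B' = C * X * genLast m := by rw [mul_assoc, eX, mul_assoc]
    have e2 : C * genLast m * (C' * genLast m) = -(C * Y) := by
      rw [mul_assoc, ← mul_assoc (genLast m), eY, mul_assoc Y, genLast_mul_self]; simp
    rw [add_mul, mul_add, mul_add, e1, e2, add_mul, ← mul_assoc]
    abel

theorem projP_mem_projQ_mem {m : ℕ} (A : Cl (m + 1)) : projP A ∈ subCl m ∧ projQ A ∈ subCl m := by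
  obtain ⟨B, hB, C, hC, rfl⟩ := exists_decomposition A
  obtain ⟨h1, h2⟩ := projP_projQ_unique hB hC
  rw [h1, h2]
  exact ⟨hB, hC⟩

/-- The Euclidean Dirac operator `D f = ∑ e_j ∂f/∂x_j`. -/
def diracOp {m : ℕ} (f : Rn (m + 1) → Cl (m + 1)) (x : Rn (m + 1)) : Cl (m + 1) :=
  ∑ j, gen j * fderiv ℝ f x (stdVec j)

/-- The Dirac-Hodge operator `M f = D f + ((n - 2) / x_n) Q'(f)`, where `n = m + 1`. -/
def diracHodgeOp {m : ℕ} (f : Rn (m + 1) → Cl (m + 1)) (x : Rn (m + 1)) : Cl (m + 1) :=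
  diracOp f x + (((m : ℝ) - 1) / x (Fin.last m)) • projQ' (f x)

/-- `f` is left hypermonogenic on the set `U` (meant for open `U` in upper half space). -/
def IsLeftHypermonogenicOn {m : ℕ} (f : Rn (m + 1) → Cl (m + 1)) (U : Set (Rn (m + 1))) : Prop :=
  DifferentiableOn ℝ f U ∧ ∀ x ∈ U, diracHodgeOp f x = 0

/-! ### Regions with `C^1` boundary, outer normal, surface measure -/

/-- Near `x`, the set `K` is the sublevel set `{ρ ≤ 0}` of the `C^1` function `ρ` on the open
neighbourhood `W` of `x`, and the gradient of `ρ` does not vanish at `x`. -/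
def IsLocalDefiningFunction {n : ℕ} (K : Set (Rn n)) (x : Rn n) (W : Set (Rn n)) (ρ : Rn n → ℝ) :
    Prop :=
  IsOpen W ∧ x ∈ W ∧ ContDiffOn ℝ 1 ρ W ∧ gradient ρ x ≠ 0 ∧ ∀ y ∈ W, (y ∈ K ↔ ρ y ≤ 0)

/-- The closed set `K` has `C^1` boundary and lies locally on one side of it. -/
def HasC1Boundary {n : ℕ} (K : Set (Rn n)) : Prop :=
  ∀ x ∈ frontier K, ∃ W ρ, IsLocalDefiningFunction K x W ρ

open Classical in
/-- The outer unit normal vector `∇ρ / ‖∇ρ‖` of `K` at a boundary point `x`; it does not depend on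
the local defining function `ρ`. -/
def outerNormal {n : ℕ} (K : Set (Rn n)) (x : Rn n) : Rn n :=
  if h : ∃ ν W ρ, IsLocalDefiningFunction K x W ρ ∧ ν = ‖gradient ρ x‖⁻¹ • gradient ρ x then
    h.choose
  else 0

/-- Surface measure `σ` on hypersurfaces of `R^{m+1}`: the `m`-dimensional Hausdorff measure,
normalised to be Lebesgue measure on `R^m`. -/
def surfaceMeasure (m : ℕ) : Measure (Rn (m + 1)) := Measure.euclideanHausdorffMeasure m

/-- The surface area `ω_n` of the unit sphere of `R^n`, where `n = m + 1`. -/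
def sphereArea (m : ℕ) : ℝ := (surfaceMeasure m).real (Metric.sphere 0 1)

/-! ### The Cauchy kernels -/

/-- `E(x, y) = (x - y)^{-1} / (‖x - y‖^{n-2} ‖x - ŷ‖^{n-2})`, where `n = m + 1`. -/
def kernelE {m : ℕ} (x y : Rn (m + 1)) : Cl (m + 1) :=
  (‖x - y‖ ^ (m - 1) * ‖x - hatVec m y‖ ^ (m - 1))⁻¹ • Ring.inverse (vec (x - y))

/-- `F(x, y) = (x̂ - y)^{-1} / (‖x - y‖^{n-2} ‖x̂ - y‖^{n-2})`, where `n = m + 1`. -/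
def kernelF {m : ℕ} (x y : Rn (m + 1)) : Cl (m + 1) :=
  (‖x - y‖ ^ (m - 1) * ‖hatVec m x - y‖ ^ (m - 1))⁻¹ • Ring.inverse (vec (hatVec m x - y))

/-! ### Möbius transformations preserving the boundary `R^{n-1}` -/

/-- `(a b; c d)` is a Vahlen matrix over `R^{n-1}`, where `n = m + 1`: an element of the group
`V(n-1)` covering the Möbius transformations of `R^{n-1} ∪ {∞}`. A product of vectors of `R^{n-1}`
may be empty, or zero. -/
structure IsVahlenMatrix {m : ℕ} (a b c d : Cl (m + 1)) : Prop where
  a_mem : a ∈ Submonoid.closure (boundaryVectors m)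
  b_mem : b ∈ Submonoid.closure (boundaryVectors m)
  c_mem : c ∈ Submonoid.closure (boundaryVectors m)
  d_mem : d ∈ Submonoid.closure (boundaryVectors m)
  ac_mem : CliffordAlgebra.reverse a * c ∈ boundaryVectors m
  cd_mem : CliffordAlgebra.reverse c * d ∈ boundaryVectors m
  db_mem : CliffordAlgebra.reverse d * b ∈ boundaryVectors m
  ba_mem : CliffordAlgebra.reverse b * a ∈ boundaryVectors m
  det_eq : CliffordAlgebra.reverse a * d - CliffordAlgebra.reverse c * b = 1 ∨
    CliffordAlgebra.reverse a * d - CliffordAlgebra.reverse c * b = -1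

/-- `ψ` leaves upper half space invariant and is given there by `ψ(u) = (a u + b)(c u + d)^{-1}`,
with a Vahlen matrix `(a b; c d)` over `R^{n-1}`. -/
def IsUpperHalfMoebius {m : ℕ} (a b c d : Cl (m + 1)) (ψ : Rn (m + 1) → Rn (m + 1)) : Prop :=
  IsVahlenMatrix a b c d ∧ MapsTo ψ (upperHalf m) (upperHalf m) ∧
    ∀ u ∈ upperHalf m, vec (ψ u) = (a * vec u + b) * Ring.inverse (c * vec u + d)

/-- The weight `J(ψ, u) = (c u + d)^~ / ‖c u + d‖^2`, where `~` is the reversion of `Cl_n`. -/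
def weightJ {m : ℕ} (c d : Cl (m + 1)) (u : Rn (m + 1)) : Cl (m + 1) :=
  (‖c * vec u + d‖ ^ 2)⁻¹ • CliffordAlgebra.reverse (c * vec u + d)

end

/-! Write n = m + 1, so that every exponent `m - 1` is n - 2. The formula is Cauchy's integral
formula for hypermonogenic functions (`cauchy_formula`), applied not to f on K but to the
transformed function J(ψ, ·) f(ψ(·)) on ψ⁻¹(K). Three things are needed: the transformed function is
again hypermonogenic (`IsUpperHalfMoebius.isLeftHypermonogenicOn`), ψ⁻¹(K) is again compact
(`IsUpperHalfMoebius.isCompact_preimage`), and its boundary is again C¹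
(`IsUpperHalfMoebius.hasC1Boundary_preimage`). No integral is ever transported by ψ.

Cauchy's formula. For fixed v the integrand is the flux of the field ν ↦ E ν g - F ν̂ ĝ.
Hypermonogenicity says Dg = c e_n (g - ĝ) with c = (n - 2)/(2 u_n), and the Dirac derivatives from
the right that enter the divergence of the two terms both equal -c (E - F) e_n, by
`hasFDerivAt_kernelE` and `kernel_sub_mul_genLast`. Hence the field has no divergence away from v
(`divergence_cauchyField`). Its flux through the boundary equals that through a small sphere about
v, where `cauchyField_radial` shows that E contributes a spherical mean of g, up to the factor ‖u -
v̂‖^{-(n-2)}, and that the contribution of F dies out. Since ‖v - v̂‖ = 2 v_n, the limit gives the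
constant in front of the integral.

Covariance. Up to one constant sign, J is p = (cu + d)⁻¹. The derivative of ψ is x ↦ p̃ x p, a
multiple of an isometry, so the Dirac operator passes through p; differentiating p itself produces a
term (n - 2) x p f(ψ(u)) with the vector x = p c. The identity 2 u_n x p = e_n (p̂ - p) turns that
term into exactly the difference between the zero order terms of the two equations. That ψ preserves
the half space enters through ψ(u)_n = u_n / ‖cu + d‖².

Analysis. Hypermonogenic functions are only assumed differentiable, so the divergence theorem
(`setIntegral_divergence_eq`) is proved for differentiable fields with continuous divergence. A
partition of unity reduces it to graph charts. There a cut-off of thin layers above the graph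
reduces it to the whole space, and the area formula identifies the limit with an integral against
Hausdorff measure. -/

/-! ### Comparison of measures and the area formula. -/

open Filter Topology in
/-- A measure inequality that holds on small sets near every point of `B` holds on all of `B`. -/
theorem measure_le_of_locally_le {α : Type*} [TopologicalSpace α] [SecondCountableTopology α]
    [MeasurableSpace α] [OpensMeasurableSpace α] {μ ν : Measure α} {B : Set α}
    (h : ∀ x ∈ B, ∃ N ∈ 𝓝 x, ∀ S, MeasurableSet S → S ⊆ N ∩ B → μ S ≤ ν S)
    {S : Set α} (hS : MeasurableSet S) (hSB : S ⊆ B) : μ S ≤ ν S := by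
  choose! N hN hle using h
  obtain ⟨t, htB, htc, htu⟩ := TopologicalSpace.countable_cover_nhdsWithin
    (f := fun x => interior (N x)) (s := B)
    (fun x hx => mem_nhdsWithin_of_mem_nhds (interior_mem_nhds.2 (hN x hx)))
  rcases t.eq_empty_or_nonempty with rfl | hne
  · have : S = ∅ := subset_empty_iff.1 (fun y hy => by simpa using htu (hSB hy))
    simp [this]
  obtain ⟨u, rfl⟩ := htc.exists_eq_range hne
  -- Lindelöf gives countably many neighbourhoods; making them disjoint lets the local inequalities
  -- be summed.
  let D : ℕ → Set α := fun n => S ∩ disjointed (fun k => interior (N (u k))) n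
  have hDm : ∀ n, MeasurableSet (D n) := fun n =>
    hS.inter (MeasurableSet.disjointed (fun k => isOpen_interior.measurableSet) n)
  have hDd : Pairwise (Function.onFun Disjoint D) := fun i j hij =>
    ((disjoint_disjointed _) hij).mono inter_subset_right inter_subset_right
  have hDS : S = ⋃ n, D n := by
    rw [← inter_iUnion, iUnion_disjointed]
    refine (inter_eq_left.2 fun y hy => ?_).symm
    obtain ⟨x, ⟨n, rfl⟩, hx⟩ := mem_iUnion₂.1 (htu (hSB hy))
    exact mem_iUnion.2 ⟨n, hx⟩
  rw [hDS, measure_iUnion hDd hDm, measure_iUnion hDd hDm]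
  refine ENNReal.tsum_le_tsum fun n => hle (u n) (htB ⟨n, rfl⟩) _ (hDm n) fun y hy => ⟨?_, hSB hy.1⟩
  have hsub : disjointed (fun k => interior (N (u k))) n ⊆ interior (N (u n)) := disjointed_le _ n
  exact interior_subset (hsub hy.2)

theorem LipschitzOnWith.euclideanHausdorffMeasure_image_le {X Y : Type*} [EMetricSpace X]
    [EMetricSpace Y] [MeasurableSpace X] [BorelSpace X] [MeasurableSpace Y] [BorelSpace Y]
    {K : NNReal} {f : X → Y} {s : Set X} (h : LipschitzOnWith K f s) (d : ℕ) :
    Measure.euclideanHausdorffMeasure d (f '' s) ≤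
      K ^ d * Measure.euclideanHausdorffMeasure d s := by
  simp_rw [Measure.euclideanHausdorffMeasure_def, Measure.smul_apply, Measure.nnreal_smul_coe_apply]
  rw [mul_left_comm]
  gcongr
  simpa using h.hausdorffMeasure_image_le (d := d) (by positivity)

section Area

variable {m : ℕ} {V : Type*} [NormedAddCommGroup V] [InnerProductSpace ℝ V]
  [MeasurableSpace V] [BorelSpace V]

-- Near `y₀` the maps `f ∘ T⁻¹` and `T ∘ f⁻¹` are both `a`-Lipschitz on the relevant images, and `T`
-- scales measure exactly by its `normDet`. The Lipschitz bounds cost `a ^ m`; the last factor `a`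
-- pays for replacing `J y` by `J y₀`.
open Filter Topology in
theorem exists_nhds_euclideanHausdorffMeasure_image_le {B : Set (EuclideanSpace ℝ (Fin m))}
    {f : EuclideanSpace ℝ (Fin m) → V} {g : V → EuclideanSpace ℝ (Fin m)}
    (hgf : ∀ y ∈ B, g (f y) = y) {y₀ : EuclideanSpace ℝ (Fin m)}
    {T : EuclideanSpace ℝ (Fin m) →L[ℝ] V} (hT : HasStrictFDerivAt f T y₀)
    (hTi : Function.Injective T) {J : EuclideanSpace ℝ (Fin m) → ℝ}
    (hJ : ContinuousWithinAt J B y₀) (hJ₀ : J y₀ = T.toLinearMap.normDet) (hpos : 0 < J y₀)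
    {a : NNReal} (ha : 1 < a) :
    ∃ N ∈ 𝓝 y₀, ∀ S, MeasurableSet S → S ⊆ N ∩ B →
      Measure.euclideanHausdorffMeasure m (f '' S) ≤
        (a : ENNReal) ^ (m + 1) * ∫⁻ y in S, ENNReal.ofReal (J y) ∧
      ∫⁻ y in S, ENNReal.ofReal (J y) ≤
        (a : ENNReal) ^ (m + 1) * Measure.euclideanHausdorffMeasure m (f '' S) := by
  have ha' : (1 : ℝ) < a := by exact_mod_cast ha
  obtain ⟨κ, hκ, hTκ⟩ := T.toLinearMap.exists_antilipschitzWith (LinearMap.ker_eq_bot.2 hTi)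
  -- With `κ` the antilipschitz constant of `T`, this error bound becomes `(a - 1) / a` relative to
  -- `‖T (y - y')‖`. It suits both sides: `1 + (a - 1) / a ≤ a` and `1 - (a - 1) / a = 1 / a`.
  have hδ : (0 : ℝ) < (a - 1) / a / κ := by
    have : (0 : ℝ) < κ := by exact_mod_cast hκ
    have : (0 : ℝ) < a - 1 := by linarith
    positivity
  obtain ⟨s, hs, hfs⟩ := hT.approximates_deriv_on_nhds (c := ⟨_, hδ.le⟩) (Or.inr hδ)
  have hlow : ∀ y y', ‖y - y'‖ ≤ κ * ‖T (y - y')‖ := fun y y' => by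
    simpa [dist_eq_norm] using hTκ.le_mul_dist y y'
  have herr : ∀ y ∈ s, ∀ y' ∈ s, ‖f y - f y' - T (y - y')‖ ≤ (a - 1) / a * ‖T (y - y')‖ := by
    intro y hy y' hy'
    have h1 := hfs y hy y' hy'
    have hκ' : (0 : ℝ) < κ := by exact_mod_cast hκ
    refine h1.trans ?_
    change (a - 1) / a / (κ : ℝ) * ‖y - y'‖ ≤ _
    calc (a - 1) / a / (κ : ℝ) * ‖y - y'‖ ≤ (a - 1) / a / (κ : ℝ) * (κ * ‖T (y - y')‖) := by
          gcongr; exact hlow y y'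
      _ = _ := by field_simp
  have hup : ∀ y ∈ s, ∀ y' ∈ s, ‖f y - f y'‖ ≤ a * ‖T (y - y')‖ := by
    intro y hy y' hy'
    have h1 := herr y hy y' hy'
    have h2 := norm_le_insert' (f y - f y') (T (y - y'))
    have h3 : ((a : ℝ) - 1) / a + 1 ≤ a := by
      rw [div_add_one (by positivity), div_le_iff₀ (by positivity)]; nlinarith
    nlinarith [norm_nonneg (T (y - y'))]
  have hdn : ∀ y ∈ s, ∀ y' ∈ s, ‖T (y - y')‖ ≤ a * ‖f y - f y'‖ := by
    intro y hy y' hy'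
    have h1 := herr y hy y' hy'
    have h2 := norm_le_insert (f y - f y') (T (y - y'))
    have h3 : ‖T (y - y')‖ / a ≤ ‖f y - f y'‖ := by
      have : ((a : ℝ) - 1) / a * ‖T (y - y')‖ = ‖T (y - y')‖ - ‖T (y - y')‖ / a := by
        field_simp
      linarith
    rw [div_le_iff₀ (by positivity)] at h3
    linarith
  have hJ1 : ∀ᶠ y in 𝓝[B] y₀, J y < a * J y₀ :=
    hJ.eventually_lt continuousWithinAt_const (by nlinarith)
  have hJ2 : ∀ᶠ y in 𝓝[B] y₀, J y₀ < a * J y :=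
    continuousWithinAt_const.eventually_lt (hJ.const_mul _) (by nlinarith)
  obtain ⟨N, hN, hNJ⟩ := mem_nhdsWithin_iff_exists_mem_nhds_inter.1 (hJ1.and hJ2)
  refine ⟨s ∩ N, inter_mem hs hN, fun S hS hSN => ?_⟩
  have hlin : Measure.euclideanHausdorffMeasure m (T '' S) = ENNReal.ofReal (J y₀) * volume S := by
    have := T.toLinearMap.euclideanHausdorffMeasure_image_eq_normDet_mul_volume S
    rw [finrank_euclideanSpace_fin] at this
    rw [hJ₀]
    exact this
  obtain ⟨L, hL⟩ := T.toLinearMap.exists_leftInverse_of_injective (LinearMap.ker_eq_bot.2 hTi)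
  have hLT : ∀ y, L (T y) = y := fun y => LinearMap.congr_fun hL y
  have hf_image : f '' S = (fun x => f (L x)) '' (T '' S) := by
    rw [image_image]; simp [hLT]
  have hT_image : T '' S = (fun x => T (g x)) '' (f '' S) := by
    rw [image_image]
    exact image_congr fun y hy => by rw [hgf y (hSN hy).2]
  have h1 : Measure.euclideanHausdorffMeasure m (f '' S) ≤
      (a : ENNReal) ^ m * Measure.euclideanHausdorffMeasure m (T '' S) := by
    rw [hf_image]
    refine LipschitzOnWith.euclideanHausdorffMeasure_image_le ?_ m
    refine LipschitzOnWith.of_dist_le_mul ?_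
    rintro _ ⟨y, hy, rfl⟩ _ ⟨y', hy', rfl⟩
    rw [hLT, hLT, dist_eq_norm, dist_eq_norm, ← map_sub]
    exact hup y (hSN hy).1.1 y' (hSN hy').1.1
  have h2 : Measure.euclideanHausdorffMeasure m (T '' S) ≤
      (a : ENNReal) ^ m * Measure.euclideanHausdorffMeasure m (f '' S) := by
    rw [hT_image]
    refine LipschitzOnWith.euclideanHausdorffMeasure_image_le ?_ m
    refine LipschitzOnWith.of_dist_le_mul ?_
    rintro _ ⟨y, hy, rfl⟩ _ ⟨y', hy', rfl⟩
    rw [hgf y (hSN hy).2, hgf y' (hSN hy').2, dist_eq_norm, dist_eq_norm, ← map_sub]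
    exact hdn y (hSN hy).1.1 y' (hSN hy').1.1
  have haJ : ∀ r : ℝ, (a : ENNReal) * ENNReal.ofReal r = ENNReal.ofReal (a * r) := fun r => by
    rw [ENNReal.ofReal_mul a.coe_nonneg, ENNReal.ofReal_coe_nnreal]
  have h3 : ENNReal.ofReal (J y₀) * volume S ≤ a * ∫⁻ y in S, ENNReal.ofReal (J y) := by
    rw [← setLIntegral_const, ← lintegral_const_mul' _ _ ENNReal.coe_ne_top]
    refine setLIntegral_mono' hS fun y hy => ?_
    rw [haJ]
    exact ENNReal.ofReal_le_ofReal (hNJ ⟨(hSN hy).1.2, (hSN hy).2⟩).2.le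
  have h4 : ∫⁻ y in S, ENNReal.ofReal (J y) ≤ a * (ENNReal.ofReal (J y₀) * volume S) := by
    rw [← setLIntegral_const, ← lintegral_const_mul' _ _ ENNReal.coe_ne_top]
    refine setLIntegral_mono' hS fun y hy => ?_
    rw [haJ]
    exact ENNReal.ofReal_le_ofReal (hNJ ⟨(hSN hy).1.2, (hSN hy).2⟩).1.le
  constructor
  · calc _ ≤ (a : ENNReal) ^ m * (ENNReal.ofReal (J y₀) * volume S) := by rw [← hlin]; exact h1
      _ ≤ (a : ENNReal) ^ m * (a * ∫⁻ y in S, ENNReal.ofReal (J y)) := by gcongr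
      _ = _ := by rw [← mul_assoc, pow_succ]
  · calc _ ≤ a * (ENNReal.ofReal (J y₀) * volume S) := h4
      _ ≤ a * ((a : ENNReal) ^ m * Measure.euclideanHausdorffMeasure m (f '' S)) := by
          rw [← hlin]; gcongr
      _ = _ := by rw [← mul_assoc, pow_succ']

open Filter Topology in
/-- **Area formula** for a `C^1` immersion `f` of an open set `B` that has a measurable left
inverse `g`. -/
theorem map_euclideanHausdorffMeasure_restrict_image {B : Set (EuclideanSpace ℝ (Fin m))}
    (hB : MeasurableSet B) {f : EuclideanSpace ℝ (Fin m) → V} {g : V → EuclideanSpace ℝ (Fin m)}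
    (hg : Measurable g) (hgf : ∀ y ∈ B, g (f y) = y)
    {T : EuclideanSpace ℝ (Fin m) → EuclideanSpace ℝ (Fin m) →L[ℝ] V}
    (hT : ∀ y ∈ B, HasStrictFDerivAt f (T y) y)
    (hTi : ∀ y ∈ B, Function.Injective (T y)) {J : EuclideanSpace ℝ (Fin m) → ℝ}
    (hJ : ContinuousOn J B) (hJT : ∀ y ∈ B, J y = (T y).toLinearMap.normDet)
    (hpos : ∀ y ∈ B, 0 < J y) :
    ((Measure.euclideanHausdorffMeasure m).restrict (f '' B)).map g =
      (volume.restrict B).withDensity fun y => ENNReal.ofReal (J y) := by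
  have key : ∀ S, MeasurableSet S → S ⊆ B →
      ((Measure.euclideanHausdorffMeasure m).restrict (f '' B)).map g S =
        Measure.euclideanHausdorffMeasure m (f '' S) := by
    intro S hS hSB
    rw [Measure.map_apply hg hS, Measure.restrict_apply (hg hS)]
    congr 1
    ext x
    constructor
    · rintro ⟨hx, y, hy, rfl⟩
      rw [mem_preimage, hgf y hy] at hx
      exact ⟨y, hx, rfl⟩
    · rintro ⟨y, hy, rfl⟩
      exact ⟨by rw [mem_preimage, hgf y (hSB hy)]; exact hy, y, hSB hy, rfl⟩
  have key2 : ∀ S, MeasurableSet S → S ⊆ B →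
      (volume.restrict B).withDensity (fun y => ENNReal.ofReal (J y)) S =
        ∫⁻ y in S, ENNReal.ofReal (J y) := by
    intro S hS hSB
    rw [withDensity_apply _ hS, Measure.restrict_restrict hS, inter_eq_left.2 hSB]
  -- The local estimates hold up to the factor `a ^ (m + 1)` for every `a > 1`; letting `a → 1`
  -- removes it.
  have hlim : ∀ x y : ENNReal,
      (∀ a : NNReal, 1 < a → x ≤ (a : ENNReal) ^ (m + 1) * y) → x ≤ y := by
    intro x y h
    have h1 : Tendsto (fun a : NNReal => (a : ENNReal) ^ (m + 1) * y) (𝓝[>] 1) (𝓝 y) := by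
      have h0 : Tendsto (fun a : NNReal => ((a ^ (m + 1) : NNReal) : ENNReal)) (𝓝[>] 1) (𝓝 1) := by
        rw [← ENNReal.coe_one, ENNReal.tendsto_coe]
        have : Continuous fun a : NNReal => a ^ (m + 1) := by fun_prop
        simpa using (this.tendsto 1).mono_left nhdsWithin_le_nhds
      have := ENNReal.Tendsto.mul_const (b := y) h0 (Or.inl one_ne_zero)
      simpa using this
    exact ge_of_tendsto h1 (eventually_mem_nhdsWithin.mono fun a ha => h a ha)
  ext S hS
  have hcompl1 : ((Measure.euclideanHausdorffMeasure m).restrict (f '' B)).map g Bᶜ = 0 := by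
    rw [Measure.map_apply hg hB.compl, Measure.restrict_apply (hg hB.compl)]
    have : g ⁻¹' Bᶜ ∩ f '' B = ∅ := by
      ext x
      simp only [mem_inter_iff, mem_preimage, mem_compl_iff, mem_image, mem_empty_iff_false,
        iff_false]
      rintro ⟨hx, y, hy, rfl⟩
      rw [hgf y hy] at hx
      exact hx hy
    rw [this, measure_empty]
  have hcompl2 : (volume.restrict B).withDensity (fun y => ENNReal.ofReal (J y)) Bᶜ = 0 := by
    rw [withDensity_apply _ hB.compl, Measure.restrict_restrict hB.compl]
    simp
  rw [← measure_inter_conull hcompl1, ← measure_inter_conull hcompl2]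
  have hSB : MeasurableSet (S ∩ B) := hS.inter hB
  have hloc := fun (a : NNReal) (ha : 1 < a) (y : _) (hy : y ∈ B) =>
    exists_nhds_euclideanHausdorffMeasure_image_le hgf (hT y hy) (hTi y hy) (hJ y hy)
      (hJT y hy) (hpos y hy) ha
  apply le_antisymm
  · refine hlim _ _ fun a ha => ?_
    have := measure_le_of_locally_le (B := B)
      (μ := ((Measure.euclideanHausdorffMeasure m).restrict (f '' B)).map g)
      (ν := ((a : ENNReal) ^ (m + 1)) • (volume.restrict B).withDensity
        fun y => ENNReal.ofReal (J y)) (fun y hy => ?_) hSB inter_subset_right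
    · simpa using this
    · obtain ⟨N, hN, h⟩ := hloc a ha y hy
      refine ⟨N, hN, fun S hS hSN => ?_⟩
      rw [Measure.smul_apply, key S hS (hSN.trans inter_subset_right),
        key2 S hS (hSN.trans inter_subset_right)]
      exact (h S hS hSN).1
  · refine hlim _ _ fun a ha => ?_
    have := measure_le_of_locally_le (B := B)
      (ν := ((a : ENNReal) ^ (m + 1)) •
        ((Measure.euclideanHausdorffMeasure m).restrict (f '' B)).map g)
      (μ := (volume.restrict B).withDensity
        fun y => ENNReal.ofReal (J y)) (fun y hy => ?_) hSB inter_subset_right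
    · simpa using this
    · obtain ⟨N, hN, h⟩ := hloc a ha y hy
      refine ⟨N, hN, fun S hS hSN => ?_⟩
      rw [Measure.smul_apply, key S hS (hSN.trans inter_subset_right),
        key2 S hS (hSN.trans inter_subset_right)]
      exact (h S hS hSN).2

end Area

/-- The Jacobian of the parametrisation `y ↦ A (y, h y)` of a graph, where `A` is isometric. -/
theorem normDet_graph {m : ℕ} {V : Type*} [NormedAddCommGroup V] [InnerProductSpace ℝ V]
    [FiniteDimensional ℝ V] (A : EuclideanSpace ℝ (Fin m) × ℝ →L[ℝ] V)
    (hA : ∀ p q, inner ℝ (A p) (A q) = inner ℝ p.1 q.1 + p.2 * q.2)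
    (p : EuclideanSpace ℝ (Fin m)) :
    (A.comp ((ContinuousLinearMap.id ℝ _).prod (innerSL ℝ p))).toLinearMap.normDet =
      Real.sqrt (1 + ‖p‖ ^ 2) := by
  set T := (A.comp ((ContinuousLinearMap.id ℝ _).prod (innerSL ℝ p))).toLinearMap with hT
  have hTi : ∀ x y, inner ℝ (T x) (T y) = inner ℝ x y + inner ℝ p x * inner ℝ p y := by
    intro x y
    simp [hT, hA]
  -- `T* T` is `x ↦ x + ⟨p, x⟩ p`, a rank one perturbation of the identity with determinant `1 + ‖p‖
  -- ^ 2`.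
  have h1 : LinearMap.adjoint T ∘ₗ T =
      LinearMap.transvection (innerSL ℝ p).toLinearMap p := by
    ext1 x
    refine ext_inner_right ℝ fun y => ?_
    rw [LinearMap.comp_apply, LinearMap.adjoint_inner_left, hTi]
    simp [LinearMap.transvection, inner_add_left, inner_smul_left]
  have h2 := T.normDet_sq
  rw [h1, LinearMap.transvection.det] at h2
  simp only [RCLike.ofReal_real_eq_id, id_eq, ContinuousLinearMap.coe_coe, innerSL_apply_apply,
    real_inner_self_eq_norm_sq] at h2
  rw [← h2, Real.sqrt_sq T.normDet_nonneg]

/-! ### Local defining functions -/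

section Normal

open Filter Topology

variable {n : ℕ} {K : Set (Rn n)} {x : Rn n} {W : Set (Rn n)} {ρ : Rn n → ℝ}

theorem IsLocalDefiningFunction.contDiffAt (h : IsLocalDefiningFunction K x W ρ) {y : Rn n}
    (hy : y ∈ W) : ContDiffAt ℝ 1 ρ y :=
  h.2.2.1.contDiffAt (h.1.mem_nhds hy)

theorem IsLocalDefiningFunction.eq_zero (h : IsLocalDefiningFunction K x W ρ) {y : Rn n}
    (hyW : y ∈ W) (hy : y ∈ frontier K) : ρ y = 0 := by
  have hc : ContinuousAt ρ y := (h.contDiffAt hyW).continuousAt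
  have hW : ∀ᶠ z in 𝓝 y, (z ∈ K ↔ ρ z ≤ 0) := by
    filter_upwards [h.1.mem_nhds hyW] with z hz using h.2.2.2.2 z hz
  rcases lt_trichotomy (ρ y) 0 with hlt | heq | hgt
  · refine absurd ?_ hy.2
    rw [mem_interior_iff_mem_nhds]
    filter_upwards [hW, hc.eventually_lt_const hlt] with z hz hz' using hz.2 hz'.le
  · exact heq
  · refine absurd hy.1 ?_
    rw [mem_closure_iff_frequently, not_frequently]
    filter_upwards [hW, hc.eventually_const_lt hgt] with z hz hz' hzK using
      (hz.1 hzK).not_gt hz'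

/-- A short step from `x` along `w` makes `ρ` negative, hence stays in `K`; so `ρ'` cannot become
positive along it. -/
theorem IsLocalDefiningFunction.inner_nonpos {W' : Set (Rn n)} {ρ' : Rn n → ℝ}
    (h : IsLocalDefiningFunction K x W ρ) (h' : IsLocalDefiningFunction K x W' ρ')
    (hx : ρ x = 0) (hx' : ρ' x = 0) {w : Rn n} (hw : inner ℝ (gradient ρ x) w < 0) :
    inner ℝ (gradient ρ' x) w ≤ 0 := by
  have hline : ∀ {σ : Rn n → ℝ}, ContDiffAt ℝ 1 σ x →
      HasDerivAt (fun t : ℝ => σ (x + t • w)) (inner ℝ (gradient σ x) w) 0 := by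
    intro σ hσ
    have h1 : HasFDerivAt σ (fderiv ℝ σ x) (x + (0 : ℝ) • w) := by
      simpa using (hσ.differentiableAt one_ne_zero).hasFDerivAt
    have h2 : HasDerivAt (fun t : ℝ => x + t • w) w 0 := by
      simpa using ((hasDerivAt_id (0 : ℝ)).smul_const w).const_add x
    rw [inner_gradient_left]
    exact h1.comp_hasDerivAt 0 h2
  by_contra! hpos
  have d1 := hline (h.contDiffAt h.2.1)
  have d2 := hline (h'.contDiffAt h'.2.1)
  have hcont : Tendsto (fun t : ℝ => x + t • w) (𝓝[>] 0) (𝓝 x) := by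
    have : Continuous fun t : ℝ => x + t • w := by fun_prop
    simpa using (this.tendsto 0).mono_left nhdsWithin_le_nhds
  have e1 : ∀ᶠ t in 𝓝[>] (0 : ℝ), slope (fun t : ℝ => ρ (x + t • w)) 0 t < 0 :=
    ((hasDerivAt_iff_tendsto_slope.1 d1).mono_left
      (nhdsWithin_mono 0 fun t ht => ne_of_gt ht)).eventually_lt_const hw
  have e2 : ∀ᶠ t in 𝓝[>] (0 : ℝ), 0 < slope (fun t : ℝ => ρ' (x + t • w)) 0 t :=
    ((hasDerivAt_iff_tendsto_slope.1 d2).mono_left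
      (nhdsWithin_mono 0 fun t ht => ne_of_gt ht)).eventually_const_lt hpos
  obtain ⟨t, ht, ht1, ht2, hW, hW'⟩ := (eventually_mem_nhdsWithin.and (e1.and (e2.and
    ((hcont.eventually_mem (h.1.mem_nhds h.2.1)).and
      (hcont.eventually_mem (h'.1.mem_nhds h'.2.1)))))).exists
  rw [slope_def_field] at ht1 ht2
  simp only [zero_smul, add_zero, hx, hx', sub_zero] at ht1 ht2
  have ht0 : (0 : ℝ) < t := ht
  have r1 : ρ (x + t • w) < 0 := by
    by_contra! hc
    exact absurd ht1 (not_lt.2 (div_nonneg hc ht0.le))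
  have r2 : 0 < ρ' (x + t • w) := by
    by_contra! hc
    exact absurd ht2 (not_lt.2 (div_nonpos_of_nonpos_of_nonneg hc ht0.le))
  exact absurd ((h'.2.2.2.2 _ hW').1 ((h.2.2.2.2 _ hW).2 r1.le)) (not_le.2 r2)

/-- If the unit normals `a`, `b` differed, the direction `b - a` would point strictly inwards for
`a` and strictly outwards for `b`, against `inner_nonpos`. -/
theorem IsLocalDefiningFunction.normal_eq {W' : Set (Rn n)} {ρ' : Rn n → ℝ}
    (h : IsLocalDefiningFunction K x W ρ) (h' : IsLocalDefiningFunction K x W' ρ')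
    (hx : x ∈ frontier K) :
    ‖gradient ρ x‖⁻¹ • gradient ρ x = ‖gradient ρ' x‖⁻¹ • gradient ρ' x := by
  have g1 : 0 < ‖gradient ρ x‖ := norm_pos_iff.2 h.2.2.2.1
  have g2 : 0 < ‖gradient ρ' x‖ := norm_pos_iff.2 h'.2.2.2.1
  set a := ‖gradient ρ x‖⁻¹ • gradient ρ x with ha
  set b := ‖gradient ρ' x‖⁻¹ • gradient ρ' x with hb
  have na : ‖a‖ = 1 := by rw [ha, norm_smul]; simp [g1.ne']
  have nb : ‖b‖ = 1 := by rw [hb, norm_smul]; simp [g2.ne']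
  by_contra hab
  have hlt : inner ℝ a b < 1 := inner_lt_one_iff_real_of_norm_eq_one na nb |>.2 hab
  have h1 : inner ℝ a (b - a) < 0 := by
    rw [inner_sub_right, real_inner_self_eq_norm_sq, na]; linarith
  have h2 : inner ℝ (gradient ρ x) (b - a) < 0 := by
    rw [ha, inner_smul_left] at h1
    by_contra! hc
    exact absurd h1 (not_lt.2 (mul_nonneg (by simp) hc))
  have h3 := h.inner_nonpos h' (h.eq_zero h.2.1 hx) (h'.eq_zero h'.2.1 hx) h2
  have h4 : inner ℝ b (b - a) ≤ 0 := by
    rw [hb, inner_smul_left]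
    exact mul_nonpos_of_nonneg_of_nonpos (by simp) h3
  rw [inner_sub_right, real_inner_self_eq_norm_sq, nb, real_inner_comm] at h4
  linarith

/-- Makes the arbitrary choice in `outerNormal` harmless: any convenient defining function computes
it. -/
theorem outerNormal_eq (h : IsLocalDefiningFunction K x W ρ) (hx : x ∈ frontier K) :
    outerNormal K x = ‖gradient ρ x‖⁻¹ • gradient ρ x := by
  have hex : ∃ ν W ρ, IsLocalDefiningFunction K x W ρ ∧ ν = ‖gradient ρ x‖⁻¹ • gradient ρ x :=
    ⟨_, W, ρ, h, rfl⟩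
  rw [outerNormal, dif_pos hex]
  obtain ⟨W', ρ', h', e⟩ := hex.choose_spec
  rw [e]
  exact h'.normal_eq h hx

end Normal

/-! ### Isometric coordinates with a prescribed vertical direction -/

theorem exists_isometric_coordinates {m : ℕ} {ν : Rn (m + 1)} (hν : ‖ν‖ = 1) :
    ∃ A : (Rn m × ℝ) ≃L[ℝ] Rn (m + 1),
      (∀ p q, inner ℝ (A p) (A q) = inner ℝ p.1 q.1 + p.2 * q.2) ∧ A (0, 1) = ν ∧
        MeasurePreserving A volume volume := by
  have hfin : Module.finrank ℝ (WithLp 2 (Rn m × ℝ)) = m + 1 := by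
    rw [(WithLp.linearEquiv 2 ℝ (Rn m × ℝ)).finrank_eq]
    simp
  let Φ₀ : WithLp 2 (Rn m × ℝ) ≃ₗᵢ[ℝ] Rn (m + 1) :=
    ((stdOrthonormalBasis ℝ (WithLp 2 (Rn m × ℝ))).reindex (finCongr hfin)).repr
  have hu : ‖Φ₀ (WithLp.toLp 2 (0, 1))‖ = ‖ν‖ := by
    rw [LinearIsometryEquiv.norm_map, hν, WithLp.prod_norm_eq_of_L2]
    simp
  -- An arbitrary isometry `Φ₀`, corrected by the reflection that swaps the image of the vertical
  -- unit vector with `ν`.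
  let Φ : WithLp 2 (Rn m × ℝ) ≃ₗᵢ[ℝ] Rn (m + 1) :=
    Φ₀.trans (ℝ ∙ (Φ₀ (WithLp.toLp 2 (0, 1)) - ν))ᗮ.reflection
  refine ⟨(WithLp.prodContinuousLinearEquiv 2 ℝ (Rn m) ℝ).symm.trans Φ.toContinuousLinearEquiv,
    fun p q => ?_, ?_, ?_⟩
  · change inner ℝ (Φ (WithLp.toLp 2 p)) (Φ (WithLp.toLp 2 q)) = _
    rw [LinearIsometryEquiv.inner_map_map, WithLp.prod_inner_apply]
    simp [mul_comm]
  · change (ℝ ∙ (Φ₀ (WithLp.toLp 2 (0, 1)) - ν))ᗮ.reflection (Φ₀ (WithLp.toLp 2 (0, 1))) = ν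
    exact Submodule.reflection_sub hu
  · exact Φ.measurePreserving.comp (WithLp.volume_preserving_toLp (Rn m) ℝ)

/-! ### Graph charts -/

/-- In the isometric coordinates `A`, the set `K` is the subgraph `{t ≤ h y}` over the box
`B × (l, r)`. -/
structure IsGraphChart {m : ℕ} (K : Set (Rn (m + 1))) (A : (Rn m × ℝ) ≃L[ℝ] Rn (m + 1))
    (h : Rn m → ℝ) (B : Set (Rn m)) (l r : ℝ) : Prop where
  inner_map : ∀ p q, inner ℝ (A p) (A q) = inner ℝ p.1 q.1 + p.2 * q.2
  measurePreserving : MeasurePreserving A volume volume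
  isOpen : IsOpen B
  contDiffOn : ContDiffOn ℝ 1 h B
  mem_Ioo : ∀ y ∈ B, h y ∈ Ioo l r
  mem_iff : ∀ y ∈ B, ∀ t ∈ Ioo l r, (A (y, t) ∈ K ↔ t ≤ h y)

-- With the vertical axis along the normal, the vertical derivative of `ρ` at `x` is `‖∇ρ‖ > 0`. The
-- implicit function theorem gives the graph, and monotonicity in the vertical variable gives the
-- side on which `K` lies. The bounds on `fderiv ℝ h` and on `B` are there to make the surface
-- measure of the patch finite.
open Filter Topology in
theorem exists_isGraphChart {m : ℕ} {K : Set (Rn (m + 1))} {x : Rn (m + 1)}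
    (hx : x ∈ frontier K) {W₀ : Set (Rn (m + 1))} {ρ : Rn (m + 1) → ℝ}
    (hρ : IsLocalDefiningFunction K x W₀ ρ) {O : Set (Rn (m + 1))} (hO : O ∈ 𝓝 x) :
    ∃ A h B l r, IsGraphChart K A h B l r ∧ x ∈ A '' (B ×ˢ Ioo l r) ∧ A '' (B ×ˢ Ioo l r) ⊆ O ∧
      (∃ C, ∀ y ∈ B, ‖fderiv ℝ h y‖ ≤ C) ∧ Bornology.IsBounded B := by
  have hg : 0 < ‖gradient ρ x‖ := norm_pos_iff.2 hρ.2.2.2.1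
  obtain ⟨A, hA, hAν, hAv⟩ := exists_isometric_coordinates (m := m)
    (ν := ‖gradient ρ x‖⁻¹ • gradient ρ x) (by rw [norm_smul]; simp [hg.ne'])
  obtain ⟨⟨y₀, t₀⟩, rfl⟩ := A.surjective x
  set σ : Rn m × ℝ → ℝ := fun p => ρ (A p) with hσ
  have hσd : ∀ p, A p ∈ W₀ → ContDiffAt ℝ 1 σ p := fun p hp =>
    (hρ.contDiffAt hp).comp p A.contDiff.contDiffAt
  have hx0 : σ (y₀, t₀) = 0 := hρ.eq_zero hρ.2.1 hx
  have cdf : ContDiffAt ℝ 1 σ (y₀, t₀) := hσd _ hρ.2.1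
  have hσ' : fderiv ℝ σ (y₀, t₀) (0, 1) = ‖gradient ρ (A (y₀, t₀))‖ := by
    have h1 : HasFDerivAt σ ((fderiv ℝ ρ (A (y₀, t₀))).comp (A : (Rn m × ℝ) →L[ℝ] Rn (m + 1)))
        (y₀, t₀) :=
      ((hρ.contDiffAt hρ.2.1).differentiableAt one_ne_zero).hasFDerivAt.comp _ A.hasFDerivAt
    rw [h1.fderiv]
    change fderiv ℝ ρ (A (y₀, t₀)) (A (0, 1)) = _
    rw [hAν, ← inner_gradient_left, inner_smul_right, real_inner_self_eq_norm_sq]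
    field_simp
  have hinv : (fderiv ℝ σ (y₀, t₀) ∘L .inr ℝ (Rn m) ℝ).IsInvertible := by
    have e : fderiv ℝ σ (y₀, t₀) ∘L .inr ℝ (Rn m) ℝ =
        ‖gradient ρ (A (y₀, t₀))‖ • ContinuousLinearMap.id ℝ ℝ := by
      ext; simpa using hσ'
    rw [e]
    refine ContinuousLinearMap.IsInvertible.of_inverse
      (g := ‖gradient ρ (A (y₀, t₀))‖⁻¹ • ContinuousLinearMap.id ℝ ℝ) ?_ ?_
    · ext; simp [hg.ne']
    · ext; simp [hg.ne']
  set h := cdf.implicitFunction one_ne_zero hinv with hh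
  have hhd : ContDiffAt ℝ 1 h y₀ := cdf.contDiffAt_implicitFunction one_ne_zero hinv
  have hh0 : h y₀ = t₀ := cdf.implicitFunction_apply_self one_ne_zero hinv
  have hOW : ∀ᶠ p in 𝓝 (y₀, t₀), A p ∈ O ∩ W₀ :=
    A.continuous.continuousAt.eventually_mem (inter_mem hO (hρ.1.mem_nhds hρ.2.1))
  have hdpos : ∀ᶠ p in 𝓝 (y₀, t₀), 0 < fderiv ℝ σ p (0, 1) := by
    have h1 : ContinuousAt (fun p => fderiv ℝ σ p (0, 1)) (y₀, t₀) :=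
      (cdf.continuousAt_fderiv one_ne_zero).clm_apply continuousAt_const
    exact h1.eventually_const_lt (by simpa only [hσ'] using hg)
  have hiff := cdf.eventually_apply_eq_iff_implicitFunction one_ne_zero hinv
  have hall := hOW.and (hdpos.and hiff)
  rw [nhds_prod_eq, eventually_prod_iff] at hall
  obtain ⟨pa, hpa, pb, hpb, hab⟩ := hall
  obtain ⟨δ, hδ, hball⟩ := Metric.eventually_nhds_iff_ball.1 hpb
  have hcf : ContinuousAt (fun y => ‖fderiv ℝ h y‖) y₀ :=
    (hhd.continuousAt_fderiv one_ne_zero).norm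
  have hBev : ∀ᶠ y in 𝓝 y₀, pa y ∧ ContDiffAt ℝ 1 h y ∧ h y ∈ Ioo (t₀ - δ) (t₀ + δ) ∧
      ‖fderiv ℝ h y‖ < ‖fderiv ℝ h y₀‖ + 1 := by
    refine hpa.and ((hhd.eventually (by simp)).and (Eventually.and ?_ ?_))
    · refine hhd.continuousAt.eventually_mem ?_
      rw [hh0]
      exact Ioo_mem_nhds (by linarith) (by linarith)
    · exact hcf.eventually_lt_const (by linarith)
  obtain ⟨ε, hε, hB⟩ := Metric.eventually_nhds_iff_ball.1 hBev
  have hI : ∀ t ∈ Ioo (t₀ - δ) (t₀ + δ), pb t := fun t ht => hball t (by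
    rw [Real.ball_eq_Ioo]; exact ht)
  refine ⟨A, h, Metric.ball y₀ ε, t₀ - δ, t₀ + δ, ⟨hA, hAv, Metric.isOpen_ball, ?_, ?_, ?_⟩,
    ?_, ?_, ⟨_, fun y hy => (hB y hy).2.2.2.le⟩, Metric.isBounded_ball⟩
  · exact fun y hy => (hB y hy).2.1.contDiffWithinAt
  · exact fun y hy => (hB y hy).2.2.1
  · intro y hy t ht
    have hbox : ∀ s ∈ Ioo (t₀ - δ) (t₀ + δ), A (y, s) ∈ O ∩ W₀ ∧ 0 < fderiv ℝ σ (y, s) (0, 1) ∧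
        (σ (y, s) = σ (y₀, t₀) ↔ h y = s) := fun s hs => hab (hB y hy).1 (hI s hs)
    have hder : ∀ s ∈ Ioo (t₀ - δ) (t₀ + δ),
        HasDerivAt (fun s => σ (y, s)) (fderiv ℝ σ (y, s) (0, 1)) s := by
      intro s hs
      have h1 := ((hσd _ (hbox s hs).1.2).differentiableAt one_ne_zero).hasFDerivAt
      have h2 : HasDerivAt (fun s : ℝ => ((y, s) : Rn m × ℝ)) (0, 1) s :=
        (hasDerivAt_const s y).prodMk (hasDerivAt_id s)
      exact h1.comp_hasDerivAt s h2
    -- On each vertical segment `σ` increases strictly and vanishes at `h y`, so `σ ≤ 0` exactly up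
    -- to height `h y`.
    have hmono : StrictMonoOn (fun s => σ (y, s)) (Ioo (t₀ - δ) (t₀ + δ)) := by
      refine strictMonoOn_of_deriv_pos (convex_Ioo _ _)
        (fun s hs => (hder s hs).continuousAt.continuousWithinAt) fun s hs => ?_
      rw [interior_Ioo] at hs
      rw [(hder s hs).deriv]
      exact (hbox s hs).2.1
    have hhy := (hB y hy).2.2.1
    have hzero : σ (y, h y) = 0 := by rw [← hx0]; exact (hbox _ hhy).2.2.2 rfl
    rw [hρ.2.2.2.2 _ (hbox t ht).1.2]
    have := hmono.le_iff_le ht hhy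
    simp only [hzero] at this
    exact this
  · exact ⟨(y₀, t₀), ⟨Metric.mem_ball_self hε, by simpa using hδ⟩, rfl⟩
  · rintro _ ⟨⟨y, t⟩, ⟨hy, ht⟩, rfl⟩
    exact (hab (hB y hy).1 (hI t ht)).1.1

namespace IsGraphChart

variable {m : ℕ} {K : Set (Rn (m + 1))} {A : (Rn m × ℝ) ≃L[ℝ] Rn (m + 1)}
  {h : Rn m → ℝ} {B : Set (Rn m)} {l r : ℝ}

theorem isOpen_image (H : IsGraphChart K A h B l r) : IsOpen (A '' (B ×ˢ Ioo l r)) :=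
  A.toHomeomorph.isOpenMap _ (H.isOpen.prod isOpen_Ioo)

theorem hasFDerivAt (H : IsGraphChart K A h B l r) {y : Rn m} (hy : y ∈ B) :
    HasFDerivAt h (fderiv ℝ h y) y :=
  ((H.contDiffOn.contDiffAt (H.isOpen.mem_nhds hy)).differentiableAt one_ne_zero).hasFDerivAt

theorem continuousOn_gradient (H : IsGraphChart K A h B l r) : ContinuousOn (gradient h) B :=
  (InnerProductSpace.toDual ℝ (Rn m)).symm.continuous.comp_continuousOn
    (H.contDiffOn.continuousOn_fderiv_of_isOpen H.isOpen le_rfl)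

theorem hasGradientAt (H : IsGraphChart K A h B l r) {y : Rn m} (hy : y ∈ B) (t : ℝ) :
    HasGradientAt (fun x => (A.symm x).2 - h (A.symm x).1) (A (-gradient h y, 1)) (A (y, t)) := by
  rw [hasGradientAt_iff_hasFDerivAt]
  have h1 : HasFDerivAt (fun x => (A.symm x).1)
      ((ContinuousLinearMap.fst ℝ (Rn m) ℝ).comp (A.symm : Rn (m + 1) →L[ℝ] Rn m × ℝ))
      (A (y, t)) := hasFDerivAt_fst.comp _ A.symm.hasFDerivAt
  have h2 : HasFDerivAt (fun x => (A.symm x).2)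
      ((ContinuousLinearMap.snd ℝ (Rn m) ℝ).comp (A.symm : Rn (m + 1) →L[ℝ] Rn m × ℝ))
      (A (y, t)) := hasFDerivAt_snd.comp _ A.symm.hasFDerivAt
  have h3 : HasFDerivAt h (fderiv ℝ h y) (A.symm (A (y, t))).1 := by
    simpa using H.hasFDerivAt hy
  convert! h2.sub (h3.comp (A (y, t)) h1) using 1
  ext1 z
  obtain ⟨q, rfl⟩ := A.surjective z
  rw [InnerProductSpace.toDual_apply_apply, H.inner_map]
  simp [inner_neg_left, inner_gradient_left]
  ring

theorem isLocalDefiningFunction (H : IsGraphChart K A h B l r) {y : Rn m} (hy : y ∈ B) :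
    IsLocalDefiningFunction K (A (y, h y)) (A '' (B ×ˢ Ioo l r))
        (fun x => (A.symm x).2 - h (A.symm x).1) ∧
      gradient (fun x => (A.symm x).2 - h (A.symm x).1) (A (y, h y)) =
        A (-gradient h y, 1) := by
  have hmem : ∀ {x}, x ∈ A '' (B ×ˢ Ioo l r) → (A.symm x).1 ∈ B ∧ (A.symm x).2 ∈ Ioo l r := by
    rintro _ ⟨p, hp, rfl⟩
    simpa using hp
  have hgrad := H.hasGradientAt hy (h y)
  refine ⟨⟨H.isOpen_image, ⟨(y, h y), ⟨hy, H.mem_Ioo y hy⟩, rfl⟩, ?_, ?_, ?_⟩, hgrad.gradient⟩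
  · refine ContDiffOn.sub ?_ ?_
    · exact (contDiff_snd.comp A.symm.contDiff).contDiffOn
    · exact H.contDiffOn.comp (contDiff_fst.comp A.symm.contDiff).contDiffOn
        fun x hx => (hmem hx).1
  · rw [hgrad.gradient]
    intro h0
    have : ((-gradient h y, 1) : Rn m × ℝ) = 0 := by simp at h0
    simpa using congrArg Prod.snd this
  · rintro _ ⟨⟨z, t⟩, ⟨hz, ht⟩, rfl⟩
    simpa using H.mem_iff z hz t ht

theorem graph_mem_frontier (H : IsGraphChart K A h B l r) {y : Rn m} (hy : y ∈ B) :
    A (y, h y) ∈ frontier K := by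
  have hI := H.mem_Ioo y hy
  refine ⟨subset_closure ((H.mem_iff y hy _ hI).2 le_rfl), fun hint => ?_⟩
  have hc : Continuous fun t : ℝ => A (y, t) := by fun_prop
  have h1 : ∀ᶠ t in nhdsWithin (h y) (Ioi (h y)), A (y, t) ∈ K ∧ t ∈ Ioo l r :=
    ((hc.continuousAt.eventually_mem (mem_interior_iff_mem_nhds.1 hint)).and
      (Ioo_mem_nhds hI.1 hI.2)).filter_mono nhdsWithin_le_nhds
  obtain ⟨t, ⟨htK, htI⟩, ht⟩ := (h1.and eventually_mem_nhdsWithin).exists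
  exact absurd ((H.mem_iff y hy t htI).1 htK) (not_le.2 ht)

theorem frontier_inter (H : IsGraphChart K A h B l r) :
    frontier K ∩ A '' (B ×ˢ Ioo l r) = (fun y => A (y, h y)) '' B := by
  ext x
  constructor
  · rintro ⟨hx, ⟨y, t⟩, ⟨hy, ht⟩, rfl⟩
    refine ⟨y, hy, ?_⟩
    have := (H.isLocalDefiningFunction hy).1.eq_zero (y := A (y, t)) ⟨(y, t), ⟨hy, ht⟩, rfl⟩ hx
    simp only [ContinuousLinearEquiv.symm_apply_apply, sub_eq_zero] at this
    simp only [this]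
  · rintro ⟨y, hy, rfl⟩
    exact ⟨H.graph_mem_frontier hy, (y, h y), ⟨hy, H.mem_Ioo y hy⟩, rfl⟩

theorem norm_map_graph_normal (H : IsGraphChart K A h B l r) (y : Rn m) :
    ‖A (-gradient h y, 1)‖ = Real.sqrt (1 + ‖gradient h y‖ ^ 2) := by
  rw [norm_eq_sqrt_real_inner, H.inner_map]
  simp [add_comm]

theorem outerNormal_graph (H : IsGraphChart K A h B l r) {y : Rn m} (hy : y ∈ B) :
    outerNormal K (A (y, h y)) =
      (Real.sqrt (1 + ‖gradient h y‖ ^ 2))⁻¹ • A (-gradient h y, 1) := by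
  rw [outerNormal_eq (H.isLocalDefiningFunction hy).1 (H.graph_mem_frontier hy),
    (H.isLocalDefiningFunction hy).2, H.norm_map_graph_normal]

/-- The area formula for `y ↦ A (y, h y)`, whose measurable left inverse is the projection to the
base; the density is the Jacobian from `normDet_graph`. -/
theorem map_surfaceMeasure (H : IsGraphChart K A h B l r) :
    ((surfaceMeasure m).restrict (frontier K ∩ A '' (B ×ˢ Ioo l r))).map
        (fun x => (A.symm x).1) =
      (volume.restrict B).withDensity
        fun y => ENNReal.ofReal (Real.sqrt (1 + ‖gradient h y‖ ^ 2)) := by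
  rw [H.frontier_inter]
  refine map_euclideanHausdorffMeasure_restrict_image H.isOpen.measurableSet
    (by fun_prop) (fun y _ => by simp)
    (T := fun y => (A : (Rn m × ℝ) →L[ℝ] Rn (m + 1)).comp
      ((ContinuousLinearMap.id ℝ _).prod (innerSL ℝ (gradient h y)))) ?_ ?_ ?_ ?_ ?_
  · intro y hy
    have h1 : HasStrictFDerivAt h (fderiv ℝ h y) y :=
      (H.contDiffOn.contDiffAt (H.isOpen.mem_nhds hy)).hasStrictFDerivAt one_ne_zero
    have h2 : innerSL ℝ (gradient h y) = fderiv ℝ h y := by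
      ext1 z; rw [innerSL_apply_apply, inner_gradient_left]
    rw [h2]
    exact A.hasStrictFDerivAt.comp y ((hasStrictFDerivAt_id y).prodMk h1)
  · intro y hy z z' hz
    have : ((z, inner ℝ (gradient h y) z) : Rn m × ℝ) = (z', inner ℝ (gradient h y) z') :=
      A.injective hz
    exact congrArg Prod.fst this
  · exact (continuousOn_const.add (H.continuousOn_gradient.norm.pow 2)).sqrt
  · intro y _
    exact (normDet_graph (A : (Rn m × ℝ) →L[ℝ] Rn (m + 1)) H.inner_map _).symm
  · intro y _
    positivity

theorem setIntegral_frontier {F : Type*} [NormedAddCommGroup F] [NormedSpace ℝ F]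
    (H : IsGraphChart K A h B l r) {G : Rn (m + 1) → F}
    (hG : ContinuousOn (fun y => G (A (y, h y))) B) :
    ∫ x in frontier K ∩ A '' (B ×ˢ Ioo l r), G x ∂(surfaceMeasure m) =
      ∫ y in B, Real.sqrt (1 + ‖gradient h y‖ ^ 2) • G (A (y, h y)) := by
  have hm : MeasurableSet (frontier K ∩ A '' (B ×ˢ Ioo l r)) :=
    isClosed_frontier.measurableSet.inter H.isOpen_image.measurableSet
  have hac : (volume.restrict B).withDensity
      (fun y => ENNReal.ofReal (Real.sqrt (1 + ‖gradient h y‖ ^ 2))) ≪ volume.restrict B :=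
    withDensity_absolutelyContinuous _ _
  have hgm : AEStronglyMeasurable (fun y => G (A (y, h y))) (volume.restrict B) :=
    hG.aestronglyMeasurable H.isOpen.measurableSet
  have h1 : ∫ x in frontier K ∩ A '' (B ×ˢ Ioo l r), G x ∂(surfaceMeasure m) =
      ∫ x in frontier K ∩ A '' (B ×ˢ Ioo l r),
        (fun y => G (A (y, h y))) ((A.symm x).1) ∂(surfaceMeasure m) := by
    refine setIntegral_congr_fun hm fun x hx => ?_
    rw [H.frontier_inter] at hx
    obtain ⟨y, hy, rfl⟩ := hx
    simp
  rw [h1, ← integral_map (φ := fun x => (A.symm x).1) (f := fun y => G (A (y, h y)))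
    (Continuous.aemeasurable (by fun_prop))
    (by rw [H.map_surfaceMeasure]; exact hgm.mono_ac hac), H.map_surfaceMeasure]
  have hJm : AEMeasurable (fun y => Real.toNNReal (Real.sqrt (1 + ‖gradient h y‖ ^ 2)))
      (volume.restrict B) := by
    refine AEMeasurable.real_toNNReal ?_
    exact ((continuousOn_const.add (H.continuousOn_gradient.norm.pow 2)).sqrt).aemeasurable
      H.isOpen.measurableSet
  have := integral_withDensity_eq_integral_smul₀ hJm (fun y => G (A (y, h y)))
  rw [show (fun y => ENNReal.ofReal (Real.sqrt (1 + ‖gradient h y‖ ^ 2))) =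
    fun y => ((Real.toNNReal (Real.sqrt (1 + ‖gradient h y‖ ^ 2)) : NNReal) : ENNReal) from rfl,
    this]
  refine integral_congr_ae (Filter.Eventually.of_forall fun y => ?_)
  simp only [NNReal.smul_def]
  rw [Real.coe_toNNReal _ (Real.sqrt_nonneg _)]

theorem surfaceMeasure_lt_top (H : IsGraphChart K A h B l r)
    (hC : ∃ C, ∀ y ∈ B, ‖fderiv ℝ h y‖ ≤ C) (hB : Bornology.IsBounded B) :
    surfaceMeasure m (frontier K ∩ A '' (B ×ˢ Ioo l r)) < ⊤ := by
  obtain ⟨C, hC⟩ := hC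
  have hmeas : Measurable fun x : Rn (m + 1) => (A.symm x).1 := by fun_prop
  have h1 := congrArg (fun μ => μ univ) H.map_surfaceMeasure
  rw [Measure.map_apply hmeas MeasurableSet.univ, preimage_univ, Measure.restrict_apply_univ,
    withDensity_apply _ MeasurableSet.univ, setLIntegral_univ] at h1
  rw [h1]
  refine (setLIntegral_mono' (g := fun _ => ENNReal.ofReal (Real.sqrt (1 + C ^ 2)))
    H.isOpen.measurableSet fun y hy => ?_).trans_lt ?_
  · refine ENNReal.ofReal_le_ofReal (Real.sqrt_le_sqrt ?_)
    have h2 : ‖gradient h y‖ = ‖fderiv ℝ h y‖ := by simp [gradient]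
    have := hC y hy
    rw [h2]
    gcongr
  · rw [setLIntegral_const]
    exact ENNReal.mul_lt_top ENNReal.ofReal_lt_top hB.measure_lt_top

end IsGraphChart

/-! ### Divergence -/

/-- The divergence of a field `X` of linear maps, `X x ν` being the flux in the direction `ν`. -/
noncomputable def divergence {n : ℕ} {F : Type*} [NormedAddCommGroup F] [NormedSpace ℝ F]
    (X : Rn n → Rn n →L[ℝ] F) (x : Rn n) : F :=
  ∑ j, fderiv ℝ X x (stdVec j) (stdVec j)

section Divergence

open Filter Topology

variable {n m : ℕ} {F : Type*} [NormedAddCommGroup F] [NormedSpace ℝ F]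

theorem divergence_congr {X Y : Rn n → Rn n →L[ℝ] F} {x : Rn n} (h : X =ᶠ[𝓝 x] Y) :
    divergence X x = divergence Y x := by
  simp only [divergence, h.fderiv_eq]

theorem support_divergence_subset (X : Rn n → Rn n →L[ℝ] F) :
    Function.support (divergence X) ⊆ tsupport X := by
  intro x hx
  by_contra h
  refine hx ?_
  have : fderiv ℝ X x = 0 := by
    have := notMem_tsupport_iff_eventuallyEq.1 h
    rw [this.fderiv_eq]
    simp
  simp [divergence, this]

theorem divergence_smul {χ : Rn n → ℝ} {X : Rn n → Rn n →L[ℝ] F} {x : Rn n}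
    (hχ : DifferentiableAt ℝ χ x) (hX : DifferentiableAt ℝ X x) :
    divergence (fun y => χ y • X y) x = χ x • divergence X x + X x (gradient χ x) := by
  have h1 : gradient χ x = ∑ j, fderiv ℝ χ x (stdVec j) • stdVec j := by
    ext i
    simp [stdVec, ← inner_gradient_left, EuclideanSpace.inner_single_right, Finset.sum_apply,
      Pi.single_apply]
  simp only [divergence]
  rw [fderiv_fun_smul hχ hX, h1, map_sum, Finset.smul_sum, ← Finset.sum_add_distrib]
  refine Finset.sum_congr rfl fun j _ => ?_
  simp

/-- The regularity class "differentiable with continuous divergence" survives cutting off, because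
`div (χ X) = χ div X + X (∇χ)` contains no derivative of `X` other than its divergence. This is what
allows localisation without assuming `X` to be C¹. -/
theorem differentiable_smul_of_tsupport_subset {χ : Rn n → ℝ} {X : Rn n → Rn n →L[ℝ] F}
    {U : Set (Rn n)} (hU : IsOpen U) (hχ : ContDiffOn ℝ 1 χ U) (hX : DifferentiableOn ℝ X U)
    (hd : ContinuousOn (divergence X) U) (hs : tsupport (fun x => χ x • X x) ⊆ U) :
    Differentiable ℝ (fun x => χ x • X x) ∧ Continuous (divergence fun x => χ x • X x) := by
  have hχd : ∀ x ∈ U, DifferentiableAt ℝ χ x := fun x hx =>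
    (hχ.contDiffAt (hU.mem_nhds hx)).differentiableAt one_ne_zero
  constructor
  · intro x
    by_cases hx : x ∈ U
    · exact (hχd x hx).smul (hX.differentiableAt (hU.mem_nhds hx))
    · have := notMem_tsupport_iff_eventuallyEq.1 fun h => hx (hs h)
      exact this.differentiableAt_iff.2 (differentiableAt_const _)
  · refine continuous_of_tsupport fun x hx => ?_
    have hxU : x ∈ U :=
      hs (closure_minimal (support_divergence_subset _) (isClosed_tsupport _) hx)
    have hev : divergence (fun x => χ x • X x) =ᶠ[𝓝 x]
        fun x => χ x • divergence X x + X x (gradient χ x) := by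
      filter_upwards [hU.mem_nhds hxU] with y hy
      exact divergence_smul (hχd y hy) (hX.differentiableAt (hU.mem_nhds hy))
    refine ContinuousAt.congr ?_ hev.symm
    have hg : ContinuousAt (gradient χ) x :=
      (InnerProductSpace.toDual ℝ (Rn n)).symm.continuous.continuousAt.comp
        ((hχ.contDiffAt (hU.mem_nhds hxU)).continuousAt_fderiv one_ne_zero)
    exact ((hχd x hxU).continuousAt.smul (hd.continuousAt (hU.mem_nhds hxU))).add
      ((hX.differentiableAt (hU.mem_nhds hxU)).continuousAt.clm_apply hg)

/-- The divergence theorem on a box asks only for differentiability and an integrable divergence; on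
a box larger than the support all face terms vanish. -/
theorem integral_divergence_eq_zero [CompleteSpace F] {X : Rn (m + 1) → Rn (m + 1) →L[ℝ] F}
    (hX : Differentiable ℝ X) (hd : Continuous (divergence X)) (hs : HasCompactSupport X) :
    ∫ x, divergence X x = 0 := by
  obtain ⟨R, hR⟩ := hs.isBounded.subset_closedBall 0
  have hzero : ∀ x : Rn (m + 1), R < ‖x‖ → X x = 0 := by
    intro x hx
    by_contra h
    have := hR (subset_tsupport _ h)
    rw [mem_closedBall_zero_iff] at this
    linarith
  have hzero' : ∀ x : Rn (m + 1), R < ‖x‖ → divergence X x = 0 := by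
    intro x hx
    by_contra h
    have := hR (support_divergence_subset _ h)
    rw [mem_closedBall_zero_iff] at this
    linarith
  -- The faces must lie strictly outside the ball of radius `R`, and `b` must be nonnegative even
  -- when `R` is not.
  set b : ℝ := |R| + 1 with hb
  have hRb : R < b := by rw [hb]; linarith [le_abs_self R]
  have hb0 : 0 ≤ b := by positivity
  let e : (Fin (m + 1) → ℝ) ≃L[ℝ] Rn (m + 1) := (EuclideanSpace.equiv (Fin (m + 1)) ℝ).symm
  have hbox := integral_divergence_of_hasFDerivAt_off_countable' (n := m)
    (fun _ => -b) (fun _ => b) (fun _ => by simp only; linarith)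
    (fun i y => X (e y) (stdVec i))
    (fun i y => (ContinuousLinearMap.apply ℝ F (stdVec i)).comp
      ((fderiv ℝ X (e y)).comp (e : (Fin (m + 1) → ℝ) →L[ℝ] Rn (m + 1)))) ∅ countable_empty
    (fun i => ((hX.continuous.comp e.continuous).clm_apply continuous_const).continuousOn)
    (fun y _ i => (ContinuousLinearMap.apply ℝ F (stdVec i)).hasFDerivAt.comp y
      ((hX (e y)).hasFDerivAt.comp y e.hasFDerivAt)) ?_
  · have hsum : ∀ y, (∑ i, ((ContinuousLinearMap.apply ℝ F (stdVec i)).comp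
        ((fderiv ℝ X (e y)).comp (e : (Fin (m + 1) → ℝ) →L[ℝ] Rn (m + 1)))) (Pi.single i 1)) =
        divergence X (e y) := fun y => rfl
    have hface : ∀ (i : Fin (m + 1)) (c : ℝ) (z : Fin m → ℝ), |c| = b →
        X (e (i.insertNth c z)) = 0 := by
      intro i c z hc
      refine hzero _ (hRb.trans_le ?_)
      have h1 : (e (i.insertNth c z)) i = c := by simp [e]
      have h2 := PiLp.norm_apply_le (e (i.insertNth c z)) i
      rwa [h1, Real.norm_eq_abs, hc] at h2
    simp only [hsum] at hbox
    rw [← (PiLp.volume_preserving_toLp (Fin (m + 1))).integral_comp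
      (MeasurableEquiv.toLp 2 (Fin (m + 1) → ℝ)).measurableEmbedding]
    change ∫ y, divergence X (e y) = 0
    rw [← setIntegral_eq_integral_of_forall_compl_eq_zero
      (s := Icc (fun _ => -b) (fun _ => b)), hbox]
    · refine Finset.sum_eq_zero fun i _ => ?_
      rw [sub_eq_zero]
      refine (integral_eq_zero_of_ae (Eventually.of_forall fun z => ?_)).trans
        (integral_eq_zero_of_ae (Eventually.of_forall fun z => ?_)).symm
      · simp only [hface i b z (abs_of_nonneg hb0)]; rfl
      · simp only [hface i (-b) z (by rw [abs_neg, abs_of_nonneg hb0])]; rfl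
    · intro y hy
      refine hzero' _ (lt_of_not_ge fun hle => hy ?_)
      have : ∀ i, |y i| ≤ b := fun i =>
        (PiLp.norm_apply_le (e y) i).trans (hle.trans hRb.le)
      exact ⟨fun i => (abs_le.1 (this i)).1, fun i => (abs_le.1 (this i)).2⟩
  · exact ((hd.comp e.continuous).continuousOn).integrableOn_compact isCompact_Icc

end Divergence

/-! ### Thin layers above a graph. -/

section Layer

open Filter Topology

/-- A continuous bump on `[0, 1]` with integral one: the derivative of the smooth step. -/
theorem deriv_smoothTransition_spec :
    Continuous (deriv Real.smoothTransition) ∧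
      (∀ t ∉ Icc (0 : ℝ) 1, deriv Real.smoothTransition t = 0) ∧
      ∫ t, deriv Real.smoothTransition t = 1 := by
  have hcd : ContDiff ℝ 1 Real.smoothTransition := Real.smoothTransition.contDiff
  have hc : Continuous (deriv Real.smoothTransition) := hcd.continuous_deriv le_rfl
  have hz : ∀ t ∉ Icc (0 : ℝ) 1, deriv Real.smoothTransition t = 0 := by
    intro t ht
    rw [mem_Icc, not_and_or, not_le, not_le] at ht
    rcases ht with h | h
    · have : Real.smoothTransition =ᶠ[𝓝 t] fun _ => 0 := by
        filter_upwards [Iio_mem_nhds h] with s hs using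
          Real.smoothTransition.zero_of_nonpos (le_of_lt hs)
      rw [this.deriv_eq, deriv_const]
    · have : Real.smoothTransition =ᶠ[𝓝 t] fun _ => 1 := by
        filter_upwards [Ioi_mem_nhds h] with s hs using
          Real.smoothTransition.one_of_one_le (le_of_lt hs)
      rw [this.deriv_eq, deriv_const]
  refine ⟨hc, hz, ?_⟩
  rw [← intervalIntegral.integral_eq_integral_of_support_subset (a := -1) (b := 2),
    intervalIntegral.integral_deriv_eq_sub]
  · rw [Real.smoothTransition.one_of_one_le (by norm_num),
      Real.smoothTransition.zero_of_nonpos (by norm_num)]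
    norm_num
  · exact fun t _ => hcd.differentiable one_ne_zero t
  · exact hc.intervalIntegrable _ _
  · intro t ht
    by_contra h
    refine ht (hz t fun h' => h ⟨by linarith [h'.1], by linarith [h'.2]⟩)

variable {m : ℕ} {F : Type*} [NormedAddCommGroup F] [NormedSpace ℝ F]

/-- Averages of `Y` over thin layers above the graph of `h` converge to its integral over the
graph. -/
theorem tendsto_integral_layer {k : ℝ → ℝ} (hk : Continuous k)
    (hk0 : ∀ t ∉ Icc (0 : ℝ) 1, k t = 0) (hk1 : ∫ t, k t = 1) [CompleteSpace F]
    {B : Set (Rn m)} (hB : IsOpen B) {h : Rn m → ℝ} (hh : ContinuousOn h B)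
    {Y : Rn m × ℝ → F} (hY : Continuous Y) (hYc : HasCompactSupport Y)
    (hYB : tsupport Y ⊆ B ×ˢ univ) :
    Tendsto (fun ε : ℝ => ∫ p, (ε⁻¹ * k ((p.2 - h p.1) / ε)) • Y p) (𝓝[>] 0)
      (𝓝 (∫ y, Y (y, h y))) := by
  have hki : Integrable k := hk.integrable_of_hasCompactSupport
    (HasCompactSupport.intro isCompact_Icc hk0)
  obtain ⟨C, hC⟩ := hYc.exists_bound_of_continuous hY
  have hC0 : 0 ≤ C := (norm_nonneg _).trans (hC (0, 0))
  set S : Set (Rn m) := Prod.fst '' tsupport Y with hS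
  have hSc : IsCompact S := hYc.image continuous_fst
  have hYS : ∀ y ∉ S, ∀ t, Y (y, t) = 0 := fun y hy t =>
    image_eq_zero_of_notMem_tsupport fun h' => hy ⟨(y, t), h', rfl⟩
  have hZ : ∀ ε : ℝ, Integrable fun p : Rn m × ℝ => (ε⁻¹ * k ((p.2 - h p.1) / ε)) • Y p := by
    intro ε
    have hsub : tsupport (fun p : Rn m × ℝ => (ε⁻¹ * k ((p.2 - h p.1) / ε)) • Y p) ⊆ tsupport Y :=
      closure_mono (Function.support_smul_subset_right _ _)
    refine Continuous.integrable_of_hasCompactSupport ?_ (hYc.mono' ?_)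
    · refine continuous_of_tsupport fun p hp => ?_
      have hpB : p.1 ∈ B := (hYB (hsub hp)).1
      have : ContinuousAt (fun p : Rn m × ℝ => h p.1) p :=
        (hh.continuousAt (hB.mem_nhds hpB)).comp continuousAt_fst
      refine ContinuousAt.smul (continuousAt_const.mul ?_) hY.continuousAt
      exact hk.continuousAt.comp (((continuousAt_snd).sub this).div_const ε)
    · exact (subset_tsupport _).trans hsub
  -- The substitution `t = h y + ε s` moves `ε` from the kernel into the continuous function `Y`, so
  -- that dominated convergence applies.
  have hinner : ∀ ε : ℝ, 0 < ε → ∀ y, ∫ t, (ε⁻¹ * k ((t - h y) / ε)) • Y (y, t) =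
      ∫ s, k s • Y (y, h y + ε * s) := by
    intro ε hε y
    have h1 := Measure.integral_comp_mul_left
      (fun t => (ε⁻¹ * k (t / ε)) • Y (y, h y + t)) ε
    have h2 := integral_add_left_eq_self (μ := volume)
      (fun t => (ε⁻¹ * k ((t - h y) / ε)) • Y (y, t)) (h y)
    rw [← h2]
    simp only [add_sub_cancel_left]
    have h3 : ∀ s, (ε⁻¹ * k (ε * s / ε)) • Y (y, h y + ε * s) =
        ε⁻¹ • (k s • Y (y, h y + ε * s)) := fun s => by
      rw [mul_div_cancel_left₀ _ hε.ne', mul_smul]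
    simp only [h3, integral_smul, abs_of_pos (inv_pos.2 hε)] at h1
    exact (smul_right_injective F (inv_ne_zero hε.ne') h1).symm
  have hint : ∀ ε : ℝ, 0 < ε → ∫ p, (ε⁻¹ * k ((p.2 - h p.1) / ε)) • Y p =
      ∫ y, ∫ s, k s • Y (y, h y + ε * s) := by
    intro ε hε
    rw [Measure.volume_eq_prod, integral_prod _ (hZ ε)]
    exact integral_congr_ae (Eventually.of_forall fun y => hinner ε hε y)
  have hev : (fun ε : ℝ => ∫ y, ∫ s, k s • Y (y, h y + ε * s)) =ᶠ[𝓝[>] 0]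
      fun ε : ℝ => ∫ p, (ε⁻¹ * k ((p.2 - h p.1) / ε)) • Y p := by
    filter_upwards [self_mem_nhdsWithin] with ε hε using (hint ε hε).symm
  refine Tendsto.congr' hev ?_
  refine tendsto_integral_filter_of_dominated_convergence
    (S.indicator fun _ => (∫ s, ‖k s‖) * C) ?_ ?_ ?_ ?_
  · filter_upwards [self_mem_nhdsWithin] with ε hε
    have := (hZ ε).integral_prod_left
    refine this.aestronglyMeasurable.congr (Eventually.of_forall fun y => ?_)
    exact hinner ε hε y
  · refine Eventually.of_forall fun ε => Eventually.of_forall fun y => ?_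
    by_cases hy : y ∈ S
    · rw [indicator_of_mem hy, ← integral_mul_const]
      refine norm_integral_le_of_norm_le (hki.norm.mul_const C) (Eventually.of_forall fun s => ?_)
      rw [norm_smul]
      gcongr
      exact hC _
    · rw [indicator_of_notMem hy]
      simp [hYS y hy]
  · exact (integrable_indicator_iff hSc.measurableSet).2 (integrableOn_const hSc.measure_ne_top)
  · refine Eventually.of_forall fun y => ?_
    have h1 : Y (y, h y) = ∫ s, k s • Y (y, h y + 0 * s) := by
      simp [integral_smul_const, hk1]
    rw [h1]
    refine tendsto_integral_filter_of_dominated_convergence (fun s => ‖k s‖ * C) ?_ ?_ ?_ ?_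
    · exact Eventually.of_forall fun ε =>
        (hk.smul (hY.comp (by fun_prop))).aestronglyMeasurable
    · refine Eventually.of_forall fun ε => Eventually.of_forall fun s => ?_
      rw [norm_smul]
      gcongr
      exact hC _
    · exact hki.norm.mul_const C
    · refine Eventually.of_forall fun s => ?_
      have : Continuous fun ε : ℝ => k s • Y (y, h y + ε * s) := by fun_prop
      exact (this.tendsto 0).mono_left nhdsWithin_le_nhds

end Layer

/-! ### The divergence theorem inside one graph chart. -/

section Chart

open Filter Topology

variable {m : ℕ} {F : Type*} [NormedAddCommGroup F] [NormedSpace ℝ F] [CompleteSpace F]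
  {K : Set (Rn (m + 1))} {A : (Rn m × ℝ) ≃L[ℝ] Rn (m + 1)} {h : Rn m → ℝ} {B : Set (Rn m)}
  {l r : ℝ}

/-- The factor `1 - smoothTransition (ρ / ε)` is 1 where `ρ ≤ 0` and 0 where `ρ ≥ ε`. The cut-off
field has total divergence zero, which balances an integral tending to that of `div X` over `K`
against a layer integral tending to the flux through the graph. -/
theorem IsGraphChart.setIntegral_divergence (H : IsGraphChart K A h B l r) (hK : IsClosed K)
    {X : Rn (m + 1) → Rn (m + 1) →L[ℝ] F} (hX : Differentiable ℝ X)
    (hd : Continuous (divergence X)) (hs : HasCompactSupport X)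
    (hsub : tsupport X ⊆ A '' (B ×ˢ Ioo l r)) :
    ∫ x in K, divergence X x = ∫ x in frontier K, X x (outerNormal K x) ∂(surfaceMeasure m) := by
  obtain ⟨hk, hk0, hk1⟩ := deriv_smoothTransition_spec
  set k := deriv Real.smoothTransition with hkdef
  have hst : ∀ t, HasDerivAt Real.smoothTransition (k t) t := fun t =>
    ((Real.smoothTransition.contDiff (n := 1)).differentiable one_ne_zero t).hasDerivAt
  set U := A '' (B ×ˢ Ioo l r) with hU
  have hmemB : ∀ {x}, x ∈ U → (A.symm x).1 ∈ B := by
    rintro _ ⟨p, hp, rfl⟩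
    simpa using hp.1
  set ρ : Rn (m + 1) → ℝ := fun x => (A.symm x).2 - h (A.symm x).1 with hρ
  have hρd : ContDiffOn ℝ 1 ρ U :=
    (contDiff_snd.comp A.symm.contDiff).contDiffOn.sub
      (H.contDiffOn.comp (contDiff_fst.comp A.symm.contDiff).contDiffOn fun x hx => hmemB hx)
  -- `N` is `∇ρ`, not normalised; its length is the surface density `√(1 + ‖∇h‖²)`.
  set N : Rn (m + 1) → Rn (m + 1) := fun x => A (-gradient h (A.symm x).1, 1) with hN
  have hρg : ∀ x ∈ U, HasGradientAt ρ (N x) x := by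
    intro x hx
    have := H.hasGradientAt (hmemB hx) (A.symm x).2
    simpa using this
  have hNc : ContinuousOn N U := by
    refine A.continuous.comp_continuousOn (ContinuousOn.prodMk ?_ continuousOn_const)
    exact (H.continuousOn_gradient.comp (by fun_prop) fun x hx => hmemB hx).neg
  set G : Rn (m + 1) → F := fun x => X x (N x) with hG
  have hGs : Function.support G ⊆ Function.support X := by
    intro x hx h0
    exact hx (by simp [hG, h0])
  have hGts : tsupport G ⊆ tsupport X := closure_mono hGs
  have hGc : Continuous G := continuous_of_tsupport fun x hx =>
    hX.continuous.continuousAt.clm_apply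
      (hNc.continuousAt (H.isOpen_image.mem_nhds (hsub (hGts hx))))
  have hdzero : ∀ x ∉ U, divergence X x = 0 := fun x hx => by
    by_contra h'
    exact hx (hsub (support_divergence_subset X h'))
  have hdc : HasCompactSupport (divergence X) := hs.mono' (support_divergence_subset X)
  have hcut : ∀ ε : ℝ, 0 < ε →
      ∫ x, (1 - Real.smoothTransition (ρ x / ε)) • divergence X x =
        ∫ x, (ε⁻¹ * k (ρ x / ε)) • G x := by
    intro ε hε
    have hφ : ContDiffOn ℝ 1 (fun x => 1 - Real.smoothTransition (ρ x / ε)) U :=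
      contDiffOn_const.sub (Real.smoothTransition.contDiff.comp_contDiffOn (hρd.div_const ε))
    have hsup : tsupport (fun x => (1 - Real.smoothTransition (ρ x / ε)) • X x) ⊆ tsupport X :=
      closure_mono fun x hx h0 => hx (by simp only [h0, smul_zero])
    obtain ⟨e1, e2⟩ := differentiable_smul_of_tsupport_subset H.isOpen_image hφ
      hX.differentiableOn hd.continuousOn (hsup.trans hsub)
    have e3 := integral_divergence_eq_zero e1 e2
      (hs.mono' (subset_tsupport _ |>.trans hsup))
    have e4 : ∀ x, divergence (fun x => (1 - Real.smoothTransition (ρ x / ε)) • X x) x =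
        (1 - Real.smoothTransition (ρ x / ε)) • divergence X x - (ε⁻¹ * k (ρ x / ε)) • G x := by
      intro x
      by_cases hx : x ∈ U
      · have hgr : HasGradientAt (fun x => 1 - Real.smoothTransition (ρ x / ε))
            (-((ε⁻¹ * k (ρ x / ε)) • N x)) x := by
          have h1 : HasFDerivAt (fun x => ρ x / ε)
              (ε⁻¹ • InnerProductSpace.toDual ℝ _ (N x)) x := by
            have h0 : (fun x => ρ x / ε) = ε⁻¹ • ρ := funext fun x => div_eq_inv_mul _ _
            rw [h0]
            exact (hρg x hx).hasFDerivAt.const_smul ε⁻¹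
          have h2 := ((hst (ρ x / ε)).comp_hasFDerivAt x h1).const_sub 1
          rw [hasGradientAt_iff_hasFDerivAt]
          convert! h2 using 1
          rw [map_neg, map_smul, smul_smul, mul_comm]
        rw [divergence_smul hgr.differentiableAt (hX x), hgr.gradient, map_neg, map_smul,
          ← sub_eq_add_neg]
      · have h0 : X x = 0 := image_eq_zero_of_notMem_tsupport fun h' => hx (hsub h')
        have h1 : divergence (fun x => (1 - Real.smoothTransition (ρ x / ε)) • X x) x = 0 := by
          by_contra h'
          exact hx (hsub (hsup (support_divergence_subset _ h')))
        rw [h1, hdzero x hx]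
        simp [hG, h0]
    have i2 : Integrable fun x => (ε⁻¹ * k (ρ x / ε)) • G x := by
      refine Continuous.integrable_of_hasCompactSupport ?_
        (hs.mono ((Function.support_smul_subset_right _ _).trans hGs))
      refine continuous_of_tsupport fun x hx => ?_
      have hxU : x ∈ U :=
        hsub (hGts (closure_mono (Function.support_smul_subset_right _ _) hx))
      exact (continuousAt_const.mul (hk.continuousAt.comp
        ((hρd.continuousOn.continuousAt (H.isOpen_image.mem_nhds hxU)).div_const ε))).smul
          hGc.continuousAt
    have i1 : Integrable fun x => (1 - Real.smoothTransition (ρ x / ε)) • divergence X x := by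
      have h5 : (fun x => (1 - Real.smoothTransition (ρ x / ε)) • divergence X x) =
          fun x => divergence (fun x => (1 - Real.smoothTransition (ρ x / ε)) • X x) x +
            (ε⁻¹ * k (ρ x / ε)) • G x := by
        funext x; rw [e4]; abel
      rw [h5]
      refine (e2.integrable_of_hasCompactSupport (hs.mono' ?_)).add i2
      exact (support_divergence_subset _).trans hsup
    simp only [e4] at e3
    rw [integral_sub i1 i2, sub_eq_zero] at e3
    exact e3
  have hlim1 : Tendsto (fun ε : ℝ => ∫ x, (1 - Real.smoothTransition (ρ x / ε)) • divergence X x)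
      (𝓝[>] 0) (𝓝 (∫ x in K, divergence X x)) := by
    rw [← integral_indicator hK.measurableSet]
    refine tendsto_integral_filter_of_dominated_convergence (fun x => ‖divergence X x‖) ?_ ?_ ?_ ?_
    · refine Eventually.of_forall fun ε => ?_
      have hc : Continuous fun x => (1 - Real.smoothTransition (ρ x / ε)) • divergence X x := by
        refine continuous_of_tsupport fun x hx => ?_
        have hxU : x ∈ U := hsub (closure_minimal (support_divergence_subset _)
          (isClosed_tsupport _) (closure_mono (Function.support_smul_subset_right _ _) hx))
        exact (continuousAt_const.sub (Real.smoothTransition.continuous.continuousAt.comp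
          ((hρd.continuousOn.continuousAt (H.isOpen_image.mem_nhds hxU)).div_const ε))).smul
            hd.continuousAt
      exact hc.aestronglyMeasurable
    · refine Eventually.of_forall fun ε => Eventually.of_forall fun x => ?_
      rw [norm_smul]
      refine mul_le_of_le_one_left (norm_nonneg _) ?_
      rw [Real.norm_eq_abs, abs_le]
      constructor <;> linarith [Real.smoothTransition.nonneg (ρ x / ε),
        Real.smoothTransition.le_one (ρ x / ε)]
    · exact (hd.integrable_of_hasCompactSupport hdc).norm
    · refine Eventually.of_forall fun x => ?_
      by_cases hx : x ∈ U
      · have hKx : x ∈ K ↔ ρ x ≤ 0 := by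
          obtain ⟨⟨y, t⟩, ⟨hy, ht⟩, rfl⟩ := hx
          simpa [hρ] using H.mem_iff y hy t ht
        by_cases hxK : x ∈ K
        · rw [indicator_of_mem hxK]
          refine tendsto_const_nhds.congr' ?_
          filter_upwards [self_mem_nhdsWithin] with ε hε
          rw [Real.smoothTransition.zero_of_nonpos
            (div_nonpos_of_nonpos_of_nonneg (hKx.1 hxK) (le_of_lt hε))]
          simp
        · rw [indicator_of_notMem hxK]
          have hpos : 0 < ρ x := not_le.1 fun h' => hxK (hKx.2 h')
          refine tendsto_const_nhds.congr' ?_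
          filter_upwards [Ioc_mem_nhdsGT hpos] with ε hε
          rw [Real.smoothTransition.one_of_one_le ((one_le_div hε.1).2 hε.2)]
          simp
      · have h1 : K.indicator (fun x => divergence X x) x = 0 := by
          rw [indicator_apply_eq_zero]; exact fun _ => hdzero x hx
        rw [h1, hdzero x hx]
        simp
  have hAint : ∀ f : Rn (m + 1) → F, ∫ x, f x = ∫ p, f (A p) := fun f =>
    (H.measurePreserving.integral_comp A.toHomeomorph.measurableEmbedding f).symm
  have hAG : tsupport (fun p => G (A p)) ⊆ A ⁻¹' tsupport G :=
    closure_minimal (fun p hp => subset_tsupport G hp) ((isClosed_tsupport G).preimage A.continuous)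
  have hlim2 : Tendsto (fun ε : ℝ => ∫ x, (ε⁻¹ * k (ρ x / ε)) • G x)
      (𝓝[>] 0) (𝓝 (∫ y, G (A (y, h y)))) := by
    simp only [hAint fun x => (_ * k (ρ x / _)) • G x]
    have := tendsto_integral_layer hk hk0 hk1 H.isOpen H.contDiffOn.continuousOn
      (Y := fun p => G (A p)) (by fun_prop)
      ((hs.mono hGs).comp_homeomorph A.toHomeomorph) ?_
    · simpa [hρ] using this
    · intro p hp
      obtain ⟨q, hq, e⟩ := hsub (hGts (hAG hp))
      rw [A.injective e] at hq
      exact ⟨hq.1, mem_univ _⟩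
  have hmain : ∫ x in K, divergence X x = ∫ y, G (A (y, h y)) := by
    refine tendsto_nhds_unique hlim1 (hlim2.congr' ?_)
    filter_upwards [self_mem_nhdsWithin] with ε hε using (hcut ε hε).symm
  rw [hmain]
  have hsq : ∀ y : Rn m, 0 < Real.sqrt (1 + ‖gradient h y‖ ^ 2) := fun y => by positivity
  -- The surface density cancels the normalisation of the outer normal, so the limit over the base
  -- is a surface integral.
  have hGn : ∀ y ∈ B, Real.sqrt (1 + ‖gradient h y‖ ^ 2) •
      X (A (y, h y)) (outerNormal K (A (y, h y))) = G (A (y, h y)) := by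
    intro y hy
    rw [H.outerNormal_graph hy, map_smul, smul_smul, mul_inv_cancel₀ (hsq y).ne', one_smul]
    simp [hG, hN]
  have hgc : ContinuousOn (fun y => A (y, h y)) B :=
    A.continuous.comp_continuousOn (continuousOn_id.prodMk H.contDiffOn.continuousOn)
  have hcont : ContinuousOn (fun y => X (A (y, h y)) (outerNormal K (A (y, h y)))) B := by
    have : ContinuousOn (fun y => (Real.sqrt (1 + ‖gradient h y‖ ^ 2))⁻¹ • G (A (y, h y))) B := by
      refine ContinuousOn.smul (ContinuousOn.inv₀ ?_ fun y _ => (hsq y).ne')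
        (hGc.comp_continuousOn hgc)
      exact (continuousOn_const.add (H.continuousOn_gradient.norm.pow 2)).sqrt
    refine this.congr fun y hy => ?_
    simp only
    rw [← hGn y hy, smul_smul, inv_mul_cancel₀ (hsq y).ne', one_smul]
  have hzero : ∀ x ∈ frontier K \ (frontier K ∩ U), X x (outerNormal K x) = 0 := by
    intro x hx
    rw [image_eq_zero_of_notMem_tsupport fun h' => hx.2 ⟨hx.1, hsub h'⟩]
    simp
  rw [setIntegral_eq_of_subset_of_forall_sdiff_eq_zero isClosed_frontier.measurableSet
    inter_subset_left hzero, H.setIntegral_frontier hcont,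
    setIntegral_congr_fun H.isOpen.measurableSet hGn]
  refine (setIntegral_eq_integral_of_forall_compl_eq_zero fun y hy => ?_).symm
  refine image_eq_zero_of_notMem_tsupport (f := G) fun h' => hy ?_
  simpa using hmemB (hsub (hGts h'))

end Chart

/-! ### The divergence theorem on compact sets with C¹ boundary. -/

section Global

open Filter Topology

variable {m : ℕ} {K : Set (Rn (m + 1))}

/-- One function `ρ` serves all boundary points near `x`, since its gradient is continuous and stays
nonzero there. -/
theorem continuousOn_outerNormal {n : ℕ} {K : Set (Rn n)} (hb : HasC1Boundary K) :
    ContinuousOn (outerNormal K) (frontier K) := by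
  intro x hx
  obtain ⟨W, ρ, h⟩ := hb x hx
  have hg : ContinuousAt (gradient ρ) x :=
    (InnerProductSpace.toDual ℝ (Rn n)).symm.continuous.continuousAt.comp
      ((h.contDiffAt h.2.1).continuousAt_fderiv one_ne_zero)
  have hev : ∀ᶠ y in 𝓝[frontier K] x, ‖gradient ρ y‖⁻¹ • gradient ρ y = outerNormal K y := by
    filter_upwards [self_mem_nhdsWithin, mem_nhdsWithin_of_mem_nhds (h.1.mem_nhds h.2.1),
      mem_nhdsWithin_of_mem_nhds (hg.eventually_ne h.2.2.2.1)] with y hy hyW hy0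
    exact (outerNormal_eq ⟨h.1, hyW, h.2.2.1, hy0, h.2.2.2.2⟩ hy).symm
  refine ContinuousWithinAt.congr_of_eventuallyEq ?_ (hev.mono fun y hy => hy.symm)
    (outerNormal_eq h hx)
  exact ((hg.norm.inv₀ (norm_ne_zero_iff.2 h.2.2.2.1)).smul hg).continuousWithinAt

theorem surfaceMeasure_frontier_lt_top (hK : IsCompact K) (hb : HasC1Boundary K) :
    surfaceMeasure m (frontier K) < ⊤ := by
  have hfc : IsCompact (frontier K) := hK.of_isClosed_subset isClosed_frontier
    hK.isClosed.frontier_subset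
  refine hfc.measure_lt_top_of_nhdsWithin fun x hx => ?_
  obtain ⟨W, ρ, h⟩ := hb x hx
  obtain ⟨A, h, B, l, r, H, hxm, -, hC, hB⟩ := exists_isGraphChart hx h univ_mem
  refine ⟨frontier K ∩ A '' (B ×ˢ Ioo l r), ?_, H.surfaceMeasure_lt_top hC hB⟩
  exact inter_mem_nhdsWithin _ (H.isOpen_image.mem_nhds hxm)

theorem integrableOn_frontier {F : Type*} [NormedAddCommGroup F] (hK : IsCompact K)
    (hb : HasC1Boundary K) {G : Rn (m + 1) → F} (hG : ContinuousOn G (frontier K)) :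
    IntegrableOn G (frontier K) (surfaceMeasure m) := by
  have hfc : IsCompact (frontier K) := hK.of_isClosed_subset isClosed_frontier
    hK.isClosed.frontier_subset
  obtain ⟨C, hC⟩ := hfc.exists_bound_of_continuousOn hG
  have : IsFiniteMeasure ((surfaceMeasure m).restrict (frontier K)) :=
    ⟨by simpa using surfaceMeasure_frontier_lt_top hK hb⟩
  exact Integrable.of_bound
    (hG.aestronglyMeasurable_of_isCompact hfc isClosed_frontier.measurableSet) C
    ((ae_restrict_iff' isClosed_frontier.measurableSet).2 (Eventually.of_forall hC))

variable {F : Type*} [NormedAddCommGroup F] [NormedSpace ℝ F] [CompleteSpace F]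

/-- At a boundary point `U` is a graph chart; at an interior point it is the interior of `K`, where
both sides vanish. Boundedness of `U` will make the pieces of a partition of unity compactly
supported. -/
theorem exists_nhds_setIntegral_divergence (hK : IsCompact K) (hb : HasC1Boundary K)
    {O : Set (Rn (m + 1))} (hO : IsOpen O) (hKO : K ⊆ O) {x : Rn (m + 1)} (hx : x ∈ K) :
    ∃ U, IsOpen U ∧ x ∈ U ∧ U ⊆ O ∧ Bornology.IsBounded U ∧
      ∀ X : Rn (m + 1) → Rn (m + 1) →L[ℝ] F, Differentiable ℝ X → Continuous (divergence X) →
        HasCompactSupport X → tsupport X ⊆ U →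
        ∫ x in K, divergence X x =
          ∫ x in frontier K, X x (outerNormal K x) ∂(surfaceMeasure m) := by
  by_cases hxf : x ∈ frontier K
  · obtain ⟨W, ρ, h⟩ := hb x hxf
    obtain ⟨A, h, B, l, r, H, hxm, hsub, -, -⟩ := exists_isGraphChart hxf h
      (inter_mem (hO.mem_nhds (hKO hx)) (Metric.ball_mem_nhds x one_pos))
    exact ⟨_, H.isOpen_image, hxm, hsub.trans inter_subset_left,
      Metric.isBounded_ball.subset (hsub.trans inter_subset_right), fun X hX hd hs ht =>
      H.setIntegral_divergence hK.isClosed hX hd hs ht⟩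
  · have hxi : x ∈ interior K := by
      by_contra hxi
      exact hxf ⟨subset_closure hx, hxi⟩
    refine ⟨interior K, isOpen_interior, hxi, interior_subset.trans hKO,
      hK.isBounded.subset interior_subset, fun X hX hd hs ht => ?_⟩
    rw [setIntegral_eq_integral_of_forall_compl_eq_zero, integral_divergence_eq_zero hX hd hs]
    · refine (setIntegral_eq_zero_of_forall_eq_zero fun y hy => ?_).symm
      rw [image_eq_zero_of_notMem_tsupport fun h' => hy.2 (ht h')]
      simp
    · intro y hy
      by_contra h'
      exact hy (interior_subset (ht (support_divergence_subset _ h')))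

/-- **Divergence theorem** on a compact set with `C^1` boundary, for a differentiable field with
continuous divergence. -/
theorem setIntegral_divergence_eq (hK : IsCompact K) (hb : HasC1Boundary K)
    {O : Set (Rn (m + 1))} (hO : IsOpen O) (hKO : K ⊆ O)
    {X : Rn (m + 1) → Rn (m + 1) →L[ℝ] F} (hX : DifferentiableOn ℝ X O)
    (hd : ContinuousOn (divergence X) O) :
    ∫ x in K, divergence X x =
      ∫ x in frontier K, X x (outerNormal K x) ∂(surfaceMeasure m) := by
  choose! U hUo hxU hUO hUb hU using fun x (hx : x ∈ K) =>
    exists_nhds_setIntegral_divergence (F := F) hK hb hO hKO hx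
  obtain ⟨t, htK, hcov⟩ := hK.elim_nhds_subcover U fun x hx => (hUo x hx).mem_nhds (hxU x hx)
  have hUto : IsOpen (⋃ x ∈ t, U x) := isOpen_biUnion fun x hx => hUo x (htK x hx)
  -- The partition of unity is taken on a thickening: its sum must be constant near each point of
  -- `K`, boundary included, for the gradients to sum to zero there.
  obtain ⟨δ, hδ, hthick⟩ := hK.exists_cthickening_subset_open hUto hcov
  obtain ⟨f, hf⟩ := SmoothPartitionOfUnity.exists_isSubordinate (ι := t)
    (modelWithCornersSelf ℝ (Rn (m + 1))) (Metric.isClosed_cthickening (E := K) (δ := δ))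
    (fun x => U x) (fun x => hUo x (htK x x.2)) (by simpa [iUnion_subtype] using hthick)
  have hfc : ∀ i, ContDiff ℝ 1 (f i) := fun i => (f i).contMDiff.contDiff.of_le (by simp)
  have hsum : ∀ x ∈ Metric.cthickening δ K, ∑ i, f i x = 1 := fun x hx => by
    rw [← finsum_eq_sum_of_fintype]; exact f.sum_eq_one hx
  have hnear : ∀ x ∈ K, ∀ᶠ y in 𝓝 x, ∑ i, f i y = 1 := by
    intro x hx
    filter_upwards [Metric.isOpen_thickening.mem_nhds (Metric.self_subset_thickening hδ K hx)]
      with y hy using hsum y (Metric.thickening_subset_cthickening δ K hy)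
  have hsub : ∀ i, tsupport (fun x => f i x • X x) ⊆ U i := fun i => by
    have : tsupport (fun x => f i x • X x) ⊆ tsupport (f i) :=
      closure_mono fun x hx h0 => hx (by simp only [h0, zero_smul])
    exact this.trans (hf i)
  have hcs : ∀ i, HasCompactSupport (fun x => f i x • X x) := fun i =>
    Metric.isCompact_of_isClosed_isBounded (isClosed_tsupport _)
      ((hUb i (htK i i.2)).subset (hsub i))
  have hgood := fun i : t => differentiable_smul_of_tsupport_subset (hUo i (htK i i.2))
    (hfc i).contDiffOn (hX.mono (hUO i (htK i i.2))) (hd.mono (hUO i (htK i i.2))) (hsub i)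
  have hloc := fun i : t => hU i (htK i i.2) _ (hgood i).1 (hgood i).2 (hcs i) (hsub i)
  have hKfr : frontier K ⊆ K := hK.isClosed.frontier_subset
  have hgrad : ∀ x ∈ K, ∑ i, gradient (f i) x = 0 := by
    intro x hx
    have h1 : fderiv ℝ (fun y => ∑ i, f i y) x = 0 := by
      have : (fun y => ∑ i, f i y) =ᶠ[𝓝 x] fun _ => (1 : ℝ) := hnear x hx
      rw [this.fderiv_eq]
      simp
    rw [fderiv_fun_sum fun i _ => (hfc i).differentiable one_ne_zero x] at h1
    simp only [gradient, ← map_sum, h1, map_zero]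
  calc ∫ x in K, divergence X x
      = ∫ x in K, ∑ i, divergence (fun x => f i x • X x) x := by
        refine setIntegral_congr_fun hK.measurableSet fun x hx => ?_
        have hXx := hX.differentiableAt (hO.mem_nhds (hKO hx))
        have : ∀ i, divergence (fun x => f i x • X x) x =
            f i x • divergence X x + X x (gradient (f i) x) := fun i =>
          divergence_smul ((hfc i).differentiable one_ne_zero x) hXx
        simp only [this]
        rw [Finset.sum_add_distrib, ← Finset.sum_smul, ← map_sum, hgrad x hx,
          hsum x (Metric.self_subset_cthickening K hx), one_smul, map_zero, add_zero]
    _ = ∑ i, ∫ x in K, divergence (fun x => f i x • X x) x :=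
        integral_finsetSum _ fun i _ => (hgood i).2.continuousOn.integrableOn_compact hK
    _ = ∑ i, ∫ x in frontier K, (f i x • X x) (outerNormal K x) ∂(surfaceMeasure m) :=
        Finset.sum_congr rfl fun i _ => hloc i
    _ = ∫ x in frontier K, ∑ i, (f i x • X x) (outerNormal K x) ∂(surfaceMeasure m) := by
        refine (integral_finsetSum _ fun i _ => ?_).symm
        exact integrableOn_frontier hK hb
          ((hgood i).1.continuous.continuousOn.clm_apply (continuousOn_outerNormal hb))
    _ = _ := by
        refine setIntegral_congr_fun isClosed_frontier.measurableSet fun x hx => ?_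
        simp only [smul_apply]
        rw [← Finset.sum_smul, hsum x (Metric.self_subset_cthickening K (hKfr hx)), one_smul]

end Global

/-! ### Balls and spheres. -/

section Ball

variable {m : ℕ} {v : Rn (m + 1)} {r : ℝ}

theorem gradient_norm_sub_sq (v x : Rn (m + 1)) (c : ℝ) :
    gradient (fun y => ‖y - v‖ ^ 2 - c) x = (2 : ℝ) • (x - v) := by
  refine HasGradientAt.gradient ?_
  rw [hasGradientAt_iff_hasFDerivAt]
  have h1 : HasFDerivAt (fun y => y - v) (ContinuousLinearMap.id ℝ (Rn (m + 1))) x :=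
    (hasFDerivAt_id x).sub_const v
  convert! h1.norm_sq.sub_const c using 1
  ext1 z
  simp

theorem isLocalDefiningFunction_closedBall (hr : 0 < r) {x : Rn (m + 1)}
    (hx : x ∈ Metric.sphere v r) :
    IsLocalDefiningFunction (Metric.closedBall v r) x univ (fun y => ‖y - v‖ ^ 2 - r ^ 2) := by
  rw [mem_sphere_iff_norm] at hx
  refine ⟨isOpen_univ, mem_univ _, ?_, ?_, fun y _ => ?_⟩
  · exact (((contDiff_id.sub contDiff_const).norm_sq ℝ).sub contDiff_const).contDiffOn
  · rw [gradient_norm_sub_sq]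
    intro h0
    have : x - v = 0 := by simpa using h0
    rw [this, norm_zero] at hx
    exact hr.ne hx
  · rw [mem_closedBall_iff_norm, sub_nonpos, sq_le_sq₀ (norm_nonneg _) hr.le]

theorem hasC1Boundary_closedBall (hr : 0 < r) : HasC1Boundary (Metric.closedBall v r) := by
  intro x hx
  rw [frontier_closedBall _ hr.ne'] at hx
  exact ⟨_, _, isLocalDefiningFunction_closedBall hr hx⟩

theorem outerNormal_closedBall (hr : 0 < r) {x : Rn (m + 1)} (hx : x ∈ Metric.sphere v r) :
    outerNormal (Metric.closedBall v r) x = r⁻¹ • (x - v) := by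
  rw [outerNormal_eq (isLocalDefiningFunction_closedBall hr hx)
    (by rwa [frontier_closedBall _ hr.ne']), gradient_norm_sub_sq]
  rw [mem_sphere_iff_norm] at hx
  rw [norm_smul, hx, smul_smul]
  congr 1
  simp

theorem surfaceMeasure_sphere (hr : 0 < r) :
    (surfaceMeasure m).real (Metric.sphere v r) = r ^ m * sphereArea m := by
  have h1 : Metric.sphere v r = AffineMap.homothety v r '' (Metric.sphere v 1) := by
    ext x
    simp only [mem_sphere_iff_norm, mem_image, AffineMap.homothety_apply, vsub_eq_sub,
      vadd_eq_add]
    constructor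
    · intro hx
      refine ⟨r⁻¹ • (x - v) + v, ?_, ?_⟩
      · rw [add_sub_cancel_right, norm_smul, hx, norm_inv, Real.norm_of_nonneg hr.le,
          inv_mul_cancel₀ hr.ne']
      · rw [add_sub_cancel_right, smul_smul, mul_inv_cancel₀ hr.ne', one_smul, sub_add_cancel]
    · rintro ⟨y, hy, rfl⟩
      rw [add_sub_cancel_right, norm_smul, hy, Real.norm_of_nonneg hr.le, mul_one]
  have h2 : Metric.sphere v 1 = (fun y => v + y) '' Metric.sphere (0 : Rn (m + 1)) 1 := by
    ext x
    simp only [mem_sphere_iff_norm, mem_image, sub_zero]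
    exact ⟨fun h => ⟨x - v, h, by abel⟩, by rintro ⟨y, hy, rfl⟩; simpa using hy⟩
  rw [sphereArea, measureReal_def, measureReal_def, surfaceMeasure, h1,
    euclideanHausdorffMeasure_homothety_image m v hr.ne', h2,
    (isometry_add_left v).euclideanHausdorffMeasure_image, ENNReal.toReal_smul, NNReal.smul_def]
  simp [abs_of_pos hr]

/-- The divergence theorem for the radial field `x ↦ ⟨x, ·⟩` on the unit ball equates the area with
`m + 1` times the volume. -/
theorem sphereArea_pos (m : ℕ) : 0 < sphereArea m := by
  let X : Rn (m + 1) → Rn (m + 1) →L[ℝ] ℝ := fun x => innerSL ℝ x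
  have hX : ∀ x, HasFDerivAt X (innerSL ℝ) x := fun x => (innerSL ℝ).hasFDerivAt
  have hdiv : ∀ x, divergence X x = m + 1 := by
    intro x
    simp only [divergence, (hX x).fderiv]
    change ∑ j : Fin (m + 1), inner ℝ (stdVec j) (stdVec j) = (m : ℝ) + 1
    simp [stdVec]
  have h1 := setIntegral_divergence_eq (isCompact_closedBall (0 : Rn (m + 1)) 1)
    (hasC1Boundary_closedBall one_pos) isOpen_univ (subset_univ _) (X := X)
    (fun x _ => (hX x).differentiableAt.differentiableWithinAt)
    (by simp only [funext hdiv]; exact continuousOn_const)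
  have h2 : ∫ x in frontier (Metric.closedBall (0 : Rn (m + 1)) 1),
      X x (outerNormal (Metric.closedBall (0 : Rn (m + 1)) 1) x) ∂(surfaceMeasure m) =
        sphereArea m := by
    rw [frontier_closedBall _ one_ne_zero]
    rw [setIntegral_congr_fun (g := fun _ => (1 : ℝ)) Metric.isClosed_sphere.measurableSet]
    · simp [sphereArea]
    · intro x hx
      simp only [outerNormal_closedBall one_pos hx]
      rw [mem_sphere_iff_norm, sub_zero] at hx
      simp [X, hx]
  rw [h2] at h1
  rw [← h1]
  simp only [hdiv, setIntegral_const, smul_eq_mul]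
  have : 0 < volume.real (Metric.closedBall (0 : Rn (m + 1)) 1) :=
    ENNReal.toReal_pos (Metric.measure_closedBall_pos _ _ one_pos).ne'
      measure_closedBall_lt_top.ne
  positivity

end Ball

/-! ### The Clifford algebra as a normed space -/

section Clifford

variable {n : ℕ}

instance finiteDimensionalCl (n : ℕ) : FiniteDimensional ℝ (Cl n) :=
  Module.Finite.of_basis (cliffordBasis n)

instance t2SpaceCl (n : ℕ) : T2Space (Cl n) :=
  TopologicalSpace.t2Space_of_metrizableSpace

instance completeSpaceCl (n : ℕ) : CompleteSpace (Cl n) := FiniteDimensional.complete ℝ _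

theorem vec_mul_vec_add_swap (x y : Rn n) :
    vec x * vec y + vec y * vec x = algebraMap ℝ (Cl n) (-2 * inner ℝ x y) := by
  rw [CliffordAlgebra.ι_mul_ι_add_swap, QuadraticMap.polar]
  simp only [negForm_apply]
  rw [norm_add_sq_real]
  congr 1
  ring

theorem vec_mul_self (x : Rn n) : vec x * vec x = algebraMap ℝ (Cl n) (-‖x‖ ^ 2) := by
  rw [CliffordAlgebra.ι_sq_scalar, negForm_apply]

theorem vec_mul_vec_mul (x : Rn n) (A : Cl n) : vec x * (vec x * A) = -(‖x‖ ^ 2) • A := by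
  rw [← mul_assoc, vec_mul_self, ← Algebra.smul_def]

theorem gen_mul_gen_of_ne {i j : Fin n} (h : i ≠ j) : gen i * gen j = -(gen j * gen i) := by
  rw [eq_neg_iff_add_eq_zero, vec_mul_vec_add_swap]
  simp [stdVec, EuclideanSpace.inner_single_left, h]

theorem gen_mul_gen_mul (j : Fin n) (A : Cl n) : gen j * (gen j * A) = -A := by
  rw [vec_mul_vec_mul]
  simp [stdVec]

theorem exists_sign_prod_gen_of_perm {l l' : List (Fin n)} (h : l.Perm l') (hl : l.Nodup) :
    ∃ ε : ℝ, (ε = 1 ∨ ε = -1) ∧ (l'.map gen).prod = ε • (l.map gen).prod := by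
  induction h with
  | nil => exact ⟨1, Or.inl rfl, by simp⟩
  | cons a _ ih =>
    obtain ⟨ε, hε, e⟩ := ih (List.nodup_cons.1 hl).2
    exact ⟨ε, hε, by rw [List.map_cons, List.prod_cons, e, List.map_cons, List.prod_cons,
      mul_smul_comm]⟩
  | swap a b l =>
    have hab : b ≠ a := fun h => (List.nodup_cons.1 hl).1 (by simp [h])
    refine ⟨-1, Or.inr rfl, ?_⟩
    simp only [List.map_cons, List.prod_cons]
    rw [← mul_assoc, ← mul_assoc, gen_mul_gen_of_ne hab]
    simp
  | trans h1 _ ih1 ih2 =>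
    obtain ⟨ε, hε, e⟩ := ih1 hl
    obtain ⟨ε', hε', e'⟩ := ih2 (h1.nodup_iff.1 hl)
    refine ⟨ε' * ε, ?_, by rw [e', e, smul_smul]⟩
    rcases hε with rfl | rfl <;> rcases hε' with rfl | rfl <;> simp

/-- Left multiplication by a generator permutes the basis of `Cl_n` up to signs. -/
theorem gen_mul_cliffordBasis (j : Fin n) (S : Finset (Fin n)) :
    ∃ ε : ℝ, (ε = 1 ∨ ε = -1) ∧
      gen j * cliffordBasis n S = ε • cliffordBasis n (symmDiff S {j}) := by
  have key : ∀ T : Finset (Fin n), j ∉ T → ∃ ε : ℝ, (ε = 1 ∨ ε = -1) ∧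
      gen j * cliffordBasis n T = ε • cliffordBasis n (insert j T) := by
    intro T hT
    have hp : ((insert j T).sort (· ≤ ·)).Perm (j :: T.sort (· ≤ ·)) := by
      refine (List.perm_ext_iff_of_nodup (Finset.sort_nodup _ _) ?_).2 fun a => by simp
      exact List.nodup_cons.2 ⟨by simpa using hT, Finset.sort_nodup _ _⟩
    obtain ⟨ε, hε, e⟩ := exists_sign_prod_gen_of_perm hp (Finset.sort_nodup _ _)
    refine ⟨ε, hε, ?_⟩
    rw [cliffordBasis_apply, cliffordBasis_apply, ← e, List.map_cons, List.prod_cons]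
  by_cases hj : j ∈ S
  · obtain ⟨ε, hε, e⟩ := key (S.erase j) (Finset.notMem_erase _ _)
    rw [Finset.insert_erase hj] at e
    have hS : symmDiff S {j} = S.erase j := by
      ext a
      simp only [Finset.mem_symmDiff, Finset.mem_singleton, Finset.mem_erase]
      constructor
      · rintro (⟨h1, h2⟩ | ⟨h1, h2⟩)
        · exact ⟨h2, h1⟩
        · exact absurd (h1 ▸ hj) h2
      · exact fun h => Or.inl ⟨h.2, h.1⟩
    have hεε : ε * ε = 1 := by rcases hε with rfl | rfl <;> norm_num
    refine ⟨-ε, by rcases hε with rfl | rfl <;> simp, ?_⟩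
    have e2 : cliffordBasis n S = ε • (gen j * cliffordBasis n (S.erase j)) := by
      rw [e, smul_smul, hεε, one_smul]
    rw [hS, e2, mul_smul_comm, gen_mul_gen_mul, smul_neg, neg_smul]
  · obtain ⟨ε, hε, e⟩ := key S hj
    have hS : symmDiff S {j} = insert j S := by
      ext a
      simp only [Finset.mem_symmDiff, Finset.mem_singleton, Finset.mem_insert]
      constructor
      · rintro (⟨h1, -⟩ | ⟨h1, -⟩)
        · exact Or.inr h1
        · exact Or.inl h1
      · rintro (rfl | h)
        · exact Or.inr ⟨rfl, hj⟩
        · exact Or.inl ⟨h, fun h' => hj (h' ▸ h)⟩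
    exact ⟨ε, hε, by rw [e, hS]⟩

/-- The inner product for which the basis of `Cl_n` is orthonormal. -/
noncomputable def clInner (n : ℕ) : Cl n →ₗ[ℝ] Cl n →ₗ[ℝ] ℝ :=
  (innerₗ (EuclideanSpace ℝ (Finset (Fin n)))).compl₁₂ (cliffordCoords n).toLinearMap
    (cliffordCoords n).toLinearMap

theorem clInner_self (A : Cl n) : clInner n A A = ‖A‖ ^ 2 := by
  change inner ℝ (cliffordCoords n A) (cliffordCoords n A) = ‖cliffordCoords n A‖ ^ 2
  exact real_inner_self_eq_norm_sq _

theorem clInner_basis (S T : Finset (Fin n)) :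
    clInner n (cliffordBasis n S) (cliffordBasis n T) = if S = T then 1 else 0 := by
  change inner ℝ (cliffordCoords n _) (cliffordCoords n _) = _
  have : ∀ S, cliffordCoords n (cliffordBasis n S) = EuclideanSpace.single S 1 := by
    intro S
    ext T
    simp [cliffordCoords, eq_comm, Finsupp.single_apply]
  rw [this, this, EuclideanSpace.inner_single_left]
  simp

/-- Multiplication by `e_j` permutes an orthonormal basis up to signs, so it is an isometry; as its
square is `-1`, it is skew. -/
theorem clInner_gen_mul (j : Fin n) (A B : Cl n) :
    clInner n (gen j * A) B = -clInner n A (gen j * B) := by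
  have hiso : ∀ A B, clInner n (gen j * A) (gen j * B) = clInner n A B := by
    have : (clInner n).compl₁₂ (LinearMap.mulLeft ℝ (gen j)) (LinearMap.mulLeft ℝ (gen j)) =
        clInner n := by
      refine LinearMap.ext_basis (cliffordBasis n) (cliffordBasis n) fun S T => ?_
      simp only [LinearMap.compl₁₂_apply, LinearMap.mulLeft_apply]
      obtain ⟨ε, hε, e⟩ := gen_mul_cliffordBasis j S
      obtain ⟨ε', hε', e'⟩ := gen_mul_cliffordBasis j T
      rw [e, e', map_smul, map_smul, LinearMap.smul_apply, clInner_basis, clInner_basis]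
      by_cases h : S = T
      · subst h
        have : ε = ε' := by
          have h0 : (ε - ε') • cliffordBasis n (symmDiff S {j}) = 0 := by
            rw [sub_smul, ← e, ← e', sub_self]
          exact sub_eq_zero.1 ((smul_eq_zero.1 h0).resolve_right ((cliffordBasis n).ne_zero _))
        subst this
        rcases hε with rfl | rfl <;> simp
      · have : symmDiff S {j} ≠ symmDiff T {j} := fun h' => h (symmDiff_left_injective _ h')
        simp [h, this]
    intro A B
    exact LinearMap.congr_fun₂ this A B
  have h := hiso (gen j * A) B
  rw [gen_mul_gen_mul, map_neg, LinearMap.neg_apply] at h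
  exact h.symm

theorem vec_eq_sum (x : Rn n) : vec x = ∑ j, x j • gen j := by
  have : x = ∑ j, x j • stdVec j := by
    ext i
    simp [stdVec, Finset.sum_apply, Pi.single_apply]
  conv_lhs => rw [this]
  simp [map_sum]

/-- Skewness passes from generators to all vectors, hence `‖xA‖² = -⟨A, x x A⟩ = ‖x‖² ‖A‖²`. The
norm of `Cl_n` is not multiplicative in general; it becomes so for products of vectors, such as `c u
+ d`. -/
theorem norm_vec_mul (x : Rn n) (A : Cl n) : ‖vec x * A‖ = ‖x‖ * ‖A‖ := by
  have hskew : ∀ A B, clInner n (vec x * A) B = -clInner n A (vec x * B) := by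
    intro A B
    rw [vec_eq_sum]
    simp only [Finset.sum_mul, smul_mul_assoc, map_sum, map_smul, LinearMap.sum_apply,
      LinearMap.smul_apply, clInner_gen_mul, smul_neg, Finset.sum_neg_distrib]
  have h : ‖vec x * A‖ ^ 2 = (‖x‖ * ‖A‖) ^ 2 := by
    rw [← clInner_self, hskew, vec_mul_vec_mul, map_smul, clInner_self]
    simp [mul_pow]
  exact (sq_eq_sq₀ (norm_nonneg _) (by positivity)).1 h

theorem norm_one_cl : ‖(1 : Cl n)‖ = 1 := by
  have h : cliffordBasis n ∅ = 1 := by rw [cliffordBasis_apply]; simp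
  have h2 : ‖(1 : Cl n)‖ ^ 2 = 1 := by rw [← clInner_self, ← h, clInner_basis]; simp
  exact (sq_eq_sq₀ (norm_nonneg _) zero_le_one).1 (by rw [h2]; norm_num)

theorem norm_vec (x : Rn n) : ‖vec x‖ = ‖x‖ := by
  have := norm_vec_mul x 1
  rwa [mul_one, norm_one_cl, mul_one] at this

theorem vec_injective : Function.Injective (vec : Rn n → Cl n) := by
  refine (injective_iff_map_eq_zero _).2 fun x hx => ?_
  rw [← norm_eq_zero, ← norm_vec, hx, norm_zero]

/-- `∑ e_j x e_j = (n - 2) x` for vectors `x`. -/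
theorem sum_gen_mul_vec_mul_gen (x : Rn n) :
    ∑ j, gen j * vec x * gen j = ((n : ℝ) - 2) • vec x := by
  have h : ∀ j, gen j * vec x * gen j = vec x - (2 * x j) • gen j := by
    intro j
    have h1 := vec_mul_vec_add_swap (stdVec j) x
    have h2 : gen j * vec x = algebraMap ℝ (Cl n) (-2 * x j) - vec x * gen j := by
      rw [eq_sub_iff_add_eq, h1]
      simp [stdVec, EuclideanSpace.inner_single_left]
    rw [h2, sub_mul, mul_assoc, vec_mul_self, ← Algebra.smul_def, ← Algebra.commutes,
      ← Algebra.smul_def]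
    simp [stdVec]
    abel
  simp only [h, Finset.sum_sub_distrib, mul_smul, ← Finset.smul_sum]
  rw [← vec_eq_sum]
  simp [sub_smul]
  rw [← nsmul_eq_mul, Nat.cast_smul_eq_nsmul]

/-- Multiplication of `Cl_n` as a continuous bilinear map. -/
noncomputable def clMul (n : ℕ) : Cl n →L[ℝ] Cl n →L[ℝ] Cl n :=
  LinearMap.toContinuousBilinearMap (LinearMap.mul ℝ (Cl n))

@[simp] theorem clMul_apply (A B : Cl n) : clMul n A B = A * B := rfl

/-- The inclusion of vectors as a continuous linear map. -/
noncomputable def vecL (n : ℕ) : Rn n →L[ℝ] Cl n := LinearMap.toContinuousLinearMap vec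

@[simp] theorem vecL_apply (x : Rn n) : vecL n x = vec x := rfl

instance continuousMulCl : ContinuousMul (Cl n) where
  continuous_mul := by
    change Continuous fun p : Cl n × Cl n => clMul n p.1 p.2
    fun_prop

theorem HasFDerivAt.clMul {E : Type*} [NormedAddCommGroup E] [NormedSpace ℝ E] {f g : E → Cl n}
    {f' g' : E →L[ℝ] Cl n} {x : E} (hf : HasFDerivAt f f' x) (hg : HasFDerivAt g g' x) :
    HasFDerivAt (fun y => f y * g y)
      ((_root_.clMul n (f x)).comp g' + ((_root_.clMul n).flip (g x)).comp f') x := by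
  convert! ((_root_.clMul n).hasFDerivAt_of_bilinear hf hg) using 1

/-! ### Products of vectors -/

/-- `q` is a product of vectors, and `ε` is the sign `(-1) ^ k` for `k` factors. -/
inductive IsVecProd {n : ℕ} : ℝ → Cl n → Prop
  | one : IsVecProd 1 1
  | vec_mul (x : Rn n) {ε : ℝ} {q : Cl n} (h : IsVecProd ε q) : IsVecProd (-ε) (vec x * q)

namespace IsVecProd

variable {ε δ : ℝ} {q p : Cl n}

theorem sq_eq_one (h : IsVecProd ε q) : ε * ε = 1 := by
  induction h with
  | one => norm_num
  | vec_mul x _ ih => simpa using ih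

theorem mul (h : IsVecProd ε q) (h' : IsVecProd δ p) : IsVecProd (ε * δ) (q * p) := by
  induction h with
  | one => simpa using h'
  | vec_mul x _ ih =>
    rw [mul_assoc, neg_mul]
    exact ih.vec_mul x

theorem of_vec (x : Rn n) : IsVecProd (-1) (vec x) := by
  simpa using IsVecProd.one.vec_mul x

theorem reverse (h : IsVecProd ε q) : IsVecProd ε (CliffordAlgebra.reverse q) := by
  induction h with
  | one => simpa using IsVecProd.one
  | vec_mul x _ ih =>
    rw [CliffordAlgebra.reverse.map_mul, CliffordAlgebra.reverse_ι]
    simpa using ih.mul (of_vec x)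

/-- The inner pair of factors collapses to the scalar `-‖x‖²`, and so on outwards: one sign for each
factor. This gives the inverses of products of vectors. -/
theorem reverse_mul_self (h : IsVecProd ε q) :
    CliffordAlgebra.reverse q * q = (ε * ‖q‖ ^ 2) • (1 : Cl n) := by
  induction h with
  | one => simp [norm_one_cl]
  | vec_mul x _ ih =>
    rw [CliffordAlgebra.reverse.map_mul, CliffordAlgebra.reverse_ι, mul_assoc, vec_mul_vec_mul,
      mul_smul_comm, ih, smul_smul, norm_vec_mul]
    congr 1
    ring

theorem self_mul_reverse (h : IsVecProd ε q) :
    q * CliffordAlgebra.reverse q = (ε * ‖q‖ ^ 2) • (1 : Cl n) := by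
  induction h with
  | one => simp [norm_one_cl]
  | @vec_mul x _ q _ ih =>
    rw [CliffordAlgebra.reverse.map_mul, CliffordAlgebra.reverse_ι, mul_assoc, ← mul_assoc q, ih,
      smul_mul_assoc, one_mul, mul_smul_comm, vec_mul_self, norm_vec_mul,
      Algebra.algebraMap_eq_smul_one, smul_smul]
    congr 1
    ring

theorem norm_mul (h : IsVecProd ε q) (A : Cl n) : ‖q * A‖ = ‖q‖ * ‖A‖ := by
  induction h with
  | one => simp [norm_one_cl]
  | vec_mul x _ ih => rw [mul_assoc, norm_vec_mul, ih, norm_vec_mul, mul_assoc]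

theorem norm_reverse (h : IsVecProd ε q) : ‖CliffordAlgebra.reverse q‖ = ‖q‖ := by
  have h1 := h.reverse.norm_mul q
  rw [h.reverse_mul_self, norm_smul, norm_one_cl, mul_one, Real.norm_eq_abs, abs_mul,
    abs_of_nonneg (sq_nonneg ‖q‖)] at h1
  have hε : |ε| = 1 := by
    rcases mul_self_eq_one_iff.1 h.sq_eq_one with e | e <;> simp [e]
  rw [hε, one_mul, sq] at h1
  by_cases h0 : ‖q‖ = 0
  · rw [norm_eq_zero] at h0
    simp [h0]
  · exact (mul_right_cancel₀ h0 h1).symm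

theorem of_mem_closure {m : ℕ} {q : Cl (m + 1)}
    (h : q ∈ Submonoid.closure (boundaryVectors m)) : ∃ ε, IsVecProd ε q := by
  induction h using Submonoid.closure_induction with
  | mem x hx =>
    obtain ⟨w, -, rfl⟩ := hx
    exact ⟨_, of_vec w⟩
  | one => exact ⟨_, one⟩
  | mul x y _ _ hx hy =>
    obtain ⟨ε, hx⟩ := hx
    obtain ⟨δ, hy⟩ := hy
    exact ⟨_, hx.mul hy⟩

end IsVecProd

/-! ### The reflection in the last coordinate -/

section Hat

variable {m : ℕ}

theorem hatCl_vec (x : Rn (m + 1)) : hatCl (vec x) = vec (hatVec m x) := by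
  rw [hatCl, CliffordAlgebra.map_apply_ι]

theorem hatVec_apply (x : Rn (m + 1)) :
    hatVec m x = x - (2 * x (Fin.last m)) • stdVec (Fin.last m) := rfl

theorem norm_hatVec (x : Rn (m + 1)) : ‖hatVec m x‖ = ‖x‖ := by
  have h := (hatVec m).map_app x
  simp only [negForm_apply, neg_inj] at h
  exact (sq_eq_sq₀ (norm_nonneg _) (norm_nonneg _)).1 h

theorem hatVec_hatVec (x : Rn (m + 1)) : hatVec m (hatVec m x) = x := by
  simp only [hatVec_apply]
  ext i
  by_cases h : i = Fin.last m
  · simp [stdVec, h]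
    ring
  · simp [stdVec, h]

theorem hatCl_hatCl (A : Cl (m + 1)) : hatCl (hatCl A) = A := by
  have : (hatCl (m := m)).comp hatCl = AlgHom.id ℝ _ := by
    refine CliffordAlgebra.hom_ext ?_
    ext x
    change hatCl (hatCl (vec x)) = vec x
    rw [hatCl_vec, hatCl_vec, hatVec_hatVec]
  exact congrArg (fun f => f A) this

theorem genLast_mul_hatCl_vec (x : Rn (m + 1)) :
    genLast m * hatCl (vec x) = -(vec x * genLast m) := by
  have h1 := vec_mul_vec_add_swap (stdVec (Fin.last m)) x
  rw [hatCl_vec, hatVec_apply, map_sub, map_smul, mul_sub, mul_smul_comm, genLast_mul_self,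
    eq_sub_of_add_eq h1]
  have : inner ℝ (stdVec (Fin.last m)) x = x (Fin.last m) := by
    simp [stdVec, EuclideanSpace.inner_single_left]
  rw [this, Algebra.algebraMap_eq_smul_one]
  module

/-- Moving `e_n` past one reflected vector removes the hat and costs a sign; `ε` collects these
signs. -/
theorem IsVecProd.genLast_mul_hatCl {ε : ℝ} {q : Cl (m + 1)} (h : IsVecProd ε q) :
    genLast m * hatCl q = ε • (q * genLast m) := by
  induction h with
  | one => simp
  | @vec_mul x ε q _ ih =>
    rw [map_mul, ← mul_assoc, genLast_mul_hatCl_vec, neg_mul, mul_assoc, ih, mul_smul_comm,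
      neg_smul, mul_assoc]

/-- `e_n x̂ e_n = x` for vectors `x`. -/
theorem genLast_mul_hatCl_vec_mul_genLast (x : Rn (m + 1)) :
    genLast m * hatCl (vec x) * genLast m = vec x := by
  rw [genLast_mul_hatCl_vec, neg_mul, mul_assoc, genLast_mul_self]
  simp

theorem projQ'_eq (A : Cl (m + 1)) :
    projQ' A = -((1 / 2 : ℝ) • (genLast m * (A - hatCl A))) := by
  rw [projQ', projQ]
  simp only [mul_neg, neg_mul, neg_neg, mul_smul_comm, smul_mul_assoc]
  rw [mul_assoc, mul_assoc, genLast_mul_self, mul_neg, mul_one, mul_neg, smul_neg]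

/-- The reflection `A ↦ Â` as a continuous linear map. -/
noncomputable def hatL (m : ℕ) : Cl (m + 1) →L[ℝ] Cl (m + 1) :=
  LinearMap.toContinuousLinearMap hatCl.toLinearMap

@[simp] theorem hatL_apply (A : Cl (m + 1)) : hatL m A = hatCl A := rfl

/-- The reflection `x ↦ x̂` of vectors as a continuous linear map. -/
noncomputable def hatVecL (m : ℕ) : Rn (m + 1) →L[ℝ] Rn (m + 1) :=
  LinearMap.toContinuousLinearMap (hatVec m).toLinearMap

@[simp] theorem hatVecL_apply (x : Rn (m + 1)) : hatVecL m x = hatVec m x := rfl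

end Hat

end Clifford

/-! ### The kernels and the vanishing divergence of the Cauchy field. -/

section Kernel

theorem Ring.inverse_eq_of_mul_eq_one {R : Type*} [MonoidWithZero R] {a b : R} (h1 : a * b = 1)
    (h2 : b * a = 1) : Ring.inverse a = b :=
  Ring.inverse_unit ⟨a, b, h1, h2⟩

theorem inverse_vec {n : ℕ} {x : Rn n} (hx : x ≠ 0) :
    Ring.inverse (vec x) = -((‖x‖ ^ 2)⁻¹ • vec x) := by
  have h : ‖x‖ ^ 2 ≠ 0 := by simpa using hx
  refine Ring.inverse_eq_of_mul_eq_one ?_ ?_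
  · rw [mul_neg, mul_smul_comm, vec_mul_self, Algebra.algebraMap_eq_smul_one, smul_smul, mul_neg,
      inv_mul_cancel₀ h]
    simp
  · rw [neg_mul, smul_mul_assoc, vec_mul_self, Algebra.algebraMap_eq_smul_one, smul_smul, mul_neg,
      inv_mul_cancel₀ h]
    simp

theorem hasFDerivAt_inv_norm_pow {E : Type*} [NormedAddCommGroup E] [InnerProductSpace ℝ E]
    (k : ℕ) {x : E} (hx : x ≠ 0) :
    HasFDerivAt (fun y : E => (‖y‖ ^ k)⁻¹) ((-(k : ℝ) * (‖x‖ ^ (k + 2))⁻¹) • innerSL ℝ x) x := by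
  have hn : ‖x‖ ≠ 0 := norm_ne_zero_iff.2 hx
  have h1 : HasFDerivAt (fun y : E => ‖y‖) (‖x‖⁻¹ • innerSL ℝ x) x := by
    have h2 := (hasStrictFDerivAt_norm_sq x).hasFDerivAt.sqrt (pow_ne_zero 2 hn)
    have h3 : (fun y : E => Real.sqrt (‖y‖ ^ 2)) = fun y => ‖y‖ :=
      funext fun y => Real.sqrt_sq (norm_nonneg y)
    rw [h3, Real.sqrt_sq (norm_nonneg x)] at h2
    convert! h2 using 1
    rw [← Nat.cast_smul_eq_nsmul ℝ, smul_smul]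
    congr 1
    field_simp
    norm_num
  have h2 : HasDerivAt (fun t : ℝ => (t ^ k)⁻¹) (-((k : ℝ) * ‖x‖ ^ (k - 1)) / (‖x‖ ^ k) ^ 2) ‖x‖ :=
    (hasDerivAt_pow k ‖x‖).inv (pow_ne_zero k hn)
  convert! h2.comp_hasFDerivAt x h1 using 1
  rw [smul_smul]
  congr 1
  cases k with
  | zero => simp
  | succ k =>
    simp only [Nat.add_sub_cancel]
    field_simp
    ring

variable {m : ℕ}

theorem kernelE_eq (hm : 1 ≤ m) {u v : Rn (m + 1)} (h : u ≠ v) :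
    kernelE u v =
      -(((‖u - v‖ ^ (m + 1))⁻¹ * (‖u - hatVec m v‖ ^ (m - 1))⁻¹) • vec (u - v)) := by
  obtain ⟨k, rfl⟩ := Nat.exists_eq_add_of_le' hm
  have h0 : ‖u - v‖ ≠ 0 := norm_ne_zero_iff.2 (sub_ne_zero.2 h)
  rw [kernelE, inverse_vec (sub_ne_zero.2 h), smul_neg, smul_smul]
  congr 2
  simp only [Nat.add_sub_cancel]
  have ht : ∀ t : ℝ, (t ^ (k + 1 + 1))⁻¹ = (t ^ k)⁻¹ * (t ^ 2)⁻¹ := fun t => by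
    rw [← mul_inv, ← pow_add]
  rw [mul_inv, ht]
  ring

/-- Thanks to this, the derivative of `F` comes from that of `E` by the chain rule. -/
theorem kernelF_eq_kernelE (u v : Rn (m + 1)) : kernelF u v = kernelE (hatVec m u) v := by
  have : ‖hatVec m u - hatVec m v‖ = ‖u - v‖ := by
    rw [← norm_hatVec (u - v)]
    congr 1
    exact (map_sub (hatVecL m) u v).symm
  rw [kernelF, kernelE, this, mul_comm]

/-- The factor `(u - v) / ‖u - v‖ ^ (m + 1)` is the Euclidean Cauchy kernel up to a constant,
annihilated by the Dirac operator from the right. Only the derivative of `‖u - v̂‖ ^ (-(m - 1))`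
survives. -/
theorem hasFDerivAt_kernelE (hm : 1 ≤ m) {u v : Rn (m + 1)} (h : u ≠ v) (h' : u ≠ hatVec m v) :
    ∃ E' : Rn (m + 1) →L[ℝ] Cl (m + 1), HasFDerivAt (fun u => kernelE u v) E' u ∧
      ∑ j, E' (stdVec j) * gen j =
        (((m : ℝ) - 1) * ((‖u - v‖ ^ (m + 1))⁻¹ * (‖u - hatVec m v‖ ^ (m + 1))⁻¹)) •
          (vec (u - v) * vec (u - hatVec m v)) := by
  set x := u - v with hx
  set y := u - hatVec m v with hy
  have hx0 : x ≠ 0 := sub_ne_zero.2 h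
  have hy0 : y ≠ 0 := sub_ne_zero.2 h'
  have hnx : ‖x‖ ≠ 0 := norm_ne_zero_iff.2 hx0
  have e1 : HasFDerivAt (fun u => (‖u - v‖ ^ (m + 1))⁻¹)
      ((-((m + 1 : ℕ) : ℝ) * (‖x‖ ^ (m + 1 + 2))⁻¹) • innerSL ℝ x) u :=
    HasFDerivAt.comp (f := fun u => u - v) u (hasFDerivAt_inv_norm_pow (m + 1) hx0)
      ((hasFDerivAt_id u).sub_const v)
  have e2 : HasFDerivAt (fun u => (‖u - hatVec m v‖ ^ (m - 1))⁻¹)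
      ((-((m - 1 : ℕ) : ℝ) * (‖y‖ ^ (m - 1 + 2))⁻¹) • innerSL ℝ y) u :=
    HasFDerivAt.comp (f := fun u => u - hatVec m v) u (hasFDerivAt_inv_norm_pow (m - 1) hy0)
      ((hasFDerivAt_id u).sub_const _)
  have e3 : HasFDerivAt (fun u => vec (u - v)) (vecL (m + 1)) u :=
    (vecL (m + 1)).hasFDerivAt.comp u ((hasFDerivAt_id u).sub_const v)
  have e4 := ((e1.mul e2).smul e3).neg
  refine ⟨_, e4.congr_of_eventuallyEq ?_, ?_⟩
  · filter_upwards [isOpen_ne.mem_nhds h] with z hz using kernelE_eq hm hz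
  set a := (‖x‖ ^ (m + 1))⁻¹ with ha
  set b := (‖y‖ ^ (m - 1))⁻¹ with hb
  set α := -((m + 1 : ℕ) : ℝ) * (‖x‖ ^ (m + 1 + 2))⁻¹ with hα
  set β := -((m - 1 : ℕ) : ℝ) * (‖y‖ ^ (m - 1 + 2))⁻¹ with hβ
  have hterm : ∀ j, (-((a * b) • vecL (m + 1) +
      (a • (β • innerSL ℝ y) + b • (α • innerSL ℝ x)).smulRight (vec x))) (stdVec j) * gen j =
      (a * b) • (1 : Cl (m + 1)) - (a * β) • (vec x * (y j • gen j)) -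
        (b * α) • (vec x * (x j • gen j)) := by
    intro j
    have hip : ∀ z : Rn (m + 1), inner ℝ z (stdVec j) = z j := fun z => by
      simp [stdVec, EuclideanSpace.inner_single_right]
    have hg : gen j * gen j = (-1 : Cl (m + 1)) := by
      have := gen_mul_gen_mul j (1 : Cl (m + 1)); simpa using this
    simp only [neg_apply, add_apply, smul_apply, vecL_apply, ContinuousLinearMap.smulRight_apply,
      innerSL_apply_apply, hip, neg_mul, add_mul, smul_mul_assoc, hg, mul_smul_comm, smul_eq_mul,
      add_smul, smul_neg]
    module
  refine (Finset.sum_congr rfl fun j _ => hterm j).trans ?_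
  rw [Finset.sum_sub_distrib, Finset.sum_sub_distrib, ← Finset.smul_sum, ← Finset.smul_sum,
    ← Finset.smul_sum, ← Finset.mul_sum, ← Finset.mul_sum, ← vec_eq_sum, ← vec_eq_sum, vec_mul_self,
    Algebra.algebraMap_eq_smul_one, smul_smul, Finset.sum_const, Finset.card_univ,
    Fintype.card_fin, ← Nat.cast_smul_eq_nsmul ℝ, smul_smul]
  -- This cancellation is the monogenicity of `x / ‖x‖ ^ (m + 1)`; `c2` evaluates the term that
  -- remains.
  have c1 : a * b * ((m + 1 : ℕ) : ℝ) = b * α * -‖x‖ ^ 2 := by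
    rw [hα, ha, pow_add _ (m + 1) 2, mul_inv]
    field_simp
  have c2 : -(a * β) = ((m : ℝ) - 1) * (a * (‖y‖ ^ (m + 1))⁻¹) := by
    rw [hβ, Nat.cast_sub hm, show m - 1 + 2 = m + 1 by omega]
    push_cast
    ring
  rw [c1, ← c2, neg_smul]
  abel

/-- The algebraic identity behind the two Cauchy kernels. -/
theorem kernel_sub_mul_genLast (u v : Rn (m + 1)) :
    ((‖u - hatVec m v‖ ^ 2) • vec (u - v) - (‖u - v‖ ^ 2) • vec (hatVec m u - v)) * genLast m =
        (2 * u (Fin.last m)) • (vec (u - v) * vec (u - hatVec m v)) ∧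
      ((‖u - hatVec m v‖ ^ 2) • vec (u - v) - (‖u - v‖ ^ 2) • vec (hatVec m u - v)) * genLast m =
        (2 * u (Fin.last m)) • (vec (hatVec m u - v) * vec (hatVec m u - hatVec m v)) := by
  have hhat : ∀ a b : Rn (m + 1), hatVec m (a - b) = hatVec m a - hatVec m b := fun a b =>
    map_sub (hatVecL m) a b
  have hn : ‖u - hatVec m v‖ = ‖hatVec m u - v‖ := by
    rw [← norm_hatVec, hhat, hatVec_hatVec]
  set x := vec (u - v) with hx
  set x' := vec (hatVec m u - v) with hx'
  -- Both identities come from this: `x * x` and `x' * x'` are central, so the bracket factors as `x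
  -- (x - x') x'` and also as `x' (x - x') x`.
  have hd : x - x' = (2 * u (Fin.last m)) • genLast m := by
    rw [hx, hx', ← map_sub, hatVec_apply, ← map_smul]
    congr 1
    abel
  have h1 : (‖u - v‖ ^ 2) • (1 : Cl (m + 1)) = -(x * x) := by
    rw [hx, vec_mul_self, Algebra.algebraMap_eq_smul_one]; simp
  have h2 : (‖u - hatVec m v‖ ^ 2) • (1 : Cl (m + 1)) = -(x' * x') := by
    rw [hn, hx', vec_mul_self, Algebra.algebraMap_eq_smul_one]; simp
  have hy : genLast m * x' * genLast m = vec (u - hatVec m v) := by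
    have := genLast_mul_hatCl_vec_mul_genLast (u - hatVec m v)
    rwa [hatCl_vec, hhat, hatVec_hatVec] at this
  have hy' : genLast m * x * genLast m = vec (hatVec m u - hatVec m v) := by
    have := genLast_mul_hatCl_vec_mul_genLast (hatVec m u - hatVec m v)
    rwa [hatCl_vec, hhat, hatVec_hatVec, hatVec_hatVec] at this
  have l1 : ∀ A : Cl (m + 1), (‖u - v‖ ^ 2) • A = -(x * x) * A := fun A => by
    rw [← h1, smul_mul_assoc, one_mul]
  have l2 : ∀ A : Cl (m + 1), (‖u - hatVec m v‖ ^ 2) • A = -(x' * x') * A := fun A => by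
    rw [← h2, smul_mul_assoc, one_mul]
  have r1 : ∀ A : Cl (m + 1), (‖u - v‖ ^ 2) • A = A * -(x * x) := fun A => by
    rw [← h1, mul_smul_comm, mul_one]
  have r2 : ∀ A : Cl (m + 1), (‖u - hatVec m v‖ ^ 2) • A = A * -(x' * x') := fun A => by
    rw [← h2, mul_smul_comm, mul_one]
  constructor
  · rw [r2, l1, ← hy]
    have : x * -(x' * x') - -(x * x) * x' = x * (x - x') * x' := by noncomm_ring
    rw [this, hd]
    simp only [mul_smul_comm, smul_mul_assoc, mul_assoc]
  · rw [l2, r1, ← hy']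
    have : -(x' * x') * x - x' * -(x * x) = x' * (x - x') * x := by noncomm_ring
    rw [this, hd]
    simp only [mul_smul_comm, smul_mul_assoc, mul_assoc]

/-- The flux form `ν ↦ A (R ν) B`, bilinear in `A` and `B`. -/
noncomputable def flux {n : ℕ} (R : Rn n →L[ℝ] Rn n) :
    Cl n →L[ℝ] Cl n →L[ℝ] Rn n →L[ℝ] Cl n :=
  LinearMap.toContinuousBilinearMap (LinearMap.mk₂ ℝ
    (fun A B => ((clMul n).flip B).comp ((clMul n A).comp ((vecL n).comp R)))
    (fun A A' B => by ext; simp)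
    (fun c A B => by ext; simp)
    (fun A B B' => by ext; simp)
    (fun c A B => by ext; simp))

theorem flux_apply {n : ℕ} (R : Rn n →L[ℝ] Rn n) (A B : Cl n) (ν : Rn n) :
    flux R A B ν = A * vec (R ν) * B := rfl

theorem divergence_flux {n : ℕ} (R : Rn n →L[ℝ] Rn n) {A B : Rn n → Cl n}
    {A' B' : Rn n →L[ℝ] Cl n} {x : Rn n} (hA : HasFDerivAt A A' x) (hB : HasFDerivAt B B' x) :
    DifferentiableAt ℝ (fun y => flux R (A y) (B y)) x ∧
      divergence (fun y => flux R (A y) (B y)) x =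
        (∑ j, A' (stdVec j) * vec (R (stdVec j))) * B x +
          A x * ∑ j, vec (R (stdVec j)) * B' (stdVec j) := by
  have h := (flux R).hasFDerivAt_of_bilinear hA hB
  refine ⟨h.differentiableAt, ?_⟩
  simp only [divergence, h.fderiv]
  rw [Finset.sum_mul, Finset.mul_sum, ← Finset.sum_add_distrib]
  refine Finset.sum_congr rfl fun j _ => ?_
  change flux R (A x) (B' (stdVec j)) (stdVec j) + flux R (A' (stdVec j)) (B x) (stdVec j) = _
  rw [flux_apply, flux_apply, add_comm, mul_assoc (A x)]

theorem hatVec_stdVec (j : Fin (m + 1)) :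
    hatVec m (stdVec j) = stdVec j ∨ hatVec m (stdVec j) = -stdVec j := by
  by_cases h : j = Fin.last m
  · right
    subst h
    rw [hatVec_apply]
    simp [stdVec, two_smul]
  · left
    rw [hatVec_apply]
    have : (stdVec j : Rn (m + 1)) (Fin.last m) = 0 := by
      simp [stdVec, Ne.symm h]
    rw [this]
    simp

/-- The flux field of Cauchy's formula. -/
noncomputable def cauchyField (g : Rn (m + 1) → Cl (m + 1)) (v : Rn (m + 1)) (u : Rn (m + 1)) :
    Rn (m + 1) →L[ℝ] Cl (m + 1) :=
  flux (ContinuousLinearMap.id ℝ _) (kernelE u v) (g u) -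
    flux (hatVecL m) (kernelF u v) (hatCl (g u))

theorem cauchyField_apply (g : Rn (m + 1) → Cl (m + 1)) (v u ν : Rn (m + 1)) :
    cauchyField g v u ν =
      kernelE u v * vec ν * g u - kernelF u v * vec (hatVec m ν) * hatCl (g u) := rfl

/-- By the product rule the kernels contribute `-c (E - F) e_n (g - ĝ)`. Since `Dg = c e_n (g - ĝ)`
is fixed by the hat, the function contributes `(E - F) Dg`, which is the opposite. -/
theorem divergence_cauchyField (hm : 1 ≤ m) {g : Rn (m + 1) → Cl (m + 1)} {u v : Rn (m + 1)}
    (hg : DifferentiableAt ℝ g u) (hgM : diracHodgeOp g u = 0) (hu : 0 < u (Fin.last m))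
    (h : u ≠ v) (h' : u ≠ hatVec m v) :
    DifferentiableAt ℝ (cauchyField g v) u ∧ divergence (cauchyField g v) u = 0 := by
  have hhat : ∀ a b : Rn (m + 1), hatVec m (a - b) = hatVec m a - hatVec m b := fun a b =>
    map_sub (hatVecL m) a b
  obtain ⟨E', hE', hED⟩ := hasFDerivAt_kernelE hm h h'
  have k1 : hatVec m u ≠ v := fun e => h' (by rw [← e, hatVec_hatVec])
  have k2 : hatVec m u ≠ hatVec m v := fun e => h (by
    rw [← hatVec_hatVec u, e, hatVec_hatVec])
  obtain ⟨F', hF', hFD⟩ := hasFDerivAt_kernelE hm k1 k2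
  have hF'' : HasFDerivAt (fun u => kernelF u v) (F'.comp (hatVecL m)) u := by
    simp only [kernelF_eq_kernelE]
    exact HasFDerivAt.comp u (f := hatVecL m) hF' (hatVecL m).hasFDerivAt
  have hgh : HasFDerivAt (fun u => hatCl (g u)) ((hatL m).comp (fderiv ℝ g u)) u :=
    (hatL m).hasFDerivAt.comp u hg.hasFDerivAt
  obtain ⟨d1, e1⟩ := divergence_flux (ContinuousLinearMap.id ℝ _) hE' hg.hasFDerivAt
  obtain ⟨d2, e2⟩ := divergence_flux (hatVecL m) hF'' hgh
  refine ⟨d1.sub d2, ?_⟩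
  have hdiv : divergence (cauchyField g v) u =
      divergence (fun u => flux (ContinuousLinearMap.id ℝ _) (kernelE u v) (g u)) u -
        divergence (fun u => flux (hatVecL m) (kernelF u v) (hatCl (g u))) u := by
    simp only [divergence, ← Finset.sum_sub_distrib]
    refine Finset.sum_congr rfl fun j _ => ?_
    have : fderiv ℝ (cauchyField g v) u = _ := fderiv_fun_sub d1 d2
    rw [this]
    rfl
  -- The sign of the reflected `e_j` occurs twice, once from the chain rule and once from the flux
  -- form.
  have f1 : ∑ j, (F'.comp (hatVecL m)) (stdVec j) * vec (hatVecL m (stdVec j)) =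
      ∑ j, F' (stdVec j) * gen j := by
    refine Finset.sum_congr rfl fun j _ => ?_
    rw [ContinuousLinearMap.comp_apply, hatVecL_apply]
    rcases hatVec_stdVec j with e | e
    · rw [e]
    · rw [e]; simp
  have f2 : ∑ j, vec (hatVecL m (stdVec j)) * ((hatL m).comp (fderiv ℝ g u)) (stdVec j) =
      hatCl (diracOp g u) := by
    rw [diracOp, map_sum]
    refine Finset.sum_congr rfl fun j _ => ?_
    rw [map_mul, hatCl_vec]
    rfl
  have f3 : ∑ j, vec ((ContinuousLinearMap.id ℝ (Rn (m + 1))) (stdVec j)) *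
      fderiv ℝ g u (stdVec j) = diracOp g u := rfl
  have f4 : ∑ j, E' (stdVec j) * vec ((ContinuousLinearMap.id ℝ (Rn (m + 1))) (stdVec j)) =
      ∑ j, E' (stdVec j) * gen j := rfl
  set c : ℝ := ((m : ℝ) - 1) / (2 * u (Fin.last m)) with hc
  have hDg : diracOp g u = c • (genLast m * (g u - hatCl (g u))) := by
    rw [diracHodgeOp, projQ'_eq, smul_neg, smul_smul, ← sub_eq_add_neg, sub_eq_zero] at hgM
    rw [hgM, hc]
    congr 1
    field_simp
  have hDgh : hatCl (diracOp g u) = diracOp g u := by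
    rw [hDg, map_smul, map_mul, hatCl_genLast, map_sub, hatCl_hatCl, neg_mul, ← mul_neg, neg_sub]
  have hn1 : ‖hatVec m u - v‖ = ‖u - hatVec m v‖ := by
    rw [← norm_hatVec, hhat, hatVec_hatVec]
  have hn2 : ‖hatVec m u - hatVec m v‖ = ‖u - v‖ := by rw [← hhat, norm_hatVec]
  set N := (‖u - v‖ ^ (m + 1))⁻¹ * (‖u - hatVec m v‖ ^ (m + 1))⁻¹ with hN
  have hpow : ∀ {t : ℝ}, t ≠ 0 → (t ^ (m - 1))⁻¹ = (t ^ (m + 1))⁻¹ * t ^ 2 := by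
    intro t ht
    rw [show m + 1 = (m - 1) + 2 by omega, pow_add]
    field_simp
  have hx0 : ‖u - v‖ ≠ 0 := norm_ne_zero_iff.2 (sub_ne_zero.2 h)
  have hy0 : ‖u - hatVec m v‖ ≠ 0 := norm_ne_zero_iff.2 (sub_ne_zero.2 h')
  have hEF : kernelE u v - kernelF u v =
      -(N • ((‖u - hatVec m v‖ ^ 2) • vec (u - v) - (‖u - v‖ ^ 2) • vec (hatVec m u - v))) := by
    rw [kernelF_eq_kernelE, kernelE_eq hm h, kernelE_eq hm k1, hn1, hn2, hpow hx0, hpow hy0, hN]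
    module
  obtain ⟨i1, i2⟩ := kernel_sub_mul_genLast u v
  have j1 : ∑ j, E' (stdVec j) * gen j = -(c • ((kernelE u v - kernelF u v) * genLast m)) := by
    rw [hED, hEF, neg_mul, smul_mul_assoc, i1, smul_neg, neg_neg, smul_smul, smul_smul, hc]
    congr 1
    field_simp
  have j2 : ∑ j, F' (stdVec j) * gen j = -(c • ((kernelE u v - kernelF u v) * genLast m)) := by
    rw [hFD, hEF, neg_mul, smul_mul_assoc, i2, smul_neg, neg_neg, smul_smul, smul_smul, hc, hn1,
      hn2, hN]
    congr 1
    field_simp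
  rw [hdiv, e1, e2, f1, f2, f3, f4, hDgh, j1, j2, hDg]
  simp only [neg_mul, smul_mul_assoc, mul_smul_comm, mul_sub, sub_mul, smul_sub, mul_assoc]
  abel

end Kernel

/-! ### Cauchy's formula for hypermonogenic functions -/

section Cauchy

open Filter Topology Metric

variable {m : ℕ}

/-- The flux of a field without divergence out of `K` equals its flux through a small sphere
about the only singularity of the field. -/
theorem setIntegral_frontier_eq_sphere {F : Type*} [NormedAddCommGroup F] [NormedSpace ℝ F]
    [CompleteSpace F] {K O : Set (Rn (m + 1))} (hK : IsCompact K) (hb : HasC1Boundary K)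
    (hO : IsOpen O) (hKO : K ⊆ O) {v : Rn (m + 1)} {X : Rn (m + 1) → Rn (m + 1) →L[ℝ] F}
    (hX : ∀ x ∈ O, x ≠ v → DifferentiableAt ℝ X x) (hd : ∀ x ∈ O, x ≠ v → divergence X x = 0)
    {r : ℝ} (hr : 0 < r) (hrK : closedBall v r ⊆ interior K) :
    ∫ x in frontier K, X x (outerNormal K x) ∂(surfaceMeasure m) =
      ∫ x in sphere v r, X x (r⁻¹ • (x - v)) ∂(surfaceMeasure m) := by
  -- `(1 - φ) X` vanishes near `v` and equals `X` at distance greater than `r / 2`. The divergence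
  -- theorem applies to it on `K` and on the ball, and its divergence vanishes between the two.
  let φ : ContDiffBump v := ⟨r / 4, r / 2, by positivity, by linarith⟩
  set χ : Rn (m + 1) → ℝ := fun x => 1 - φ x with hχ
  have hχc : ContDiff ℝ 1 χ := contDiff_const.sub φ.contDiff
  set Y : Rn (m + 1) → Rn (m + 1) →L[ℝ] F := fun x => χ x • X x with hY
  have hone : ∀ x, r / 2 < dist x v → χ x = 1 := fun x hx => by
    rw [hχ]
    simp [φ.zero_of_le_dist hx.le]
  have hYX : ∀ x, r / 2 < dist x v → Y =ᶠ[𝓝 x] X := fun x hx => by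
    filter_upwards [(continuous_id.dist continuous_const).continuousAt.eventually
      (lt_mem_nhds hx)] with y hy
    change χ y • X y = X y
    rw [hone y hy, one_smul]
  have hY0 : Y =ᶠ[𝓝 v] fun _ => 0 := by
    filter_upwards [closedBall_mem_nhds v φ.rIn_pos] with y hy
    change (1 - φ y) • X y = 0
    rw [φ.one_of_mem_closedBall hy, sub_self, zero_smul]
  have hYd : DifferentiableOn ℝ Y O := by
    intro x hx
    refine DifferentiableAt.differentiableWithinAt ?_
    by_cases h : x = v
    · rw [h, hY0.differentiableAt_iff]
      exact differentiableAt_const _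
    · exact (hχc.differentiable one_ne_zero x).smul (hX x hx h)
  have hYc : ContinuousOn (divergence Y) O := by
    intro x hx
    refine ContinuousAt.continuousWithinAt ?_
    by_cases h : x = v
    · subst h
      have : divergence Y =ᶠ[𝓝 x] fun _ => 0 := by
        filter_upwards [hY0.eventuallyEq_nhds] with y hy
        rw [divergence_congr hy]
        simp [divergence]
      exact continuousAt_const.congr this.symm
    · have : divergence Y =ᶠ[𝓝 x] fun y => X y (gradient χ y) := by
        filter_upwards [hO.mem_nhds hx, isOpen_ne.mem_nhds h] with y hy hyv
        rw [divergence_smul (hχc.differentiable one_ne_zero y) (hX y hy hyv), hd y hy hyv,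
          smul_zero, zero_add]
      refine ContinuousAt.congr ?_ this.symm
      exact (hX x hx h).continuousAt.clm_apply
        (((InnerProductSpace.toDual ℝ (Rn (m + 1))).symm.continuous.comp
          (hχc.continuous_fderiv one_ne_zero)).continuousAt)
  have hBK : closedBall v r ⊆ K := hrK.trans interior_subset
  have e1 := setIntegral_divergence_eq hK hb hO hKO hYd hYc
  have e2 := setIntegral_divergence_eq (isCompact_closedBall v r) (hasC1Boundary_closedBall hr) hO
    (hBK.trans hKO) hYd hYc
  have e3 : ∫ x in K, divergence Y x = ∫ x in closedBall v r, divergence Y x := by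
    refine setIntegral_eq_of_subset_of_forall_sdiff_eq_zero hK.measurableSet hBK fun x hx => ?_
    have hxr : r < dist x v := not_le.1 hx.2
    rw [divergence_congr (hYX x (by linarith))]
    exact hd x (hKO hx.1) fun h => by simp [h] at hxr; linarith
  rw [frontier_closedBall v hr.ne'] at e2
  have e4 : ∫ x in frontier K, Y x (outerNormal K x) ∂(surfaceMeasure m) =
      ∫ x in frontier K, X x (outerNormal K x) ∂(surfaceMeasure m) := by
    refine setIntegral_congr_fun isClosed_frontier.measurableSet fun x hx => ?_
    have hxr : r < dist x v := by
      by_contra h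
      exact hx.2 (hrK (not_lt.1 h))
    change (χ x • X x) _ = _
    rw [hone x (by linarith), one_smul]
  have e5 : ∫ x in sphere v r, Y x (outerNormal (closedBall v r) x) ∂(surfaceMeasure m) =
      ∫ x in sphere v r, X x (r⁻¹ • (x - v)) ∂(surfaceMeasure m) := by
    refine setIntegral_congr_fun isClosed_sphere.measurableSet fun x hx => ?_
    have hxr : dist x v = r := hx
    change (χ x • X x) _ = _
    rw [hone x (by linarith), one_smul, outerNormal_closedBall hr hx]
  rw [← e4, ← e1, e3, e2, e5]

/-- Spherical means converge to the value at the centre. -/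
theorem tendsto_setIntegral_sphere {F : Type*} [NormedAddCommGroup F] [NormedSpace ℝ F]
    [CompleteSpace F] {H : Rn (m + 1) → F} {v : Rn (m + 1)} {R : ℝ} (hR : 0 < R)
    (hH : ContinuousOn H (closedBall v R)) :
    Tendsto (fun r : ℝ => ∫ x in sphere v r, (r ^ m)⁻¹ • H x ∂(surfaceMeasure m)) (𝓝[>] 0)
      (𝓝 (sphereArea m • H v)) := by
  have hHv : ContinuousAt H v := hH.continuousAt (closedBall_mem_nhds v hR)
  rw [tendsto_iff_norm_sub_tendsto_zero]
  rw [Metric.tendsto_nhds]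
  intro δ hδ
  have hS := sphereArea_pos m
  obtain ⟨η, hη, hηH⟩ := Metric.continuousAt_iff.1 hHv (δ / (2 * sphereArea m)) (by positivity)
  have hmem : Ioo 0 (min η R) ∈ 𝓝[>] (0 : ℝ) := Ioo_mem_nhdsGT (lt_min hη hR)
  filter_upwards [hmem] with r hr
  have hr0 : 0 < r := hr.1
  have hfin : surfaceMeasure m (sphere v r) < ⊤ := by
    have := surfaceMeasure_frontier_lt_top (isCompact_closedBall v r) (hasC1Boundary_closedBall hr0)
    rwa [frontier_closedBall v hr0.ne'] at this
  have hi : IntegrableOn H (sphere v r) (surfaceMeasure m) := by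
    have := integrableOn_frontier (isCompact_closedBall v r) (hasC1Boundary_closedBall hr0)
      (G := H)
    rw [frontier_closedBall v hr0.ne'] at this
    exact this (hH.mono (sphere_subset_closedBall.trans
      (closedBall_subset_closedBall (hr.2.le.trans (min_le_right _ _)))))
  have hc : ∫ _ in sphere v r, H v ∂(surfaceMeasure m) = (r ^ m * sphereArea m) • H v := by
    rw [setIntegral_const, surfaceMeasure_sphere hr0]
  have hci : IntegrableOn (fun _ => H v) (sphere v r) (surfaceMeasure m) :=
    integrableOn_const hfin.ne
  have hrm : (0 : ℝ) < r ^ m := pow_pos hr0 m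
  have e : ∫ x in sphere v r, (r ^ m)⁻¹ • H x ∂(surfaceMeasure m) - sphereArea m • H v =
      (r ^ m)⁻¹ • ∫ x in sphere v r, (H x - H v) ∂(surfaceMeasure m) := by
    rw [integral_smul, integral_sub hi hci, hc, smul_sub, smul_smul]
    congr 2
    field_simp
  have hb : ‖∫ x in sphere v r, (H x - H v) ∂(surfaceMeasure m)‖ ≤
      δ / (2 * sphereArea m) * (r ^ m * sphereArea m) := by
    rw [← surfaceMeasure_sphere hr0 (v := v)]
    refine norm_setIntegral_le_of_norm_le_const hfin fun x hx => ?_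
    rw [← dist_eq_norm]
    refine (hηH ?_).le
    rw [mem_sphere.1 hx]
    exact hr.2.trans_le (min_le_left _ _)
  rw [Real.dist_eq, sub_zero, abs_norm, e, norm_smul, norm_inv, Real.norm_of_nonneg hrm.le]
  calc (r ^ m)⁻¹ * _ ≤ (r ^ m)⁻¹ * (δ / (2 * sphereArea m) * (r ^ m * sphereArea m)) := by gcongr
    _ = δ / 2 := by field_simp
    _ < δ := by linarith

theorem ne_hatVec_of_mem_upperHalf {u v : Rn (m + 1)} (hu : u ∈ upperHalf m)
    (hv : v ∈ upperHalf m) : u ≠ hatVec m v := by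
  intro h
  have h1 : u (Fin.last m) = -v (Fin.last m) := by
    rw [h, hatVec_apply]
    simp [stdVec]
    ring
  have h2 : 0 < u (Fin.last m) := hu
  have h3 : 0 < v (Fin.last m) := hv
  linarith

/-- In the radial direction `(u - v)² = -‖u - v‖²` makes the kernel `E` scalar. After the factor `‖u
- v‖ ^ (-m)`, matching the area of the sphere, what remains is continuous near `v` when `g` is and
`v ≠ v̂`, and its second term vanishes at `u = v`. -/
theorem cauchyField_radial (hm : 1 ≤ m) (g : Rn (m + 1) → Cl (m + 1)) {u v : Rn (m + 1)}
    (h : u ≠ v) (h' : u ≠ hatVec m v) :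
    cauchyField g v u (‖u - v‖⁻¹ • (u - v)) =
      (‖u - v‖ ^ m)⁻¹ • ((‖u - hatVec m v‖ ^ (m - 1))⁻¹ • g u +
        (‖u - hatVec m v‖ ^ (m + 1))⁻¹ •
          (vec (hatVec m u - v) * vec (hatVec m (u - v)) * hatCl (g u))) := by
  have hhat : ∀ a b : Rn (m + 1), hatVec m (a - b) = hatVec m a - hatVec m b := fun a b =>
    map_sub (hatVecL m) a b
  have hsm : hatVec m (‖u - v‖⁻¹ • (u - v)) = ‖u - v‖⁻¹ • hatVec m (u - v) :=
    map_smul (hatVecL m) _ _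
  have k1 : hatVec m u ≠ v := fun e => h' (by rw [← e, hatVec_hatVec])
  have hn1 : ‖hatVec m u - v‖ = ‖u - hatVec m v‖ := by
    rw [← norm_hatVec, hhat, hatVec_hatVec]
  have hn2 : ‖hatVec m u - hatVec m v‖ = ‖u - v‖ := by rw [← hhat, norm_hatVec]
  have hx0 : ‖u - v‖ ≠ 0 := norm_ne_zero_iff.2 (sub_ne_zero.2 h)
  rw [cauchyField_apply, kernelF_eq_kernelE, kernelE_eq hm h, kernelE_eq hm k1, hn1, hn2, hsm,
    map_smul, map_smul]
  simp only [neg_mul, smul_mul_assoc, mul_smul_comm, vec_mul_self, smul_smul, smul_add,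
    Algebra.algebraMap_eq_smul_one, one_mul, smul_neg, neg_smul, neg_neg, sub_neg_eq_add]
  congr 2
  · rw [pow_succ ‖u - v‖ m, mul_inv]
    field_simp
  · obtain ⟨k, rfl⟩ := Nat.exists_eq_add_of_le' hm
    rw [pow_succ ‖u - v‖ k, mul_inv, Nat.add_sub_cancel]
    ring

/-- **Cauchy's formula** for left hypermonogenic functions. -/
theorem cauchy_formula (hm : 1 ≤ m) {U : Set (Rn (m + 1))} (hU : IsOpen U) (hUH : U ⊆ upperHalf m)
    {g : Rn (m + 1) → Cl (m + 1)} (hg : IsLeftHypermonogenicOn g U) {L : Set (Rn (m + 1))}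
    (hL : IsCompact L) (hLU : L ⊆ U) (hb : HasC1Boundary L) {v : Rn (m + 1)}
    (hv : v ∈ interior L) :
    IntegrableOn (fun u => cauchyField g v u (outerNormal L u)) (frontier L) (surfaceMeasure m) ∧
      g v = ((2 * v (Fin.last m)) ^ (m - 1) / sphereArea m) •
        ∫ u in frontier L, cauchyField g v u (outerNormal L u) ∂(surfaceMeasure m) := by
  have hvU : v ∈ U := hLU (interior_subset hv)
  have hvn : 0 < v (Fin.last m) := hUH hvU
  have hgd : ∀ u ∈ U, DifferentiableAt ℝ g u := fun u hu =>
    hg.1.differentiableAt (hU.mem_nhds hu)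
  have hX : ∀ u ∈ U, u ≠ v → DifferentiableAt ℝ (cauchyField g v) u ∧
      divergence (cauchyField g v) u = 0 := fun u hu huv =>
    divergence_cauchyField hm (hgd u hu) (hg.2 u hu) (hUH hu) huv
      (ne_hatVec_of_mem_upperHalf (hUH hu) (hUH hvU))
  refine ⟨integrableOn_frontier hL hb ?_, ?_⟩
  · refine ContinuousOn.clm_apply (fun u hu => ?_) (continuousOn_outerNormal hb)
    exact (hX u (hLU (hL.isClosed.frontier_subset hu))
      fun h => hu.2 (h ▸ hv)).1.continuousAt.continuousWithinAt
  obtain ⟨R, hR, hRL⟩ := Metric.nhds_basis_closedBall.mem_iff.1 (isOpen_interior.mem_nhds hv)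
  set H : Rn (m + 1) → Cl (m + 1) := fun u => (‖u - hatVec m v‖ ^ (m - 1))⁻¹ • g u +
    (‖u - hatVec m v‖ ^ (m + 1))⁻¹ •
      (vec (hatVec m u - v) * vec (hatVec m (u - v)) * hatCl (g u)) with hH
  have hRU : closedBall v R ⊆ U := hRL.trans (interior_subset.trans hLU)
  have hHc : ContinuousOn H (closedBall v R) := by
    have hg' : ContinuousOn g (closedBall v R) := hg.1.continuousOn.mono hRU
    have hne : ∀ u ∈ closedBall v R, ‖u - hatVec m v‖ ≠ 0 := fun u hu =>
      norm_ne_zero_iff.2 (sub_ne_zero.2 (ne_hatVec_of_mem_upperHalf (hUH (hRU hu)) (hUH hvU)))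
    have hn : ∀ k : ℕ, ContinuousOn (fun u => (‖u - hatVec m v‖ ^ k)⁻¹) (closedBall v R) :=
      fun k => ContinuousOn.inv₀ (by fun_prop) fun u hu => pow_ne_zero k (hne u hu)
    refine ((hn _).smul hg').add ((hn _).smul (ContinuousOn.fun_mul (Continuous.continuousOn ?_) ?_))
    · change Continuous fun u => vecL (m + 1) (hatVecL m u - v) * vecL (m + 1) (hatVecL m (u - v))
      fun_prop
    · exact (hatL m).continuous.comp_continuousOn hg'
  have hlim := tendsto_setIntegral_sphere hR hHc
  -- The spherical integrals do not depend on small `r`, so their limit is the boundary integral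
  -- itself.
  have hconst : (fun r : ℝ => ∫ x in sphere v r, (r ^ m)⁻¹ • H x ∂(surfaceMeasure m)) =ᶠ[𝓝[>] 0]
      fun _ => ∫ u in frontier L, cauchyField g v u (outerNormal L u) ∂(surfaceMeasure m) := by
    filter_upwards [Ioc_mem_nhdsGT hR] with r hr
    rw [setIntegral_frontier_eq_sphere hL hb hU hLU (fun u hu h => (hX u hu h).1)
      (fun u hu h => (hX u hu h).2) hr.1 ((closedBall_subset_closedBall hr.2).trans hRL)]
    refine setIntegral_congr_fun isClosed_sphere.measurableSet fun u hu => ?_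
    have hur : ‖u - v‖ = r := by rw [← dist_eq_norm]; exact hu
    have huv : u ≠ v := fun h => by
      rw [h, sub_self, norm_zero] at hur
      exact hr.1.ne hur
    have huU : u ∈ U := hRU (closedBall_subset_closedBall hr.2 (sphere_subset_closedBall hu))
    have := cauchyField_radial hm g huv (ne_hatVec_of_mem_upperHalf (hUH huU) (hUH hvU))
    rw [hur] at this
    exact this.symm
  have hval := tendsto_nhds_unique (tendsto_const_nhds.congr' hconst.symm) hlim
  have hHv : H v = ((2 * v (Fin.last m)) ^ (m - 1))⁻¹ • g v := by
    have : ‖v - hatVec m v‖ = 2 * v (Fin.last m) := by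
      rw [hatVec_apply, sub_sub_cancel, norm_smul]
      simp [stdVec, abs_of_pos hvn]
    simp [hH, this]
  rw [hval, hHv, smul_smul, smul_smul]
  have h1 := (sphereArea_pos m).ne'
  have h2 : (2 * v (Fin.last m)) ^ (m - 1) ≠ 0 := by positivity
  rw [show ((2 * v (Fin.last m)) ^ (m - 1) / sphereArea m * sphereArea m) *
    ((2 * v (Fin.last m)) ^ (m - 1))⁻¹ = 1 by field_simp, one_smul]

end Cauchy

/-! ### Algebra of Möbius transformations -/

section MoebiusAlgebra

open CliffordAlgebra (reverse)

variable {m : ℕ} {a b c d : Cl (m + 1)} {ψ : Rn (m + 1) → Rn (m + 1)}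

theorem norm_gen {n : ℕ} (j : Fin n) : ‖gen j‖ = 1 := by
  rw [norm_vec]
  simp [stdVec]

theorem mem_subCl_of_mem_closure {q : Cl (m + 1)}
    (h : q ∈ Submonoid.closure (boundaryVectors m)) : q ∈ subCl m :=
  (Submonoid.closure_le (S := (subCl m).toSubmonoid)).2 Algebra.subset_adjoin h

theorem reverse_eq_of_mem_boundaryVectors {q : Cl (m + 1)} (h : q ∈ boundaryVectors m) :
    reverse q = q := by
  obtain ⟨w, -, rfl⟩ := h
  exact CliffordAlgebra.reverse_ι w

theorem IsVecProd.inverse_eq {n : ℕ} {ε : ℝ} {q : Cl n} (h : IsVecProd ε q) (h0 : q ≠ 0) :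
    Ring.inverse q = (ε * (‖q‖ ^ 2)⁻¹) • CliffordAlgebra.reverse q := by
  have hn : ‖q‖ ^ 2 ≠ 0 := by simpa using h0
  have hs : ε * (‖q‖ ^ 2)⁻¹ * (ε * ‖q‖ ^ 2) = 1 := by
    calc _ = (ε * ε) * ((‖q‖ ^ 2)⁻¹ * ‖q‖ ^ 2) := by ring
      _ = 1 := by rw [h.sq_eq_one, inv_mul_cancel₀ hn, one_mul]
  refine Ring.inverse_eq_of_mul_eq_one ?_ ?_
  · rw [mul_smul_comm, h.self_mul_reverse, smul_smul, hs, one_smul]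
  · rw [smul_mul_assoc, h.reverse_mul_self, smul_smul, hs, one_smul]

/-- For `c ≠ 0` the product `c c̃` is a nonzero scalar, so `d` is a multiple of `c (c̃ d)`, and `c̃
d` is a vector of `R^{n-1}`. -/
theorem IsVahlenMatrix.denominator_eq (h : IsVahlenMatrix a b c d) :
    c = 0 ∨ ∃ w : Rn (m + 1), w (Fin.last m) = 0 ∧ ∀ u, c * vec u + d = c * vec (u + w) := by
  by_cases hc : c = 0
  · exact Or.inl hc
  right
  obtain ⟨ε, hε⟩ := IsVecProd.of_mem_closure h.c_mem
  obtain ⟨w, hw, e⟩ := h.cd_mem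
  have hn : ‖c‖ ^ 2 ≠ 0 := by simpa using hc
  refine ⟨(ε * (‖c‖ ^ 2)⁻¹) • w, ?_, fun u => ?_⟩
  · rw [PiLp.smul_apply, show w (Fin.last m) = 0 from hw, smul_zero]
  · rw [map_add, mul_add, map_smul, e, mul_smul_comm, ← mul_assoc, hε.self_mul_reverse,
      smul_mul_assoc, one_mul, smul_smul]
    have : ε * (‖c‖ ^ 2)⁻¹ * (ε * ‖c‖ ^ 2) = 1 := by
      calc _ = (ε * ε) * ((‖c‖ ^ 2)⁻¹ * ‖c‖ ^ 2) := by ring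
        _ = 1 := by rw [hε.sq_eq_one, inv_mul_cancel₀ hn, one_mul]
    rw [this, one_smul]

/-- That one sign works for all `u` is essential: it makes the weight a constant multiple of `(c u +
d)⁻¹`, so the sign is not differentiated. -/
theorem IsVahlenMatrix.exists_isVecProd (h : IsVahlenMatrix a b c d) :
    ∃ ε : ℝ, ∀ u, IsVecProd ε (c * vec u + d) := by
  rcases h.denominator_eq with hc | ⟨w, -, hw⟩
  · obtain ⟨ε, hε⟩ := IsVecProd.of_mem_closure h.d_mem
    exact ⟨ε, fun u => by simpa [hc] using hε⟩
  · obtain ⟨ε, hε⟩ := IsVecProd.of_mem_closure h.c_mem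
    exact ⟨_, fun u => by
      rw [hw]
      exact hε.mul (IsVecProd.of_vec _)⟩

theorem IsVahlenMatrix.hatCl_denominator (h : IsVahlenMatrix a b c d) (u : Rn (m + 1)) :
    hatCl (c * vec u + d) = c * vec (hatVec m u) + d := by
  rw [map_add, map_mul, hatCl_of_mem_subCl (mem_subCl_of_mem_closure h.c_mem),
    hatCl_of_mem_subCl (mem_subCl_of_mem_closure h.d_mem), hatCl_vec]

theorem IsVahlenMatrix.hatCl_numerator (h : IsVahlenMatrix a b c d) (u : Rn (m + 1)) :
    hatCl (a * vec u + b) = a * vec (hatVec m u) + b := by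
  rw [map_add, map_mul, hatCl_of_mem_subCl (mem_subCl_of_mem_closure h.a_mem),
    hatCl_of_mem_subCl (mem_subCl_of_mem_closure h.b_mem), hatCl_vec]

/-- The difference of two values of a Möbius transformation. -/
theorem IsVahlenMatrix.reverse_mul_sub_mul (h : IsVahlenMatrix a b c d) {s : ℝ}
    (hs : reverse a * d - reverse c * b = s • (1 : Cl (m + 1))) {x y X Y : Rn (m + 1)}
    (hx : vec X * (c * vec x + d) = a * vec x + b)
    (hy : vec Y * (c * vec y + d) = a * vec y + b) :
    reverse (c * vec y + d) * vec (X - Y) * (c * vec x + d) = s • vec (x - y) := by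
  have hrv : ∀ x : Rn (m + 1), reverse (vec x) = vec x := fun x => CliffordAlgebra.reverse_ι x
  have hrr : ∀ A : Cl (m + 1), reverse (reverse A) = A := CliffordAlgebra.reverse_reverse
  have hy' := congrArg reverse hy
  simp only [CliffordAlgebra.reverse.map_mul, map_add, hrv] at hy'
  have h1 := reverse_eq_of_mem_boundaryVectors h.ac_mem
  have h2 := reverse_eq_of_mem_boundaryVectors h.db_mem
  have h3 := congrArg reverse hs
  simp only [CliffordAlgebra.reverse.map_mul, map_sub, hrr, map_smul,
    CliffordAlgebra.reverse.map_one] at h1 h2 h3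
  simp only [CliffordAlgebra.reverse.map_mul, map_add, hrv, map_sub]
  have e1 : (vec y * reverse c + reverse d) * (vec X - vec Y) * (c * vec x + d) =
      (vec y * reverse c + reverse d) * (vec X * (c * vec x + d)) -
        ((vec y * reverse c + reverse d) * vec Y) * (c * vec x + d) := by noncomm_ring
  rw [e1, hx, hy']
  -- `ã c` and `d̃ b` are vectors, hence fixed by reversion, which kills the quadratic and the
  -- constant term; the two linear terms carry the determinant.
  have e2 : (vec y * reverse c + reverse d) * (a * vec x + b) -
      (vec y * reverse a + reverse b) * (c * vec x + d) =
      vec y * (reverse c * a - reverse a * c) * vec x +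
        (reverse d * a - reverse b * c) * vec x -
        vec y * (reverse a * d - reverse c * b) + (reverse d * b - reverse b * d) := by
    noncomm_ring
  rw [e2, h1, h3, hs, h2]
  simp [smul_sub]

variable {u v : Rn (m + 1)}

/-- `Ring.inverse` is 0 on non-units, which would force `ψ u = 0`, outside the open half space. -/
theorem IsUpperHalfMoebius.isUnit_denominator (h : IsUpperHalfMoebius a b c d ψ)
    (hu : u ∈ upperHalf m) :
    IsUnit (c * vec u + d) := by
  by_contra hn
  have h1 := h.2.2 u hu
  rw [Ring.inverse_non_unit _ hn, mul_zero] at h1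
  have h2 : ψ u = 0 := vec_injective (by rw [h1, map_zero])
  have h3 : 0 < ψ u (Fin.last m) := h.2.1 hu
  simp [h2] at h3

theorem IsUpperHalfMoebius.vec_mul_denominator (h : IsUpperHalfMoebius a b c d ψ)
    (hu : u ∈ upperHalf m) :
    vec (ψ u) * (c * vec u + d) = a * vec u + b := by
  rw [h.2.2 u hu, mul_assoc, Ring.inverse_mul_cancel _ (h.isUnit_denominator hu), mul_one]

theorem IsUpperHalfMoebius.denominator_ne_zero (h : IsUpperHalfMoebius a b c d ψ)
    (hu : u ∈ upperHalf m) : c * vec u + d ≠ 0 :=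
  (h.isUnit_denominator hu).ne_zero

/-- The determinant is `1`, and the last coordinate of `ψ u` is `u_n / ‖c u + d‖ ^ 2`. -/
theorem IsUpperHalfMoebius.last_coordinate (h : IsUpperHalfMoebius a b c d ψ)
    (hu : u ∈ upperHalf m) :
    reverse a * d - reverse c * b = 1 ∧
      ψ u (Fin.last m) * ‖c * vec u + d‖ ^ 2 = u (Fin.last m) := by
  obtain ⟨ε, hε⟩ := h.1.exists_isVecProd
  obtain ⟨s, hs1, hs⟩ : ∃ s : ℝ, (s = 1 ∨ s = -1) ∧
      reverse a * d - reverse c * b = s • (1 : Cl (m + 1)) := by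
    rcases h.1.det_eq with e | e
    · exact ⟨1, Or.inl rfl, by rw [e, one_smul]⟩
    · exact ⟨-1, Or.inr rfl, by rw [e, neg_smul, one_smul]⟩
  have hx := h.vec_mul_denominator hu
  -- The coefficients are fixed by the hat, so the same matrix sends `û` to the reflection of `ψ u`.
  -- The difference identity for the pair `u`, `û` involves only multiples of `e_n` and so reduces
  -- to a scalar equation.
  have hy := congrArg hatCl hx
  rw [map_mul, hatCl_vec, h.1.hatCl_denominator, h.1.hatCl_numerator] at hy
  have key := h.1.reverse_mul_sub_mul hs hx hy
  have hsub : ∀ x : Rn (m + 1), x - hatVec m x = (2 * x (Fin.last m)) • stdVec (Fin.last m) :=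
    fun x => by rw [hatVec_apply, sub_sub_cancel]
  have e1 := (hε (hatVec m u)).genLast_mul_hatCl
  rw [h.1.hatCl_denominator, hatVec_hatVec] at e1
  have hnorm : ‖c * vec (hatVec m u) + d‖ = ‖c * vec u + d‖ := by
    have := congrArg norm e1
    rw [norm_vec_mul, norm_smul, (hε (hatVec m u)).norm_mul, norm_gen] at this
    have hε1 : ‖ε‖ = 1 := by
      rcases mul_self_eq_one_iff.1 (hε u).sq_eq_one with e | e <;> simp [e]
    simpa [stdVec, hε1] using this.symm
  rw [hsub, hsub, map_smul, map_smul, mul_smul_comm, smul_mul_assoc, mul_assoc, e1, mul_smul_comm,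
    ← mul_assoc, (hε _).reverse_mul_self, smul_mul_assoc, one_mul, smul_smul, smul_smul, smul_smul,
    hnorm] at key
  have hg : genLast m ≠ 0 := by
    rw [← norm_ne_zero_iff, norm_gen]
    exact one_ne_zero
  have key2 := smul_left_injective ℝ hg key
  have key3 : ψ u (Fin.last m) * ‖c * vec u + d‖ ^ 2 = s * u (Fin.last m) := by
    have hεε := (hε u).sq_eq_one
    linear_combination (1 / 2) * key2 - ψ u (Fin.last m) * ‖c * vec u + d‖ ^ 2 * hεε
  have hp : 0 < ψ u (Fin.last m) * ‖c * vec u + d‖ ^ 2 := by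
    have h1 : 0 < ψ u (Fin.last m) := h.2.1 hu
    have h2 := norm_pos_iff.2 (h.denominator_ne_zero hu)
    positivity
  have hun : 0 < u (Fin.last m) := hu
  -- Determinant `-1` would make the last coordinate of `ψ u` negative.
  rcases hs1 with rfl | rfl
  · exact ⟨by rw [hs, one_smul], by rw [key3, one_mul]⟩
  · linarith

theorem IsUpperHalfMoebius.norm_sub (h : IsUpperHalfMoebius a b c d ψ)
    (hu : u ∈ upperHalf m) (hv : v ∈ upperHalf m) :
    ‖c * vec v + d‖ * ‖ψ u - ψ v‖ * ‖c * vec u + d‖ = ‖u - v‖ := by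
  obtain ⟨ε, hε⟩ := h.1.exists_isVecProd
  have := h.1.reverse_mul_sub_mul (s := 1) (by rw [(h.last_coordinate hu).1, one_smul])
    (h.vec_mul_denominator hu) (h.vec_mul_denominator hv)
  have := congrArg norm this
  rwa [one_smul, mul_assoc, (hε v).reverse.norm_mul, (hε v).norm_reverse, norm_vec_mul, norm_vec,
    ← mul_assoc] at this

/-- `ψ u - ψ v = (c v + d)^{~-1} (u - v) (c u + d)^{-1}`. -/
theorem IsUpperHalfMoebius.vec_sub (h : IsUpperHalfMoebius a b c d ψ)
    (hu : u ∈ upperHalf m) (hv : v ∈ upperHalf m) :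
    vec (ψ u) - vec (ψ v) = reverse (Ring.inverse (c * vec v + d)) * (vec u - vec v) *
      Ring.inverse (c * vec u + d) := by
  have key := h.1.reverse_mul_sub_mul (s := 1) (by rw [(h.last_coordinate hu).1, one_smul])
    (h.vec_mul_denominator hu) (h.vec_mul_denominator hv)
  have e1 := Ring.mul_inverse_cancel _ (h.isUnit_denominator hu)
  have e2 : reverse (Ring.inverse (c * vec v + d)) * reverse (c * vec v + d) = 1 := by
    rw [← CliffordAlgebra.reverse.map_mul, Ring.mul_inverse_cancel _ (h.isUnit_denominator hv),
      CliffordAlgebra.reverse.map_one]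
  rw [one_smul, map_sub, map_sub] at key
  rw [← key]
  simp only [mul_assoc, e1, mul_one]
  rw [← mul_assoc, e2, one_mul]

/-- The resolvent identity, from which the derivative of `(c u + d)⁻¹` is read off. -/
theorem IsUpperHalfMoebius.inverse_sub_inverse (h : IsUpperHalfMoebius a b c d ψ)
    (hu : u ∈ upperHalf m) (hv : v ∈ upperHalf m) :
    Ring.inverse (c * vec u + d) = Ring.inverse (c * vec v + d) -
      Ring.inverse (c * vec u + d) * (c * (vec u - vec v) * Ring.inverse (c * vec v + d)) := by
  have e1 := Ring.inverse_mul_cancel _ (h.isUnit_denominator hu)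
  have e2 := Ring.mul_inverse_cancel _ (h.isUnit_denominator hv)
  have : c * (vec u - vec v) = (c * vec u + d) - (c * vec v + d) := by noncomm_ring
  rw [this, sub_mul, e2, mul_sub, ← mul_assoc, e1]
  simp

/-- The denominator is `c (u + w)` unless `c = 0`, so its inverse is a multiple of `(u + w) c̃`, and
`c̃ c` is scalar. Being a vector, it can be summed by `sum_gen_mul_vec_mul_gen`. -/
theorem IsUpperHalfMoebius.exists_inverse_mul_eq_vec (h : IsUpperHalfMoebius a b c d ψ)
    (hu : u ∈ upperHalf m) :
    ∃ x : Rn (m + 1), Ring.inverse (c * vec u + d) * c = vec x := by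
  rcases h.1.denominator_eq with hc | ⟨w, -, hw⟩
  · exact ⟨0, by simp [hc]⟩
  · obtain ⟨ε, hε⟩ := h.1.exists_isVecProd
    obtain ⟨δ, hδ⟩ := IsVecProd.of_mem_closure h.1.c_mem
    rw [(hε u).inverse_eq (h.denominator_ne_zero hu)]
    set r := ε * (‖c * vec u + d‖ ^ 2)⁻¹
    refine ⟨(r * (δ * ‖c‖ ^ 2)) • (u + w), ?_⟩
    rw [hw, CliffordAlgebra.reverse.map_mul, CliffordAlgebra.reverse_ι, smul_mul_assoc, mul_assoc,
      hδ.reverse_mul_self, mul_smul_comm, mul_one, smul_smul, map_smul]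

end MoebiusAlgebra

/-! ### Calculus of Möbius transformations -/

section MoebiusCalculus

open Filter Topology
open CliffordAlgebra (reverse)

variable {m : ℕ} {a b c d : Cl (m + 1)} {ψ : Rn (m + 1) → Rn (m + 1)} {u v : Rn (m + 1)}

theorem isOpen_upperHalf (m : ℕ) : IsOpen (upperHalf m) :=
  isOpen_lt continuous_const (PiLp.continuous_apply 2 _ _)

theorem contDiff_denominator (c d : Cl (m + 1)) : ContDiff ℝ 1 fun u => c * vec u + d :=
  ((clMul (m + 1) c).comp (vecL (m + 1))).contDiff.add contDiff_const

theorem contDiff_norm_sq_cl {n : ℕ} : ContDiff ℝ 1 fun A : Cl n => ‖A‖ ^ 2 := by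
  simp only [← clInner_self]
  exact (LinearMap.toContinuousBilinearMap (clInner n)).contDiff.clm_apply contDiff_id

theorem ContDiffOn.cl_mul {n : ℕ} {E : Type*} [NormedAddCommGroup E] [NormedSpace ℝ E]
    {f g : E → Cl n} {s : Set E} (hf : ContDiffOn ℝ 1 f s) (hg : ContDiffOn ℝ 1 g s) :
    ContDiffOn ℝ 1 (fun x => f x * g x) s :=
  ((clMul n).contDiff.comp_contDiffOn hf).clm_apply hg

theorem exists_leftInverse_vec (n : ℕ) : ∃ w : Cl n →L[ℝ] Rn n, ∀ x, w (vec x) = x := by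
  obtain ⟨g, hg⟩ := LinearMap.exists_leftInverse_of_injective (vec (n := n))
    (LinearMap.ker_eq_bot.2 vec_injective)
  exact ⟨LinearMap.toContinuousLinearMap g, fun x => LinearMap.congr_fun hg x⟩

theorem IsUpperHalfMoebius.contDiffOn_inverse (h : IsUpperHalfMoebius a b c d ψ) :
    ContDiffOn ℝ 1 (fun u => Ring.inverse (c * vec u + d)) (upperHalf m) := by
  obtain ⟨ε, hε⟩ := h.1.exists_isVecProd
  have hq := (contDiff_denominator c d).contDiffOn (s := upperHalf m)
  refine ContDiffOn.congr (f := fun u => (ε * (‖c * vec u + d‖ ^ 2)⁻¹) • reverse (c * vec u + d))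
    ?_ fun u hu => (hε u).inverse_eq (h.denominator_ne_zero hu)
  refine ContDiffOn.smul (contDiffOn_const.mul (ContDiffOn.inv
    (contDiff_norm_sq_cl.comp_contDiffOn hq) fun u hu => ?_)) ?_
  · exact pow_ne_zero 2 (norm_ne_zero_iff.2 (h.denominator_ne_zero hu))
  · exact (LinearMap.toContinuousLinearMap (reverse (Q := negForm (m + 1)))).contDiff.comp_contDiffOn
      hq

theorem IsUpperHalfMoebius.contDiffOn (h : IsUpperHalfMoebius a b c d ψ) :
    ContDiffOn ℝ 1 ψ (upperHalf m) := by
  obtain ⟨w, hw⟩ := exists_leftInverse_vec (m + 1)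
  refine ContDiffOn.congr (f := fun u => w ((a * vec u + b) * Ring.inverse (c * vec u + d))) ?_
    fun u hu => by rw [← h.2.2 u hu, hw]
  exact w.contDiff.comp_contDiffOn ((contDiff_denominator a b).contDiffOn.cl_mul
    h.contDiffOn_inverse)

theorem IsUpperHalfMoebius.hasFDerivAt_inverse (h : IsUpperHalfMoebius a b c d ψ)
    (hu : u ∈ upperHalf m) :
    ∃ P : Rn (m + 1) →L[ℝ] Cl (m + 1),
      HasFDerivAt (fun u => Ring.inverse (c * vec u + d)) P u ∧
      ∀ x, P x = -(Ring.inverse (c * vec u + d) * c * vec x * Ring.inverse (c * vec u + d)) := by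
  set p := Ring.inverse (c * vec u + d) with hp
  have h1 : HasFDerivAt (fun u => Ring.inverse (c * vec u + d)) _ u :=
    ((h.contDiffOn_inverse.contDiffAt ((isOpen_upperHalf m).mem_nhds hu)).differentiableAt
      one_ne_zero).hasFDerivAt
  have h2 : HasFDerivAt (fun y => c * (vec y - vec u) * p)
      (((clMul (m + 1)).flip p).comp ((clMul (m + 1) c).comp (vecL (m + 1)))) u :=
    (((clMul (m + 1)).flip p).comp (clMul (m + 1) c)).hasFDerivAt.comp u
      ((vecL (m + 1)).hasFDerivAt.sub_const (vec u))
  have h3 := (h1.clMul h2).const_sub p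
  refine ⟨_, h3.congr_of_eventuallyEq ?_, fun x => ?_⟩
  · filter_upwards [(isOpen_upperHalf m).mem_nhds hu] with y hy
    exact h.inverse_sub_inverse hy hu
  · simp [← hp, mul_assoc]

theorem IsUpperHalfMoebius.hasFDerivAt (h : IsUpperHalfMoebius a b c d ψ)
    (hu : u ∈ upperHalf m) :
    ∃ T : Rn (m + 1) →L[ℝ] Rn (m + 1), HasFDerivAt ψ T u ∧
      ∀ x, vec (T x) =
        reverse (Ring.inverse (c * vec u + d)) * vec x * Ring.inverse (c * vec u + d) := by
  set p := Ring.inverse (c * vec u + d) with hp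
  have h1 : HasFDerivAt (fun u => Ring.inverse (c * vec u + d)) _ u :=
    ((h.contDiffOn_inverse.contDiffAt ((isOpen_upperHalf m).mem_nhds hu)).differentiableAt
      one_ne_zero).hasFDerivAt
  have h2 : HasFDerivAt (fun y => reverse p * (vec y - vec u))
      ((clMul (m + 1) (reverse p)).comp (vecL (m + 1))) u :=
    (clMul (m + 1) (reverse p)).hasFDerivAt.comp u
      ((vecL (m + 1)).hasFDerivAt.sub_const (vec u))
  have h3 := (h2.clMul h1).add_const (vec (ψ u))
  have h4 : HasFDerivAt (fun y => vec (ψ y)) _ u := h3.congr_of_eventuallyEq (by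
    filter_upwards [(isOpen_upperHalf m).mem_nhds hu] with y hy
    rw [hp, ← h.vec_sub hy hu, sub_add_cancel])
  have h5 : HasFDerivAt ψ _ u :=
    ((h.contDiffOn.contDiffAt ((isOpen_upperHalf m).mem_nhds hu)).differentiableAt
      one_ne_zero).hasFDerivAt
  have h6 : HasFDerivAt (fun y => vec (ψ y)) ((vecL (m + 1)).comp (fderiv ℝ ψ u)) u :=
    (vecL (m + 1)).hasFDerivAt.comp u h5
  refine ⟨_, h5, fun x => ?_⟩
  have := congrArg (fun S => S x) (h6.unique h4)
  simpa [← hp] using this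

/-- The Dirac operator may be computed in any orthonormal basis. -/
theorem sum_vec_mul_isometry {n : ℕ} (O : Rn n →ₗᵢ[ℝ] Rn n) (D : Rn n →L[ℝ] Cl n) :
    ∑ j, vec (O (stdVec j)) * D (O (stdVec j)) = ∑ j, gen j * D (stdVec j) := by
  let B : Rn n →ₗ[ℝ] Rn n →ₗ[ℝ] Cl n :=
    (LinearMap.mul ℝ (Cl n)).compl₁₂ vec D.toLinearMap
  let e := EuclideanSpace.basisFun (Fin n) ℝ
  have key : ∀ e : OrthonormalBasis (Fin n) ℝ (Rn n), ∑ j, vec (e j) * D (e j) =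
      TensorProduct.lift B (InnerProductSpace.canonicalCovariantTensor (Rn n)) := by
    intro e
    rw [InnerProductSpace.canonicalCovariantTensor_eq_sum (Rn n) e, map_sum]
    rfl
  have h1 := key e
  have h2 := key (e.map (O.toLinearIsometryEquiv rfl))
  rw [← h1] at h2
  simpa [e] using h2

theorem IsUpperHalfMoebius.norm_fderiv (h : IsUpperHalfMoebius a b c d ψ)
    (hu : u ∈ upperHalf m) {T : Rn (m + 1) →L[ℝ] Rn (m + 1)}
    (hT : ∀ x, vec (T x) =
      reverse (Ring.inverse (c * vec u + d)) * vec x * Ring.inverse (c * vec u + d))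
    (x : Rn (m + 1)) : ‖c * vec u + d‖ ^ 2 * ‖T x‖ = ‖x‖ := by
  obtain ⟨ε, hε⟩ := h.1.exists_isVecProd
  have e1 : reverse (c * vec u + d) * (vec (T x) * (c * vec u + d)) = vec x := by
    rw [hT, mul_assoc, mul_assoc, Ring.inverse_mul_cancel _ (h.isUnit_denominator hu), mul_one,
      ← mul_assoc, ← CliffordAlgebra.reverse.map_mul,
      Ring.inverse_mul_cancel _ (h.isUnit_denominator hu), CliffordAlgebra.reverse.map_one, one_mul]
  have := congrArg norm e1
  rw [(hε u).reverse.norm_mul, (hε u).norm_reverse, norm_vec_mul, norm_vec] at this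
  rw [← this]
  ring

theorem IsUpperHalfMoebius.weightJ_eq (h : IsUpperHalfMoebius a b c d ψ) {ε : ℝ}
    (hε : ∀ u, IsVecProd ε (c * vec u + d)) (hu : u ∈ upperHalf m) :
    weightJ c d u = ε • Ring.inverse (c * vec u + d) := by
  rw [(hε u).inverse_eq (h.denominator_ne_zero hu), smul_smul, ← mul_assoc, (hε u).sq_eq_one,
    one_mul, weightJ]

/-- The Dirac operator of `f ∘ ψ`, weighted by `(c u + d)^{-1}`. -/
theorem IsUpperHalfMoebius.sum_gen_mul_inverse_mul (h : IsUpperHalfMoebius a b c d ψ)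
    {ε : ℝ} (hε : ∀ u, IsVecProd ε (c * vec u + d)) (hu : u ∈ upperHalf m)
    {T : Rn (m + 1) →L[ℝ] Rn (m + 1)}
    (hT : ∀ x, vec (T x) =
      reverse (Ring.inverse (c * vec u + d)) * vec x * Ring.inverse (c * vec u + d))
    (D : Rn (m + 1) →L[ℝ] Cl (m + 1)) :
    ∑ j, gen j * (Ring.inverse (c * vec u + d) * D (T (stdVec j))) =
      (ε * (‖c * vec u + d‖ ^ 2)⁻¹) •
        (Ring.inverse (c * vec u + d) * ∑ j, gen j * D (stdVec j)) := by
  have hn : 0 < ‖c * vec u + d‖ := norm_pos_iff.2 (h.denominator_ne_zero hu)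
  have hN := h.norm_fderiv hu hT
  have hpq := Ring.inverse_mul_cancel _ (h.isUnit_denominator hu)
  have hp := (hε u).inverse_eq (h.denominator_ne_zero hu)
  have hεε := (hε u).sq_eq_one
  set q := c * vec u + d with hq
  set p := Ring.inverse q with hpdef
  -- The rescaled derivative of `ψ` is `O x = ε q x p`, an isometry with `x p = ε p (O x)`. This
  -- moves `p` to the left of the Dirac sum, which is then taken in the rotated orthonormal basis.
  let O : Rn (m + 1) →ₗᵢ[ℝ] Rn (m + 1) :=
    { toLinearMap := (‖q‖ ^ 2) • T.toLinearMap
      norm_map' := fun x => by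
        rw [← hN x]
        change ‖(‖q‖ ^ 2) • T x‖ = _
        rw [norm_smul, Real.norm_of_nonneg (sq_nonneg _)] }
  have hO : ∀ x, O x = (‖q‖ ^ 2) • T x := fun x => rfl
  have hrp : reverse p = (ε * (‖q‖ ^ 2)⁻¹) • q := by
    rw [hp, map_smul, CliffordAlgebra.reverse_reverse]
  have hterm : ∀ x, vec x * p = ε • (p * vec (O x)) := by
    intro x
    rw [hO, map_smul, hT, hrp, smul_mul_assoc, smul_mul_assoc, mul_smul_comm, mul_smul_comm,
      ← mul_assoc, ← mul_assoc, hpq, one_mul, smul_smul, smul_smul]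
    rw [show ε * ‖q‖ ^ 2 * (ε * (‖q‖ ^ 2)⁻¹) = ε * ε by field_simp, hεε, one_smul]
  rw [← sum_vec_mul_isometry O D, Finset.mul_sum, Finset.smul_sum]
  refine Finset.sum_congr rfl fun j _ => ?_
  rw [← mul_assoc, hterm, hO (stdVec j), map_smul D, mul_smul_comm, mul_smul_comm, smul_smul,
    smul_mul_assoc, mul_assoc]
  congr 1
  field_simp

/-- With `k = (m - 1)/(2 u_n)`, differentiating `f ∘ ψ` yields `ε k e_n p̂ (F - F̂)`, and
differentiating `p` yields `-ε k e_n (p̂ - p) F`. Their sum `ε k e_n (p F - p̂ F̂)` is what the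
equation for the transformed function demands. -/
theorem IsUpperHalfMoebius.isLeftHypermonogenicOn (h : IsUpperHalfMoebius a b c d ψ)
    {f : Rn (m + 1) → Cl (m + 1)} {U : Set (Rn (m + 1))} (hU : IsOpen U)
    (hf : IsLeftHypermonogenicOn f U) :
    IsLeftHypermonogenicOn (fun u => weightJ c d u * f (ψ u)) (upperHalf m ∩ ψ ⁻¹' U) := by
  obtain ⟨ε, hε⟩ := h.1.exists_isVecProd
  suffices ∀ u ∈ upperHalf m ∩ ψ ⁻¹' U,
      DifferentiableAt ℝ (fun u => weightJ c d u * f (ψ u)) u ∧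
        diracHodgeOp (fun u => weightJ c d u * f (ψ u)) u = 0 from
    ⟨fun u hu => (this u hu).1.differentiableWithinAt, fun u hu => (this u hu).2⟩
  rintro u ⟨hu, huU⟩
  obtain ⟨P, hP, hPx⟩ := h.hasFDerivAt_inverse hu
  obtain ⟨T, hT, hTx⟩ := h.hasFDerivAt hu
  have hfd : HasFDerivAt f (fderiv ℝ f (ψ u)) (ψ u) :=
    (hf.1.differentiableAt (hU.mem_nhds huU)).hasFDerivAt
  have hg := ((hP.clMul (hfd.comp u hT)).const_smul ε).congr_of_eventuallyEq
    (f₁ := fun u => weightJ c d u * f (ψ u)) (by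
      filter_upwards [(isOpen_upperHalf m).mem_nhds hu] with y hy
      rw [h.weightJ_eq hε hy, smul_mul_assoc]
      rfl)
  refine ⟨hg.differentiableAt, ?_⟩
  obtain ⟨x, hx⟩ := h.exists_inverse_mul_eq_vec hu
  have hsum := h.sum_gen_mul_inverse_mul hε hu hTx (fderiv ℝ f (ψ u))
  have hfM := hf.2 (ψ u) huU
  obtain ⟨-, hlast⟩ := h.last_coordinate hu
  have hun : u (Fin.last m) ≠ 0 := ne_of_gt hu
  have hψn : ψ u (Fin.last m) ≠ 0 := ne_of_gt (h.2.1 hu)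
  have hunit := h.isUnit_denominator hu
  have hqhat := h.1.hatCl_denominator u
  have hq0 : ‖c * vec u + d‖ ≠ 0 := norm_ne_zero_iff.2 (h.denominator_ne_zero hu)
  have hpε := (hε u).inverse_eq (h.denominator_ne_zero hu)
  have hD : diracOp (fun u => weightJ c d u * f (ψ u)) u =
      ε • (∑ j, gen j * (Ring.inverse (c * vec u + d) * fderiv ℝ f (ψ u) (T (stdVec j))) -
        (∑ j, gen j * vec x * gen j) * (Ring.inverse (c * vec u + d) * f (ψ u))) := by
    rw [diracOp, hg.fderiv, Finset.sum_mul, ← Finset.sum_sub_distrib, Finset.smul_sum]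
    refine Finset.sum_congr rfl fun j _ => ?_
    simp [hPx, hx, mul_assoc, mul_add, sub_eq_add_neg]
  set q := c * vec u + d with hq
  set p := Ring.inverse q with hp
  set F := f (ψ u) with hF
  have hgu : weightJ c d u = ε • p := h.weightJ_eq hε hu
  have hDf : diracOp f (ψ u) =
      (((m : ℝ) - 1) / (2 * ψ u (Fin.last m))) • (genLast m * (F - hatCl F)) := by
    rw [diracHodgeOp, projQ'_eq, smul_neg, smul_smul, ← sub_eq_add_neg, sub_eq_zero] at hfM
    rw [hfM]
    congr 1
    field_simp
  have hphat : genLast m * hatCl p = ε • (p * genLast m) := by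
    rw [hpε, map_smul, mul_smul_comm, (hε u).reverse.genLast_mul_hatCl, smul_mul_assoc, smul_comm]
  -- The resolvent identity between `q` and its reflection, whose difference is `2 u_n c e_n`.
  have hpp : hatCl p - p = hatCl p * c * ((2 * u (Fin.last m)) • (genLast m * p)) := by
    have e1 : hatCl p * hatCl q = 1 := by
      rw [← map_mul, hp, Ring.inverse_mul_cancel _ hunit, map_one]
    have e2 : q * p = 1 := Ring.mul_inverse_cancel _ hunit
    have e3 : q - hatCl q = (2 * u (Fin.last m)) • (c * genLast m) := by
      rw [hqhat, hq, add_sub_add_right_eq_sub, ← mul_sub, ← map_sub, hatVec_apply, sub_sub_cancel,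
        map_smul, mul_smul_comm]
    have e4 : hatCl p - p = hatCl p * (q - hatCl q) * p := by
      rw [mul_sub, sub_mul, mul_assoc, e2, e1, mul_one, one_mul]
    rw [e4, e3]
    simp only [mul_smul_comm, smul_mul_assoc, mul_assoc]
  have hkey : genLast m * (hatCl p - p) = (2 * u (Fin.last m)) • (vec x * p) := by
    have hc : hatCl c = c := hatCl_of_mem_subCl (mem_subCl_of_mem_closure h.1.c_mem)
    have e1 : hatCl p * c = hatCl (vec x) := by rw [← hx, map_mul, hc]
    rw [hpp, e1, mul_smul_comm, mul_smul_comm, ← mul_assoc, ← mul_assoc,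
      genLast_mul_hatCl_vec_mul_genLast]
  have hfin : diracOp (fun u => weightJ c d u * f (ψ u)) u =
      (((m : ℝ) - 1) / (2 * u (Fin.last m))) • ε •
        (genLast m * (p * F) - genLast m * (hatCl p * hatCl F)) := by
    have e1 : ε * (‖q‖ ^ 2)⁻¹ * (((m : ℝ) - 1) / (2 * ψ u (Fin.last m))) =
        ((m : ℝ) - 1) / (2 * u (Fin.last m)) * ε := by
      rw [← hlast]
      field_simp
    have e2 : ∑ j, gen j * fderiv ℝ f (ψ u) (stdVec j) = diracOp f (ψ u) := rfl
    have e3 : ((m + 1 : ℕ) : ℝ) - 2 = ((m : ℝ) - 1) / (2 * u (Fin.last m)) *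
        (2 * u (Fin.last m)) := by
      push_cast
      field_simp
      ring
    have e4 : ∀ A, ε • (p * (genLast m * A)) = genLast m * (hatCl p * A) := fun A => by
      rw [← mul_assoc, ← mul_assoc, hphat, smul_mul_assoc]
    have e5 : (2 * u (Fin.last m)) • (vec x * (p * F)) = genLast m * ((hatCl p - p) * F) := by
      rw [← mul_assoc, ← smul_mul_assoc, ← hkey, mul_assoc]
    rw [hD, hsum, sum_gen_mul_vec_mul_gen, e2, hDf, mul_smul_comm, smul_smul, e1, e3, mul_smul,
      mul_smul, smul_mul_assoc, smul_mul_assoc, e5, mul_sub, mul_sub, smul_sub ε (p * _), e4, e4,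
      ← smul_sub, smul_comm]
    congr 2
    noncomm_ring
  rw [diracHodgeOp, hfin, projQ'_eq, hgu]
  simp only [smul_mul_assoc, map_smul, map_mul, smul_neg, smul_smul, ← smul_sub, mul_smul_comm,
    mul_sub]
  rw [← sub_eq_add_neg, sub_eq_zero]
  congr 1
  field_simp

end MoebiusCalculus

/-! ### Preimages under Möbius transformations, and the transformed Cauchy formula -/

section MoebiusPreimage

open Filter Topology

variable {m : ℕ} {a b c d : Cl (m + 1)} {ψ : Rn (m + 1) → Rn (m + 1)} {K : Set (Rn (m + 1))}

theorem abs_last_le_norm (x : Rn (m + 1)) : |x (Fin.last m)| ≤ ‖x‖ := PiLp.norm_apply_le x _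

/-- Bounds for the last coordinate on a compact subset of upper half space. -/
theorem exists_last_bounds (hK : IsCompact K) (hKH : K ⊆ upperHalf m) :
    ∃ k₁ > 0, ∃ k₂ > 0, ∀ x ∈ K, k₁ ≤ x (Fin.last m) ∧ ‖x‖ ≤ k₂ := by
  have hc : Continuous fun x : Rn (m + 1) => x (Fin.last m) := PiLp.continuous_apply 2 _ _
  obtain ⟨k₁, hk₁, h1⟩ : ∃ k₁ > 0, ∀ x ∈ K, k₁ ≤ x (Fin.last m) := by
    rcases K.eq_empty_or_nonempty with rfl | hne
    · exact ⟨1, one_pos, by simp⟩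
    · obtain ⟨x, hx, hmin⟩ := hK.exists_isMinOn hne hc.continuousOn
      exact ⟨_, hKH hx, fun y hy => hmin hy⟩
  obtain ⟨k₂, hk₂, h2⟩ := hK.isBounded.exists_pos_norm_le
  exact ⟨k₁, hk₁, k₂, hk₂, fun x hx => ⟨h1 x hx, h2 x hx⟩⟩

/-- The preimage must not run off to infinity or to the boundary of the half space. Both are
excluded by `u_n = ψ(u)_n N(u)²` with `N(u) = ‖c u + d‖`, together with the distance formula
`norm_sub` relative to one fixed point `v` of the preimage. -/
theorem IsUpperHalfMoebius.isCompact_preimage (h : IsUpperHalfMoebius a b c d ψ)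
    (hK : IsCompact K) (hKH : K ⊆ upperHalf m) : IsCompact (upperHalf m ∩ ψ ⁻¹' K) := by
  rcases (upperHalf m ∩ ψ ⁻¹' K).eq_empty_or_nonempty with he | ⟨v, hv, hvK⟩
  · rw [he]
    exact isCompact_empty
  obtain ⟨k₁, hk₁, k₂, hk₂, hk⟩ := exists_last_bounds hK hKH
  have hvn : 0 < v (Fin.last m) := hv
  set N : Rn (m + 1) → ℝ := fun u => ‖c * vec u + d‖ with hN
  have hNv : 0 < N v := norm_pos_iff.2 (h.denominator_ne_zero hv)
  have hdist : ∀ u ∈ upperHalf m ∩ ψ ⁻¹' K, ‖u - v‖ ≤ 2 * k₂ * N v * N u := by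
    rintro u ⟨hu, huK⟩
    rw [← h.norm_sub hu hv]
    have h1 : ‖ψ u - ψ v‖ ≤ 2 * k₂ :=
      (_root_.norm_sub_le _ _).trans (by linarith [(hk _ huK).2, (hk _ hvK).2])
    have h2 : 0 ≤ N u := norm_nonneg _
    calc N v * ‖ψ u - ψ v‖ * N u ≤ N v * (2 * k₂) * N u := by gcongr
      _ = _ := by ring
  have hlow : ∃ δ > 0, ∀ u ∈ upperHalf m ∩ ψ ⁻¹' K, δ ≤ N u := by
    -- If `N u < 1` then `u_n ≤ k₂ N(u)`, while `v_n - u_n ≤ ‖u - v‖ ≤ 2 k₂ N(v) N(u)`. Adding these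
    -- bounds `N(u)` from below.
    refine ⟨min 1 (v (Fin.last m) / (k₂ + 2 * k₂ * N v)), lt_min one_pos (by positivity), ?_⟩
    rintro u ⟨hu, huK⟩
    by_contra! hlt
    have h0 : 0 < N u := norm_pos_iff.2 (h.denominator_ne_zero hu)
    have h1 := hdist u ⟨hu, huK⟩
    have h2 := (h.last_coordinate hu).2
    have h3 : ψ u (Fin.last m) ≤ k₂ := (le_abs_self _).trans
      ((abs_last_le_norm _).trans (hk _ huK).2)
    have h4 : v (Fin.last m) - u (Fin.last m) ≤ ‖u - v‖ := by
      have := abs_last_le_norm (u - v)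
      rw [PiLp.sub_apply] at this
      linarith [neg_abs_le (u (Fin.last m) - v (Fin.last m))]
    have h5 : u (Fin.last m) ≤ k₂ * N u := by
      rw [← h2]
      have h6 : N u ^ 2 ≤ N u := by
        nlinarith [hlt.le.trans (min_le_left _ _)]
      have h7 : 0 < ψ u (Fin.last m) := h.2.1 hu
      change ψ u (Fin.last m) * N u ^ 2 ≤ _
      gcongr
    have h8 := hlt.trans_le (min_le_right _ _)
    rw [lt_div_iff₀ (by positivity)] at h8
    nlinarith
  obtain ⟨δ, hδ, hδN⟩ := hlow
  have hup : ∃ B, ∀ u ∈ upperHalf m ∩ ψ ⁻¹' K, ‖u‖ ≤ B := by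
    rcases h.1.denominator_eq with hc | ⟨w, hw0, hw⟩
    · refine ⟨2 * k₂ * N v * ‖d‖ + ‖v‖, fun u hu => ?_⟩
      have h1 := hdist u hu
      have h2 : N u = ‖d‖ := by simp [hN, hc]
      rw [h2] at h1
      linarith [norm_sub_norm_le u v]
    · obtain ⟨ε, hε⟩ := IsVecProd.of_mem_closure h.1.c_mem
      have hNu : ∀ u, N u = ‖c‖ * ‖u + w‖ := fun u => by
        rw [hN]
        change ‖c * vec u + d‖ = _
        rw [hw, hε.norm_mul, norm_vec]
      have hc0 : 0 < ‖c‖ := by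
        have := hNu v
        by_contra hn
        have h0 : ‖c‖ = 0 := le_antisymm (not_lt.1 hn) (norm_nonneg _)
        rw [h0, zero_mul] at this
        exact hNv.ne' this
      refine ⟨(k₁ * ‖c‖ ^ 2)⁻¹ + ‖w‖, ?_⟩
      rintro u ⟨hu, huK⟩
      have h2 := (h.last_coordinate hu).2
      change ψ u (Fin.last m) * N u ^ 2 = _ at h2
      rw [hNu] at h2
      have hun : 0 < u (Fin.last m) := hu
      have h3 : u (Fin.last m) ≤ ‖u + w‖ := by
        have := (le_abs_self _).trans (abs_last_le_norm (u + w))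
        rwa [PiLp.add_apply, hw0, add_zero] at this
      have h4 : 0 < ‖u + w‖ := hun.trans_le h3
      -- For `c ≠ 0` the square `N(u)² = ‖c‖² ‖u + w‖²` grows quadratically, but `k₁ N(u)² ≤ u_n ≤
      -- ‖u + w‖` only linearly.
      have h5 : k₁ * ‖c‖ ^ 2 * ‖u + w‖ * ‖u + w‖ ≤ 1 * ‖u + w‖ := by
        calc k₁ * ‖c‖ ^ 2 * ‖u + w‖ * ‖u + w‖ = k₁ * (‖c‖ * ‖u + w‖) ^ 2 := by ring
          _ ≤ ψ u (Fin.last m) * (‖c‖ * ‖u + w‖) ^ 2 := by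
            gcongr
            exact (hk _ huK).1
          _ ≤ 1 * ‖u + w‖ := by rw [h2, one_mul]; exact h3
      have h6 := le_of_mul_le_mul_right h5 h4
      have h7 : ‖u + w‖ ≤ (k₁ * ‖c‖ ^ 2)⁻¹ := by
        rw [← one_div, le_div_iff₀ (by positivity)]
        linarith
      have h8 : ‖u‖ ≤ ‖u + w‖ + ‖w‖ := by
        calc ‖u‖ = ‖(u + w) - w‖ := by rw [add_sub_cancel_right]
          _ ≤ _ := _root_.norm_sub_le _ _
      linarith
  obtain ⟨B, hB⟩ := hup
  -- A closed half space inside the open one that contains the preimage; continuity of `ψ` on it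
  -- gives closedness in all of `R^n`.
  set S : Set (Rn (m + 1)) := {u | k₁ * δ ^ 2 ≤ u (Fin.last m)} with hS
  have hSc : IsClosed S := isClosed_le continuous_const (PiLp.continuous_apply 2 _ _)
  have hSH : S ⊆ upperHalf m := fun u hu => (show 0 < k₁ * δ ^ 2 by positivity).trans_le hu
  have heq : upperHalf m ∩ ψ ⁻¹' K = S ∩ ψ ⁻¹' K := by
    refine Subset.antisymm (fun u hu => ⟨?_, hu.2⟩) (inter_subset_inter_left _ hSH)
    change k₁ * δ ^ 2 ≤ _
    rw [← (h.last_coordinate hu.1).2]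
    have h1 := hδN u hu
    have h2 := (hk _ hu.2).1
    have h3 : 0 < ψ u (Fin.last m) := h.2.1 hu.1
    change _ ≤ _ * N u ^ 2
    gcongr
  refine Metric.isCompact_of_isClosed_isBounded ?_
    (isBounded_iff_forall_norm_le.2 ⟨B, hB⟩)
  rw [heq]
  exact (h.contDiffOn.continuousOn.mono hSH).preimage_isClosed_of_isClosed hSc hK.isClosed

/-- Defining functions pull back to `ρ ∘ ψ`. Their gradients stay nonzero because the derivative of
`ψ`, a multiple of an isometry, is surjective. -/
theorem IsUpperHalfMoebius.hasC1Boundary_preimage (h : IsUpperHalfMoebius a b c d ψ)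
    (hK : IsCompact K) (hKH : K ⊆ upperHalf m) (hKb : HasC1Boundary K) :
    HasC1Boundary (upperHalf m ∩ ψ ⁻¹' K) := by
  intro x hx
  have hxL : x ∈ upperHalf m ∩ ψ ⁻¹' K := (h.isCompact_preimage hK hKH).isClosed.frontier_subset hx
  have hψc := h.contDiffOn.continuousOn
  have hfr : ψ x ∈ frontier K := by
    refine ⟨subset_closure hxL.2, fun hint => hx.2 ?_⟩
    have ho := hψc.isOpen_inter_preimage (isOpen_upperHalf m) (isOpen_interior (s := K))
    exact interior_maximal (inter_subset_inter_right _ (preimage_mono interior_subset)) ho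
      ⟨hxL.1, hint⟩
  obtain ⟨W, ρ, hW, hxW, hρ, hgrad, hiff⟩ := hKb _ hfr
  refine ⟨upperHalf m ∩ ψ ⁻¹' W, ρ ∘ ψ, hψc.isOpen_inter_preimage (isOpen_upperHalf m) hW,
    ⟨hxL.1, hxW⟩, hρ.comp (h.contDiffOn.mono inter_subset_left) fun y hy => hy.2, ?_,
    fun y hy => ?_⟩
  · intro h0
    obtain ⟨T, hT, hTx⟩ := h.hasFDerivAt hxL.1
    have hρd : HasFDerivAt ρ (fderiv ℝ ρ (ψ x)) (ψ x) :=
      ((hρ.contDiffAt (hW.mem_nhds hxW)).differentiableAt one_ne_zero).hasFDerivAt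
    have h1 := (hρd.comp x hT).fderiv
    have h2 : fderiv ℝ (ρ ∘ ψ) x = 0 := (map_eq_zero_iff _ (LinearIsometryEquiv.injective _)).1 h0
    rw [h2] at h1
    have hinj : Function.Injective T.toLinearMap := by
      refine (injective_iff_map_eq_zero _).2 fun y hy => ?_
      have := h.norm_fderiv hxL.1 hTx y
      rw [show T y = 0 from hy, norm_zero, mul_zero] at this
      exact norm_eq_zero.1 this.symm
    have hsurj := LinearMap.injective_iff_surjective.1 hinj
    refine hgrad ((map_eq_zero_iff _ (LinearIsometryEquiv.injective _)).2 ?_)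
    ext z
    obtain ⟨y, rfl⟩ := hsurj z
    exact (congrArg (fun S => S y) h1).symm
  · rw [Function.comp_apply, ← hiff _ hy.2]
    exact and_iff_right hy.1

end MoebiusPreimage

theorem theorem15 (m : ℕ) (hm : 2 ≤ m)
    (a b c d : Cl (m + 1)) (ψ : Rn (m + 1) → Rn (m + 1)) (hψ : IsUpperHalfMoebius a b c d ψ)
    (U : Set (Rn (m + 1))) (hU : IsOpen U) (hUH : U ⊆ upperHalf m)
    (f : Rn (m + 1) → Cl (m + 1)) (hf : IsLeftHypermonogenicOn f U)
    (K : Set (Rn (m + 1))) (hK : IsCompact K) (hKU : K ⊆ U) (hKb : HasC1Boundary K)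
    (L : Set (Rn (m + 1))) (hL : L = {u ∈ upperHalf m | ψ u ∈ K})
    (v : Rn (m + 1)) (hv : v ∈ interior L) :
    IntegrableOn
        (fun u => kernelE u v * vec (outerNormal L u) * (weightJ c d u * f (ψ u)) -
          kernelF u v * vec (hatVec m (outerNormal L u)) *
            (hatCl (weightJ c d u) * hatCl (f (ψ u))))
        (frontier L) (surfaceMeasure m) ∧
      weightJ c d v * f (ψ v) =
        ((2 * v (Fin.last m)) ^ (m - 1) / sphereArea m) •
          ∫ u in frontier L,
            (kernelE u v * vec (outerNormal L u) * (weightJ c d u * f (ψ u)) -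
              kernelF u v * vec (hatVec m (outerNormal L u)) *
                (hatCl (weightJ c d u) * hatCl (f (ψ u)))) ∂(surfaceMeasure m) := by
  obtain rfl : L = upperHalf m ∩ ψ ⁻¹' K := hL
  have hKH := hKU.trans hUH
  -- Cauchy's formula for `u ↦ weightJ c d u * f (ψ u)`; the hat is multiplicative, so it splits
  -- over this product.
  have key := cauchy_formula (by omega)
    (hψ.contDiffOn.continuousOn.isOpen_inter_preimage (isOpen_upperHalf m) hU) inter_subset_left
    (hψ.isLeftHypermonogenicOn hU hf) (hψ.isCompact_preimage hK hKH)
    (inter_subset_inter_right _ (preimage_mono hKU)) (hψ.hasC1Boundary_preimage hK hKH hKb) hv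
  simpa only [cauchyField_apply, map_mul] using key
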